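/- **Setting.** For $s\in\mathbb R$ let $\dot H^s(\mathbb T;\mathbb C)$ be the Sobolev space of zero-average functions $u(x)=\sum_{j\ne0}\hat u(j)\frac{e^{ijx}}{\sqrt{2\pi}}$ on $\mathbb T=\mathbb R/2\pi\mathbb Z$, with norm $\|u\|_s^2=\sum_{j\neq 0}|\hat u(j)|^2|j|^{2s}$ (also used for pairs of functions), and let $\dot H^\infty=\bigcap_s\dot H^s$. For $n\in\mathbb N=\{1,2,\dots\}$ let $\Pi_n$ be the projector on $\mathrm{span}\{e^{inx},e^{-inx}\}$, and let $\tau_\varsigma u(x)=u(x+\varsigma)$. On $\dot H^\infty(\mathbb T;\mathbb C^2)$, whose elements are written $U=(u^+,u^-)$, put $\langle V,W\rangle_r=\int v^+w^+\,dx+\int v^-w^-\,dx$, $E_c=\begin{pmatrix}0&-i\\ i&0\end{pmatrix}$ and $\Omega_c(V,W)=\langle E_cV,W\rangle_r$; transposes are taken with respect to $\langle\cdot,\cdot\rangle_r$. The real subspace consists of the pairs $(u,\bar u)$. A $U$-dependent matrix of operators $A(U)$ is *real-to-real* if for every $U$ in the real subspace it has the form $\begin{pmatrix}R_1&R_2\\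 \overline{R_2}&\overline{R_1}\end{pmatrix}$, where $\overline R[v]:=\overline{R[\bar v]}$. **Homogeneous operators.** For $q\in\mathbb N$ and $m\in\mathbb R$, $\widetilde{\mathcal M}^m_q$ is the space of continuous $(q+1)$-linear maps $M(U_1,\dots,U_q)V$ from $\dot H^\infty(\mathbb T;\mathbb C^2)^q\times\dot H^\infty(\mathbb T;\mathbb C)$ to $\dot H^\infty(\mathbb T;\mathbb C)$, symmetric in $U_1,\dots,U_q$, with the following properties. * There are $\mu\ge0$, $C>0$ such that for all $n_0,\dots,n_{q+1}\in\mathbb N$ and all $U_1,\dots,U_q,V$ $$\|\Pi_{n_0}M(\Pi_{n_1}U_1,\dots,\Pi_{n_q}U_q)\Pi_{n_{q+1}}V\|_{L^2}\le C\,{\max}_2(n_1,\dots,n_{q+1})^\mu\max(n_1,\dots,n_{q+1})^m\prod_{j=1}^q\|\Pi_{n_j}U_j\|_{L^2}\,\|\Pi_{n_{q+1}}V\|_{L^2},$$ where $\max_2$ is the second largest entry. * If $\Pi_{n_0}M(\Pi_{n_1}U_1,\dots,\Pi_{n_q}U_q)\Pi_{n_{q+1}}V\ne0$, then $\sum_{j=0}^{q+1}\sigma_jn_j=0$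 for some signs $\sigma_j\in\{\pm1\}$. * $M(\tau_\varsigma U_1,\dots,\tau_\varsigma U_q)\tau_\varsigma V=\tau_\varsigma(M(U_1,\dots,U_q)V)$ for all $\varsigma\in\mathbb R$. Write $M(U)=M(U,\dots,U)$, $\widetilde{\mathcal M}_q=\bigcup_{m\ge0}\widetilde{\mathcal M}_q^m$ and $\widetilde{\mathcal R}^{-\varrho}_q=\widetilde{\mathcal M}_q^{-\varrho}$ for $\varrho\ge0$ ($\varrho$-smoothing operators). The space $\widetilde{\mathcal S}^m_q\subset\widetilde{\mathcal M}^m_q$ of *spectrally localized* maps consists of those $M$ for which there are $\delta>0$, $C>1$ such that a nonzero block as in the second item forces $\max(n_1,\dots,n_q)\le\delta n_{q+1}$ and $C^{-1}n_0\le n_{q+1}\le Cn_0$; and $\widetilde{\mathcal S}_q=\bigcup_m\widetilde{\mathcal S}^m_q$. For a class of operators, $\Sigma_p^N$ denotes the finite sums over the degrees $q=p,\dots,N$ of elements of the class of degree $q$, $\Sigma_p=\bigcup_N\Sigma_p^N$, and $\otimes\mathcal M_2(\mathbb C)$ denotes $2\times2$ matrices with entries in the class. **Linearly symplectic up to homogeneity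 $N$.** A matrix $\mathbf B(U)$ of operators is linearly symplectic up to homogeneity $N$ if it is real-to-real and there are $s_0,r>0$ and $m\in\mathbb R$ such that, for $\|U\|_{s_0}<r$, $$\mathbf B(U)^\top E_c\,\mathbf B(U)=E_c+S_{>N}(U),$$ where the entries $S$ of the matrix $S_{>N}$ are linear in $V$ and satisfy: for every $s\in\mathbb R$ there are $C>0$ and $r(s)\in(0,r)$ with $\|S(U)V\|_{s-m}\le C\|U\|_{s_0}^{N+1}\|V\|_s$ whenever $\|U\|_{s_0}<r(s)$. **Symplectic up to homogeneity $N$.** A map $\mathcal D(U)=U+\sum_{q=p}^LM_q(U)U$ with $L\ge N$ and $M_q\in\widetilde{\mathcal M}_q\otimes\mathcal M_2(\mathbb C)$ is symplectic up to homogeneity $N$ if $\mathcal D_{\le N}(U):=U+\sum_{q=p}^NM_q(U)U$ satisfies $(\mathcal D_{\le N})^*\Omega_c=\Omega_c+\Omega_{>N}$, where $\Omega_{>N}$ is a finite sum of $q$-homogeneous $2$-forms with $q\ge N+1$. Here $(\mathcal D^*\Omega_c)(U)[V,W]=\Omega_c(d_U\mathcal D(U)V,d_U\mathcal D(U)W)$,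 and a $q$-homogeneous $2$-form is a continuous $(q+2)$-linear map $\Lambda(U_1,\dots,U_q)[V_1,V_2]\in\mathbb C$ on $\dot H^\infty(\mathbb T;\mathbb C^2)$, symmetric in the $U_i$, antisymmetric in $V_1,V_2$, real on the real subspace, invariant under $\tau_\varsigma$ (applied to all arguments), such that for some $C>0$, $m\ge0$ its value at $(\Pi_{n_1}U_1,\dots,\Pi_{n_q}U_q)[\Pi_{n_{q+1}}V_1,\Pi_{n_{q+2}}V_2]$ is bounded by $C\max(n_1,\dots,n_{q+2})^m$ times the product of the $L^2$ norms of the arguments and is nonzero only if $\sum_{j=1}^{q+2}\sigma_jn_j=0$ for some signs $\sigma_j$. **Theorem 4.1 (symplectic correction up to homogeneity $N$).** Let $p,N\in\mathbb N$ with $1\le p\le N$ and $\Phi_{\le N}(U):=\mathbf B_{\le N}(U)U$, where 1. $\mathbf B_{\le N}(U)-\mathrm{Id}\in\Sigma_p^N\widetilde{\mathcal S}_q\otimes\mathcal M_2(\mathbb C)$; 2. $\mathbf B_{\le N}(U)$ is linearly symplectic up to homogeneity $N$. Then there is a real-to-real matrix of pluri-homogeneous operators $R_{\le N}(W)$, belonging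 to $\Sigma_p^N\widetilde{\mathcal R}_q^{-\varrho}\otimes\mathcal M_2(\mathbb C)$ for every $\varrho\ge0$ (the same $R_{\le N}$ for all $\varrho$), such that, with $\mathcal C_{\le N}(W)=W+R_{\le N}(W)W$, the map $$\mathcal D_N(U):=(\mathcal C_{\le N}\circ\Phi_{\le N})(U)=\big(\mathrm{Id}+R_{\le N}(\Phi_{\le N}(U))\big)\Phi_{\le N}(U)$$ has the form $\mathcal D_N(U)=U+\sum_{q=p}^LM_q(U)U$ with $L\ge N$ and $M_q\in\widetilde{\mathcal M}_q\otimes\mathcal M_2(\mathbb C)$, and is symplectic up to homogeneity $N$. -/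

import Mathlib

noncomputable section

namespace PluriHom

open scoped BigOperators

/-! ## Function spaces on the torus, on the Fourier side -/

/-- The space `Ḣ^∞(𝕋; ℂ) = ⋂ₛ Ḣˢ(𝕋; ℂ)`. A zero-average function `u` is represented by its Fourier
coefficients `u j = (2π)^(-1/2) ∫ u(x) e^{-ijx} dx`, so `u(x) = ∑ⱼ u j e^{ijx} / √(2π)`, `u 0 = 0`,
and `‖u‖²_{Ḣˢ} = ∑_{j ≠ 0} |u j|² |j|^{2s}` is finite for every real `s`. -/
def Hinf : Submodule ℂ (ℤ → ℂ) where
  carrier := {u | u 0 = 0 ∧ ∀ s : ℝ, Summable fun j : ℤ => ‖u j‖ ^ 2 * |(j : ℝ)| ^ (2 * s)}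
  zero_mem' := by
    refine ⟨rfl, fun s => ?_⟩
    simp
  add_mem' := by
    rintro u v ⟨hu0, hu⟩ ⟨hv0, hv⟩
    refine ⟨by simp [hu0, hv0], fun s => ?_⟩
    refine Summable.of_nonneg_of_le (fun j => by positivity) (fun j => ?_)
      (((hu s).mul_left 2).add ((hv s).mul_left 2))
    have h1 : ‖u j + v j‖ ≤ ‖u j‖ + ‖v j‖ := norm_add_le _ _
    have h2 : ‖u j + v j‖ ^ 2 ≤ 2 * ‖u j‖ ^ 2 + 2 * ‖v j‖ ^ 2 := by
      nlinarith [norm_nonneg (u j + v j), sq_nonneg (‖u j‖ - ‖v j‖)]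
    have h3 : 0 ≤ |(j : ℝ)| ^ (2 * s) := by positivity
    calc ‖(u + v) j‖ ^ 2 * |(j : ℝ)| ^ (2 * s)
        ≤ (2 * ‖u j‖ ^ 2 + 2 * ‖v j‖ ^ 2) * |(j : ℝ)| ^ (2 * s) :=
          mul_le_mul_of_nonneg_right h2 h3
      _ = 2 * (‖u j‖ ^ 2 * |(j : ℝ)| ^ (2 * s)) + 2 * (‖v j‖ ^ 2 * |(j : ℝ)| ^ (2 * s)) := by
          ring
  smul_mem' := by
    rintro c u ⟨hu0, hu⟩
    refine ⟨by simp [hu0], fun s => ?_⟩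
    have h := (hu s).mul_left (‖c‖ ^ 2)
    refine h.congr (fun j => ?_)
    simp only [Pi.smul_apply, smul_eq_mul, norm_mul]
    ring

/-- A coefficientwise operation that does not increase any `|u j|` beyond `|v j|` stays in `Ḣ^∞`. -/
theorem mem_Hinf_of_le {u v : ℤ → ℂ} (hv : v ∈ Hinf) (h : ∀ j, ‖u j‖ ≤ ‖v j‖) : u ∈ Hinf := by
  refine ⟨?_, fun s => ?_⟩
  · have h0 := h 0
    rw [hv.1, norm_zero] at h0
    exact norm_le_zero_iff.mp h0
  · refine Summable.of_nonneg_of_le (fun j => by positivity) (fun j => ?_) (hv.2 s)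
    have := h j
    gcongr

/-- `Ḣ^∞(𝕋; ℂ²)`: pairs `U = (u⁺, u⁻)`; the index `0` is `+` and the index `1` is `-`. -/
abbrev Hinf2 : Type := Fin 2 → Hinf

/-- The norm of `Ḣˢ(𝕋; ℂ)`; for `s = 0` it is the `L²` norm. -/
def sobNorm (s : ℝ) (u : Hinf) : ℝ :=
  Real.sqrt (∑' j : ℤ, ‖u.1 j‖ ^ 2 * |(j : ℝ)| ^ (2 * s))

/-- The norm of `Ḣˢ(𝕋; ℂ²)`. -/
def sobNorm2 (s : ℝ) (U : Hinf2) : ℝ :=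
  Real.sqrt (sobNorm s (U 0) ^ 2 + sobNorm s (U 1) ^ 2)

/-- The projector `Πₙ` on the span of `e^{inx}` and `e^{-inx}`. -/
def proj (n : ℕ) (u : Hinf) : Hinf :=
  ⟨fun j => if j.natAbs = n then u.1 j else 0,
    mem_Hinf_of_le u.2 (fun j => by split_ifs <;> simp)⟩

/-- `Πₙ` on pairs. -/
def proj2 (n : ℕ) (U : Hinf2) : Hinf2 := fun σ => proj n (U σ)

/-- The translation `(τ_ς u)(x) = u(x + ς)`. -/
def trans (ς : ℝ) (u : Hinf) : Hinf :=
  ⟨fun j => Complex.exp (((j * ς : ℝ) : ℂ) * Complex.I) * u.1 j,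
    mem_Hinf_of_le u.2 (fun j => by
      rw [norm_mul, Complex.norm_exp_ofReal_mul_I, one_mul])⟩

/-- `τ_ς` on pairs. -/
def trans2 (ς : ℝ) (U : Hinf2) : Hinf2 := fun σ => trans ς (U σ)

/-- The complex conjugate function `x ↦ conj (u x)`; its coefficients are `conj (u (-j))`. -/
def conjH (u : Hinf) : Hinf :=
  ⟨fun j => (starRingEnd ℂ) (u.1 (-j)), by
    refine ⟨by simp [u.2.1], fun s => ?_⟩
    have h := (Equiv.neg ℤ).summable_iff.mpr (u.2.2 s)
    refine h.congr (fun j => ?_)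
    simp⟩

/-- The real subspace of pairs of the form `(u, conj u)`. -/
def IsRealPair (U : Hinf2) : Prop := U 1 = conjH (U 0)

/-- The non-degenerate bilinear form `⟨V, W⟩_r = ∫ v⁺ w⁺ dx + ∫ v⁻ w⁻ dx`
(no complex conjugation), where `∫ v w dx = ∑ⱼ v j * w (-j)`. -/
def bilin (V W : Hinf2) : ℂ :=
  ∑ σ : Fin 2, ∑' j : ℤ, (V σ).1 j * (W σ).1 (-j)

/-! ## Matrices of operators -/

/-- `2 × 2` matrices of linear operators on `Ḣ^∞(𝕋; ℂ)`. -/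
abbrev LinMat : Type := Matrix (Fin 2) (Fin 2) (Module.End ℂ Hinf)

/-- The action of a matrix of operators on a pair. -/
def LinMat.act (A : LinMat) (V : Hinf2) : Hinf2 := fun σ => ∑ σ' : Fin 2, A σ σ' (V σ')

/-- The symplectic operator `E_c = [[0, -i], [i, 0]]`. -/
def Ec : LinMat := !![0, -(Complex.I • (1 : Module.End ℂ Hinf)); Complex.I • 1, 0]

/-- The symplectic form `Ω_c(V, W) = ⟨E_c V, W⟩_r`. -/
def Omegac (V W : Hinf2) : ℂ := bilin (Ec.act V) W

/-- A `U`-dependent matrix of operators is real-to-real if, for every `U` in the real subspace, it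
has the form `[[R₁, R₂], [conj R₂, conj R₁]]`, with `(conj R) v = conj (R (conj v))`. -/
def RealToReal (A : Hinf2 → LinMat) : Prop :=
  ∀ U, IsRealPair U → ∀ v : Hinf,
    A U 1 1 v = conjH (A U 0 0 (conjH v)) ∧ A U 1 0 v = conjH (A U 0 1 (conjH v))

/-! ## Homogeneous operators -/

/-- `(p+1)`-linear operators `(U₁, …, U_p, V) ↦ M(U₁, …, U_p) V`. -/
abbrev HomOp (p : ℕ) : Type := MultilinearMap ℂ (fun _ : Fin p => Hinf2) (Module.End ℂ Hinf)

/-- The largest entry of a tuple. -/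
def maxOne {r : ℕ} (n : Fin r → ℕ) : ℕ := Finset.univ.sup n

/-- The second largest entry of a tuple, counted with multiplicity. -/
def maxTwo {r : ℕ} (n : Fin r → ℕ) : ℕ :=
  (Finset.univ : Finset (Fin r)).offDiag.sup fun ij => min (n ij.1) (n ij.2)

/-- The frequency block `Π_{n₀} M(Π_{n₁} U₁, …, Π_{n_p} U_p) Π_{n_{p+1}} V`; the entries of `n` are
`n₁, …, n_{p+1}` and the last of them is the frequency of `V`. -/
def block {p : ℕ} (M : HomOp p) (n₀ : ℕ) (n : Fin (p + 1) → ℕ) (U : Fin p → Hinf2) (V : Hinf) :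
    Hinf :=
  proj n₀ (M (fun i => proj2 (n i.castSucc) (U i)) (proj (n (Fin.last p)) V))

/-- The class of `p`-homogeneous `m`-operators. The field `bounded` is the continuity of the
multilinear map for the Fréchet topology of `Ḣ^∞`: it says that `M` is determined by
its frequency blocks. -/
structure IsHomOp {p : ℕ} (m : ℝ) (M : HomOp p) : Prop where
  symm : ∀ (π : Equiv.Perm (Fin p)) (U : Fin p → Hinf2), M (fun i => U (π i)) = M U
  bounded : ∀ s : ℝ, ∃ s' C : ℝ, ∀ (U : Fin p → Hinf2) (V : Hinf),
    sobNorm s (M U V) ≤ C * (∏ i, sobNorm2 s' (U i)) * sobNorm s' V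
  estimate : ∃ μ C : ℝ, 0 ≤ μ ∧ 0 < C ∧
    ∀ (n₀ : ℕ) (n : Fin (p + 1) → ℕ) (U : Fin p → Hinf2) (V : Hinf), 1 ≤ n₀ → (∀ i, 1 ≤ n i) →
      sobNorm 0 (block M n₀ n U V) ≤
        C * (maxTwo n : ℝ) ^ μ * (maxOne n : ℝ) ^ m *
          ((∏ i : Fin p, sobNorm2 0 (proj2 (n i.castSucc) (U i))) *
            sobNorm 0 (proj (n (Fin.last p)) V))
  momentum : ∀ (n₀ : ℕ) (n : Fin (p + 1) → ℕ) (U : Fin p → Hinf2) (V : Hinf),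
    1 ≤ n₀ → (∀ i, 1 ≤ n i) → block M n₀ n U V ≠ 0 →
      ∃ (ε₀ : ℤˣ) (ε : Fin (p + 1) → ℤˣ),
        (ε₀ : ℤ) * (n₀ : ℤ) + ∑ i, (ε i : ℤ) * (n i : ℤ) = 0
  translation : ∀ (ς : ℝ) (U : Fin p → Hinf2) (V : Hinf),
    M (fun i => trans2 ς (U i)) (trans ς V) = trans ς (M U V)

/-- The class of spectrally localized `p`-homogeneous maps of order `m`. -/
structure IsSpecLoc {p : ℕ} (m : ℝ) (M : HomOp p) : Prop extends IsHomOp m M where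
  spectral : ∃ δ C : ℝ, 0 < δ ∧ 1 < C ∧
    ∀ (n₀ : ℕ) (n : Fin (p + 1) → ℕ) (U : Fin p → Hinf2) (V : Hinf), 1 ≤ n₀ → (∀ i, 1 ≤ n i) →
      block M n₀ n U V ≠ 0 →
        (∀ i : Fin p, (n i.castSucc : ℝ) ≤ δ * n (Fin.last p)) ∧
        C⁻¹ * n₀ ≤ n (Fin.last p) ∧ (n (Fin.last p) : ℝ) ≤ C * n₀

/-- `2 × 2` matrices of `(p+1)`-linear operators. -/
abbrev OpMat (p : ℕ) : Type := Matrix (Fin 2) (Fin 2) (HomOp p)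

/-- `M(U) = M(U, …, U)`. -/
def OpMat.eval {p : ℕ} (M : OpMat p) (U : Hinf2) : LinMat := fun σ σ' => M σ σ' (fun _ => U)

/-- `d_U M(U)[V] = ∑ᵢ M(U, …, V, …, U)`, with `V` in the `i`-th internal slot. -/
def OpMat.dEval {p : ℕ} (M : OpMat p) (U V : Hinf2) : LinMat :=
  fun σ σ' => (M σ σ').linearDeriv (fun _ => U) (fun _ => V)

/-- Matrices with entries in the union over `m ≥ 0` of the classes of `m`-operators. -/
def OpMat.IsOp {p : ℕ} (M : OpMat p) : Prop := ∃ m : ℝ, 0 ≤ m ∧ ∀ σ σ', IsHomOp m (M σ σ')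

/-- Matrices with entries in the union over `m` of the classes of spectrally localized maps. -/
def OpMat.IsLoc {p : ℕ} (M : OpMat p) : Prop := ∃ m : ℝ, ∀ σ σ', IsSpecLoc m (M σ σ')

/-- Matrices of `ϱ`-smoothing operators, that is, of operators of order `-ϱ`. -/
def OpMat.IsSmoothing {p : ℕ} (ϱ : ℝ) (M : OpMat p) : Prop := ∀ σ σ', IsHomOp (-ϱ) (M σ σ')

/-- The pluri-homogeneous matrix of operators `∑_{q=p}^N M_q(U)`. -/
def pluri (p N : ℕ) (M : (q : ℕ) → OpMat q) (U : Hinf2) : LinMat :=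
  ∑ q ∈ Finset.Icc p N, (M q).eval U

/-- The nonlinear map `U ↦ U + ∑_{q=p}^N M_q(U) U`. -/
def pluriMap (p N : ℕ) (M : (q : ℕ) → OpMat q) (U : Hinf2) : Hinf2 :=
  LinMat.act (1 + pluri p N M U) U

/-- The differential of `U ↦ U + ∑_{q=p}^N M_q(U) U` at `U` in the direction `V`, that is,
`V + ∑_{q=p}^N (M_q(U) V + d_U M_q(U)[V] U)`. -/
def dPluriMap (p N : ℕ) (M : (q : ℕ) → OpMat q) (U V : Hinf2) : Hinf2 :=
  LinMat.act (1 + pluri p N M U) V + ∑ q ∈ Finset.Icc p N, LinMat.act ((M q).dEval U V) U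

/-! ## Linearly symplectic maps up to homogeneity `N` -/

/-- Not necessarily homogeneous spectrally localized maps `S(U)` of order `m`, vanishing at order
`p` at `U = 0`, defined for `‖U‖_{Ḣ^{s₀}} < r` and not depending on time. -/
def IsNonhomSpecLoc (p : ℕ) (s₀ r m : ℝ) (S : Hinf2 → Module.End ℂ Hinf) : Prop :=
  ∀ s : ℝ, ∃ C rs : ℝ, 0 < C ∧ 0 < rs ∧ rs < r ∧
    ∀ (U : Hinf2) (V : Hinf), sobNorm2 s₀ U < rs →
      sobNorm (s - m) (S U V) ≤ C * sobNorm2 s₀ U ^ p * sobNorm s V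

/-- `B(U)` is real-to-real and `B(U)ᵀ E_c B(U) = E_c + S_{>N}(U)` near `U = 0`, where `S_{>N}` is a
matrix of spectrally localized maps vanishing at order `N + 1`. The transpose is the one of the
bilinear form `⟨ , ⟩_r`, and the identity of operators is tested against all `V`, `W`. -/
def LinSymplecticUpTo (N : ℕ) (B : Hinf2 → LinMat) : Prop :=
  RealToReal B ∧
  ∃ (s₀ r m : ℝ) (S : Hinf2 → LinMat), 0 < s₀ ∧ 0 < r ∧
    (∀ σ σ', IsNonhomSpecLoc (N + 1) s₀ r m (fun U => S U σ σ')) ∧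
    ∀ U : Hinf2, sobNorm2 s₀ U < r → ∀ V W : Hinf2,
      bilin (Ec.act ((B U).act V)) ((B U).act W) =
        bilin (Ec.act V) W + bilin ((S U).act V) W

/-! ## Homogeneous `2`-forms and symplectic maps up to homogeneity `N` -/

/-- `(r+2)`-linear maps `(U₁, …, U_r, V₁, V₂) ↦ Λ(U₁, …, U_r)[V₁, V₂]`. -/
abbrev Form2 (r : ℕ) : Type :=
  MultilinearMap ℂ (fun _ : Fin r => Hinf2) (Hinf2 →ₗ[ℂ] Hinf2 →ₗ[ℂ] ℂ)

/-- The class of `r`-homogeneous `2`-forms. As for operators, `bounded` is the continuity of the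
multilinear map. -/
structure IsForm2 {r : ℕ} (Λ : Form2 r) : Prop where
  symm : ∀ (π : Equiv.Perm (Fin r)) (U : Fin r → Hinf2), Λ (fun i => U (π i)) = Λ U
  antisymm : ∀ (U : Fin r → Hinf2) (V W : Hinf2), Λ U V W = -Λ U W V
  bounded : ∃ s C : ℝ, ∀ (U : Fin r → Hinf2) (V W : Hinf2),
    ‖Λ U V W‖ ≤ C * (∏ i, sobNorm2 s (U i)) * sobNorm2 s V * sobNorm2 s W
  estimate : ∃ m C : ℝ, 0 ≤ m ∧ 0 < C ∧
    ∀ (n : Fin r → ℕ) (k l : ℕ) (U : Fin r → Hinf2) (V W : Hinf2),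
      (∀ i, 1 ≤ n i) → 1 ≤ k → 1 ≤ l →
      ‖Λ (fun i => proj2 (n i) (U i)) (proj2 k V) (proj2 l W)‖ ≤
        C * ((max (maxOne n) (max k l) : ℕ) : ℝ) ^ m *
          ((∏ i, sobNorm2 0 (proj2 (n i) (U i))) *
            sobNorm2 0 (proj2 k V) * sobNorm2 0 (proj2 l W))
  momentum : ∀ (n : Fin r → ℕ) (k l : ℕ) (U : Fin r → Hinf2) (V W : Hinf2),
    (∀ i, 1 ≤ n i) → 1 ≤ k → 1 ≤ l →
    Λ (fun i => proj2 (n i) (U i)) (proj2 k V) (proj2 l W) ≠ 0 →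
      ∃ (ε : Fin r → ℤˣ) (η θ : ℤˣ),
        ∑ i, (ε i : ℤ) * (n i : ℤ) + (η : ℤ) * (k : ℤ) + (θ : ℤ) * (l : ℤ) = 0
  translation : ∀ (ς : ℝ) (U : Fin r → Hinf2) (V W : Hinf2),
    Λ (fun i => trans2 ς (U i)) (trans2 ς V) (trans2 ς W) = Λ U V W
  real : ∀ (U : Fin r → Hinf2) (V W : Hinf2),
    (∀ i, IsRealPair (U i)) → IsRealPair V → IsRealPair W → (Λ U V W).im = 0

/-- The map `D` has the form `D(U) = U + ∑_{q=p}^L M_q(U) U` with `L ≥ N` and `M_q` matrices of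
`q`-homogeneous operators, and its truncation `D_{≤N}(U) = U + ∑_{q=p}^N M_q(U) U` satisfies
`(D_{≤N})^* Ω_c = Ω_c + Ω_{>N}`, where `Ω_{>N} = ∑_{q=N+1}^{L'} Ω_q` is a pluri-homogeneous `2`-form
whose components have degrees at least `N + 1`. -/
def SymplecticUpTo (p N : ℕ) (D : Hinf2 → Hinf2) : Prop :=
  ∃ (L : ℕ) (M : (q : ℕ) → OpMat q), N ≤ L ∧
    (∀ q ∈ Finset.Icc p L, (M q).IsOp) ∧
    (∀ U, D U = pluriMap p L M U) ∧
    ∃ (L' : ℕ) (Λ : (q : ℕ) → Form2 q),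
      (∀ q ∈ Finset.Icc (N + 1) L', IsForm2 (Λ q)) ∧
      ∀ U V W : Hinf2,
        Omegac (dPluriMap p N M U V) (dPluriMap p N M U W) =
          Omegac V W + ∑ q ∈ Finset.Icc (N + 1) L', Λ q (fun _ => U) V W

end PluriHom

end

open PluriHom

/-! Write Φ(U) = B(U)U for the given map. Its differential is dΦ(U)V = B(U)V + (dB(U)[V])U. In the
second term V sits in an internal slot of a spectrally localized operator, so its frequency and the
output frequency are at most comparable with that of U in the last slot. Any number of derivatives
can then be charged to U, and this term is smoothing in V (`entryVF_smoothing`, `matVF_smoothing`).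
Since B is linearly symplectic up to homogeneity N, the components of Bᵀ E_c B of degrees 1, …, N
vanish (`linOmega_eq_zero`). Hence the components of Φ^*Ω_c in these degrees are 2-forms smoothing
in both tangent variables.

They are removed one degree at a time, as in a Darboux argument. Let D = C∘Φ, with C - Id polynomial
and regularizing, have no component of its pulled back form in degrees 1, …, k-1. The component ω_k
is still smoothing (`Corrected.omegaComp_bound`). One looks for a homogeneous G with Ω_c(dG V, W) +
Ω_c(V, dG W) = -ω_k(V, W) and replaces C by C + G. As Φ is tangent to the identity, this adds G to
the component of D of index k and leaves the lower ones unchanged (`Corrected.step`).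

To find G, note that Ω_c is the differential of ½Ω_c(U, ·), so ω_k has an explicit primitive H
(`exists_primitive`). H need not be smoothing; only its exterior derivative is. The remedy is to
subtract an exact form, given by a symmetric form g obtained from H by moving the argument of
highest frequency to the last slot (`topForm`). Fix a slot i and the last slot. If a third argument
has frequency at least as high as both, it pays for the derivatives to be gained in these two.
Otherwise the top frequency is in the last slot, where H - g vanishes, or in slot i, where H - g is
an antisymmetrization of H and so a value of the smoothing form dH; a tie gives half of it
(`sub_topForm_block_le`). Thus H - g regularizes in every slot at every order, and duality turns it
into the vector field G (`exists_correction`). Regularization at every order is why one and the same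
R is ϱ-smoothing for all ϱ (`isSmoothing_opMat`).

Three devices recur. Bounds on frequency blocks extend to all arguments at the price of two
derivatives per slot (`form_le_of_block_bound`). Statements about symmetric multilinear maps are
checked on the diagonal and polarized (`exists_polarization`). Statements about homogeneous
components are read off from their sum at several dilations t U by inverting a Vandermonde matrix
(`exists_weights`). Throughout, the component of index q has q + 1 arguments. -/

noncomputable section

namespace PluriHom

open Filter Topology

/-! ### Sobolev norms -/

theorem Hinf.apply_zero (u : Hinf) : u.1 0 = 0 := u.2.1

theorem summable_sob (s : ℝ) (u : Hinf) :
    Summable fun j : ℤ => ‖u.1 j‖ ^ 2 * |(j : ℝ)| ^ (2 * s) := u.2.2 s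

theorem weight_sq (s : ℝ) (x : ℝ) : |x| ^ (2 * s) = (|x| ^ s) ^ 2 := by
  rw [mul_comm, Real.rpow_mul (abs_nonneg x)]; norm_num

theorem summable_pair (s : ℝ) (U : Hinf2) :
    Summable fun p : Fin 2 × ℤ => (‖(U p.1).1 p.2‖ * |(p.2 : ℝ)| ^ s) ^ 2 := by
  refine (summable_prod_of_nonneg (fun _ => by positivity)).2 ⟨fun σ => ?_, (hasSum_fintype _).summable⟩
  refine (summable_sob s (U σ)).congr fun j => ?_
  rw [weight_sq, mul_pow]

theorem sobNorm2_sq (s : ℝ) (U : Hinf2) :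
    sobNorm2 s U ^ 2 = ∑' p : Fin 2 × ℤ, (‖(U p.1).1 p.2‖ * |(p.2 : ℝ)| ^ s) ^ 2 := by
  have h : ∀ u : Hinf, sobNorm s u ^ 2 = ∑' j : ℤ, (‖u.1 j‖ * |(j : ℝ)| ^ s) ^ 2 := by
    intro u
    rw [sobNorm, Real.sq_sqrt (tsum_nonneg fun j => by positivity)]
    exact tsum_congr fun j => by rw [weight_sq, mul_pow]
  rw [sobNorm2, Real.sq_sqrt (by positivity), (summable_pair s U).tsum_prod, tsum_fintype,
    Fin.sum_univ_two, h, h]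

theorem sobNorm_nonneg (s : ℝ) (u : Hinf) : 0 ≤ sobNorm s u := Real.sqrt_nonneg _

theorem sobNorm2_nonneg (s : ℝ) (U : Hinf2) : 0 ≤ sobNorm2 s U := Real.sqrt_nonneg _

theorem sobNorm2_eq (s : ℝ) (U : Hinf2) :
    sobNorm2 s U = (∑' p : Fin 2 × ℤ, (‖(U p.1).1 p.2‖ * |(p.2 : ℝ)| ^ s) ^ (2 : ℝ)) ^ (1 / (2 : ℝ)) := by
  have h := sobNorm2_sq s U
  simp only [Real.rpow_two]
  rw [← h, ← Real.sqrt_eq_rpow, Real.sqrt_sq (sobNorm2_nonneg s U)]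

theorem sobNorm2_le_of_coeff {s t K : ℝ} (hK : 0 ≤ K) {U V : Hinf2}
    (h : ∀ σ j, j ≠ 0 → ‖(U σ).1 j‖ * |(j : ℝ)| ^ s ≤ K * (‖(V σ).1 j‖ * |(j : ℝ)| ^ t)) :
    sobNorm2 s U ≤ K * sobNorm2 t V := by
  refine le_of_sq_le_sq ?_ (mul_nonneg hK (sobNorm2_nonneg t V))
  rw [mul_pow, sobNorm2_sq, sobNorm2_sq, ← tsum_mul_left]
  refine (summable_pair s U).tsum_le_tsum (fun p => ?_) ((summable_pair t V).mul_left _)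
  rw [← mul_pow]
  rcases eq_or_ne p.2 0 with h0 | h0
  · rw [h0, Hinf.apply_zero, norm_zero, zero_mul, zero_pow two_ne_zero]; positivity
  · have := h p.1 p.2 h0
    gcongr

theorem one_le_abs_int {j : ℤ} (hj : j ≠ 0) : (1 : ℝ) ≤ |(j : ℝ)| := by
  exact_mod_cast Int.one_le_abs hj

theorem sobNorm2_mono {s t : ℝ} (h : s ≤ t) (U : Hinf2) : sobNorm2 s U ≤ sobNorm2 t U := by
  rw [← one_mul (sobNorm2 t U)]
  refine sobNorm2_le_of_coeff zero_le_one fun σ j hj => ?_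
  rw [one_mul]
  gcongr
  exact one_le_abs_int hj

theorem sobNorm2_smul (s : ℝ) (c : ℂ) (U : Hinf2) : sobNorm2 s (c • U) = ‖c‖ * sobNorm2 s U := by
  have h : sobNorm2 s (c • U) ^ 2 = (‖c‖ * sobNorm2 s U) ^ 2 := by
    rw [mul_pow, sobNorm2_sq, sobNorm2_sq, ← tsum_mul_left]
    refine tsum_congr fun p => ?_
    have : ((c • U) p.1).1 p.2 = c * (U p.1).1 p.2 := rfl
    rw [this, norm_mul]; ring
  exact (pow_left_inj₀ (sobNorm2_nonneg _ _) (mul_nonneg (norm_nonneg c) (sobNorm2_nonneg _ _))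
    two_ne_zero).1 h

theorem sobNorm2_add_le (s : ℝ) (U V : Hinf2) :
    sobNorm2 s (U + V) ≤ sobNorm2 s U + sobNorm2 s V := by
  have hU := summable_pair s U
  have hV := summable_pair s V
  have H := Real.Lp_add_le_tsum_of_nonneg (p := 2) one_le_two
    (f := fun p : Fin 2 × ℤ => ‖(U p.1).1 p.2‖ * |(p.2 : ℝ)| ^ s)
    (g := fun p : Fin 2 × ℤ => ‖(V p.1).1 p.2‖ * |(p.2 : ℝ)| ^ s)
    (fun _ => by positivity) (fun _ => by positivity) (by simpa using hU) (by simpa using hV)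
  rw [sobNorm2_eq s U, sobNorm2_eq s V]
  refine le_trans ?_ H.2
  rw [sobNorm2_eq]
  refine Real.rpow_le_rpow (tsum_nonneg fun _ => by positivity) ?_ (by norm_num)
  have h1 := summable_pair s (U + V)
  refine Summable.tsum_le_tsum (fun p => ?_) (by simpa using h1) H.1
  refine Real.rpow_le_rpow (by positivity) ?_ (by norm_num)
  rw [← add_mul]
  exact mul_le_mul_of_nonneg_right (norm_add_le _ _) (by positivity)

theorem sobNorm2_zero (s : ℝ) : sobNorm2 s (0 : Hinf2) = 0 := by
  have := sobNorm2_smul s 0 (0 : Hinf2)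
  simpa using this

/-- The norm of `Ḣˢ(𝕋; ℂ²)` as a seminorm. -/
def sobSeminorm (s : ℝ) : Seminorm ℂ Hinf2 :=
  Seminorm.of (sobNorm2 s) (sobNorm2_add_le s) (sobNorm2_smul s)

theorem sobNorm2_sum_le {ι : Type*} (s : ℝ) (T : Finset ι) (f : ι → Hinf2) :
    sobNorm2 s (∑ i ∈ T, f i) ≤ ∑ i ∈ T, sobNorm2 s (f i) :=
  map_sum_le_sum (sobSeminorm s) T f
where
  map_sum_le_sum (q : Seminorm ℂ Hinf2) (T : Finset ι) (f : ι → Hinf2) :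
      q (∑ i ∈ T, f i) ≤ ∑ i ∈ T, q (f i) :=
    Finset.le_sum_of_subadditive q (map_zero q).le (map_add_le_add q) T f

theorem coeff_le_sobNorm2 (s : ℝ) (U : Hinf2) (σ : Fin 2) (j : ℤ) :
    ‖(U σ).1 j‖ * |(j : ℝ)| ^ s ≤ sobNorm2 s U := by
  refine le_of_sq_le_sq ?_ (sobNorm2_nonneg s U)
  rw [sobNorm2_sq]
  exact (summable_pair s U).le_tsum (σ, j) fun _ _ => by positivity

theorem eq_zero_of_sobNorm2_eq_zero {s : ℝ} {U : Hinf2} (h : sobNorm2 s U = 0) : U = 0 := by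
  funext σ
  refine Subtype.ext (funext fun j => ?_)
  rcases eq_or_ne j 0 with rfl | hj
  · exact Hinf.apply_zero _
  · have h1 := coeff_le_sobNorm2 s U σ j
    rw [h] at h1
    have h2 : 0 < |(j : ℝ)| ^ s := Real.rpow_pos_of_pos (by positivity) s
    have h3 : ‖(U σ).1 j‖ ≤ 0 := by
      by_contra hc
      push Not at hc
      have := mul_pos hc h2
      linarith
    simpa using h3

theorem sobNorm_le_sobNorm2 (s : ℝ) (U : Hinf2) (σ : Fin 2) : sobNorm s (U σ) ≤ sobNorm2 s U := by
  refine le_of_sq_le_sq ?_ (sobNorm2_nonneg s U)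
  rw [sobNorm2, Real.sq_sqrt (by positivity)]
  have h0 := sq_nonneg (sobNorm s (U 0))
  have h1 := sq_nonneg (sobNorm s (U 1))
  match σ with
  | 0 => linarith
  | 1 => linarith

theorem sobNorm_zero (s : ℝ) : sobNorm s (0 : Hinf) = 0 :=
  le_antisymm (by simpa [sobNorm2_zero] using sobNorm_le_sobNorm2 s 0 0) (sobNorm_nonneg _ _)

theorem sobNorm2_single (s : ℝ) (σ : Fin 2) (u : Hinf) :
    sobNorm2 s (Pi.single σ u) = sobNorm s u := by
  have h := sobNorm_nonneg s u
  match σ with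
  | 0 => simp [sobNorm2, sobNorm_zero, h]
  | 1 => simp [sobNorm2, sobNorm_zero, h]

/-! ### Rapidly decreasing sequences -/

/-- The constant `∑_{j ∈ ℤ} |j|⁻²` (with the convention `|0|⁻² = 0`). -/
def zetaConst : ℝ := ∑' j : ℤ, |(j : ℝ)| ^ (-2 : ℝ)

theorem summable_zeta : Summable fun j : ℤ => |(j : ℝ)| ^ (-2 : ℝ) :=
  Real.summable_abs_int_rpow (by norm_num)

theorem zetaConst_nonneg : 0 ≤ zetaConst := tsum_nonneg fun _ => by positivity

/-- Pointwise decay at rate s + 1 bounds the terms of the `Ḣˢ` sum by a multiple of |j|⁻², which is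
summable. One derivative is the price of passing from a supremum of coefficients to a square sum. -/
theorem mem_Hinf_of_decay {u : ℤ → ℂ} (h0 : u 0 = 0)
    (h : ∀ s : ℝ, ∃ K : ℝ, ∀ j : ℤ, j ≠ 0 → ‖u j‖ * |(j : ℝ)| ^ s ≤ K) : u ∈ Hinf := by
  refine ⟨h0, fun s => ?_⟩
  obtain ⟨K, hK⟩ := h (s + 1)
  refine Summable.of_nonneg_of_le (fun j => by positivity) (fun j => ?_)
    (summable_zeta.mul_left (K ^ 2))
  rcases eq_or_ne j 0 with rfl | hj
  · rw [h0, norm_zero]; simp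
  · have hp : 0 < |(j : ℝ)| := by positivity
    have h1 := hK j hj
    have h2 : ‖u j‖ ^ 2 * |(j : ℝ)| ^ (2 * s)
        = (‖u j‖ * |(j : ℝ)| ^ (s + 1)) ^ 2 * |(j : ℝ)| ^ (-2 : ℝ) := by
      rw [mul_pow, ← weight_sq, mul_assoc, ← Real.rpow_add hp]
      congr 2; ring
    rw [h2]
    gcongr

theorem sobNorm2_le_of_decay {s K : ℝ} (hK : 0 ≤ K) {U : Hinf2}
    (h : ∀ σ j, j ≠ 0 → ‖(U σ).1 j‖ * |(j : ℝ)| ^ (s + 1) ≤ K) :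
    sobNorm2 s U ≤ (1 + 2 * zetaConst) * K := by
  have hz := zetaConst_nonneg
  refine le_of_sq_le_sq ?_ (by positivity)
  rw [sobNorm2_sq, (summable_pair s U).tsum_prod, tsum_fintype]
  have h1 : ∀ σ, ∑' j : ℤ, (‖(U σ).1 j‖ * |(j : ℝ)| ^ s) ^ 2 ≤ K ^ 2 * zetaConst := by
    intro σ
    rw [zetaConst, ← tsum_mul_left]
    refine Summable.tsum_le_tsum (fun j => ?_) ((summable_pair s U).prod_factor σ)
      (summable_zeta.mul_left _)
    rcases eq_or_ne j 0 with rfl | hj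
    · rw [Hinf.apply_zero, norm_zero]; simp
    · have hp : 0 < |(j : ℝ)| := by positivity
      have h1 := h σ j hj
      have h2 : (‖(U σ).1 j‖ * |(j : ℝ)| ^ s) ^ 2
          = (‖(U σ).1 j‖ * |(j : ℝ)| ^ (s + 1)) ^ 2 * |(j : ℝ)| ^ (-2 : ℝ) := by
        rw [mul_pow, mul_pow, ← weight_sq, ← weight_sq, mul_assoc, ← Real.rpow_add hp]
        congr 2; ring
      rw [h2]
      gcongr
  calc ∑ σ, ∑' j : ℤ, (‖(U σ).1 j‖ * |(j : ℝ)| ^ s) ^ 2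
      ≤ ∑ σ : Fin 2, K ^ 2 * zetaConst := Finset.sum_le_sum fun σ _ => h1 σ
    _ ≤ ((1 + 2 * zetaConst) * K) ^ 2 := by
        simp only [Finset.sum_const, Finset.card_univ, Fintype.card_fin, nsmul_eq_mul]
        push_cast
        nlinarith [sq_nonneg K, mul_nonneg hz (sq_nonneg K), mul_nonneg (mul_nonneg hz hz) (sq_nonneg K)]

/-! ### Fourier multipliers -/

/-- The Fourier multiplier with symbol `m`, bounded by `1`, acting on pairs. -/
def multiplier (m : ℤ → ℂ) (hm : ∀ j, ‖m j‖ ≤ 1) : Hinf2 →ₗ[ℂ] Hinf2 where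
  toFun U σ := ⟨fun j => m j * (U σ).1 j, mem_Hinf_of_le (U σ).2 fun j => by
    rw [norm_mul]; exact mul_le_of_le_one_left (norm_nonneg _) (hm j)⟩
  map_add' U V := by
    funext σ; refine Subtype.ext (funext fun j => ?_)
    exact mul_add (m j) ((U σ).1 j) ((V σ).1 j)
  map_smul' c U := by
    funext σ; refine Subtype.ext (funext fun j => ?_)
    exact mul_left_comm (m j) c ((U σ).1 j)

theorem multiplier_apply (m : ℤ → ℂ) (hm : ∀ j, ‖m j‖ ≤ 1) (U : Hinf2) (σ : Fin 2) (j : ℤ) :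
    (multiplier m hm U σ).1 j = m j * (U σ).1 j := rfl

theorem multiplier_le (m : ℤ → ℂ) (hm : ∀ j, ‖m j‖ ≤ 1) (s : ℝ) (U : Hinf2) :
    sobNorm2 s (multiplier m hm U) ≤ sobNorm2 s U := by
  rw [← one_mul (sobNorm2 s U)]
  refine sobNorm2_le_of_coeff zero_le_one fun σ j hj => ?_
  rw [one_mul, multiplier_apply, norm_mul]
  refine mul_le_mul_of_nonneg_right (mul_le_of_le_one_left (norm_nonneg _) (hm j)) (by positivity)

/-- `Πₙ` as a linear map. -/
def projL (n : ℕ) : Hinf2 →ₗ[ℂ] Hinf2 :=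
  multiplier (fun j => if j.natAbs = n then 1 else 0) fun j => by split_ifs <;> simp

theorem projL_apply (n : ℕ) (U : Hinf2) : projL n U = proj2 n U := by
  funext σ; refine Subtype.ext (funext fun j => ?_)
  change (if j.natAbs = n then (1 : ℂ) else 0) * (U σ).1 j = if j.natAbs = n then (U σ).1 j else 0
  split_ifs <;> simp

theorem proj2_coeff (n : ℕ) (U : Hinf2) (σ : Fin 2) (j : ℤ) :
    (proj2 n U σ).1 j = if j.natAbs = n then (U σ).1 j else 0 := rfl

theorem proj2_le (n : ℕ) (s : ℝ) (U : Hinf2) : sobNorm2 s (proj2 n U) ≤ sobNorm2 s U := by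
  rw [← projL_apply]; exact multiplier_le _ _ _ _

theorem abs_eq_of_natAbs {j : ℤ} {n : ℕ} (h : j.natAbs = n) : |(j : ℝ)| = n := by
  rw [← h, Nat.cast_natAbs, Int.cast_abs]

theorem sobNorm2_proj2_le {n : ℕ} (hn : 1 ≤ n) (s t : ℝ) (U : Hinf2) :
    sobNorm2 s (proj2 n U) ≤ (n : ℝ) ^ (s - t) * sobNorm2 t (proj2 n U) := by
  have hp : (0 : ℝ) < n := by exact_mod_cast hn
  refine sobNorm2_le_of_coeff (by positivity) fun σ j _ => ?_
  rw [proj2_coeff]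
  split_ifs with h
  · rw [abs_eq_of_natAbs h, mul_left_comm, ← Real.rpow_add hp]
    simp
  · simp

theorem sobNorm2_proj2 {n : ℕ} (hn : 1 ≤ n) (s t : ℝ) (U : Hinf2) :
    sobNorm2 s (proj2 n U) = (n : ℝ) ^ (s - t) * sobNorm2 t (proj2 n U) := by
  have hp : (0 : ℝ) < n := by exact_mod_cast hn
  refine le_antisymm (sobNorm2_proj2_le hn s t U) ?_
  have h := mul_le_mul_of_nonneg_left (sobNorm2_proj2_le hn t s U)
    (Real.rpow_nonneg hp.le (s - t))
  rwa [← mul_assoc, ← Real.rpow_add hp, show s - t + (t - s) = 0 by ring, Real.rpow_zero,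
    one_mul] at h

theorem proj2_zero (U : Hinf2) : proj2 0 U = 0 := by
  funext σ; refine Subtype.ext (funext fun j => ?_)
  rw [proj2_coeff]
  split_ifs with h
  · rw [Int.natAbs_eq_zero.1 h]; exact Hinf.apply_zero _
  · rfl

theorem proj2_proj2 (n m : ℕ) (U : Hinf2) :
    proj2 n (proj2 m U) = if n = m then proj2 m U else 0 := by
  funext σ; refine Subtype.ext (funext fun j => ?_)
  by_cases h : n = m
  · subst h
    rw [if_pos rfl, proj2_coeff, proj2_coeff]; split_ifs <;> rfl
  · rw [if_neg h, proj2_coeff, proj2_coeff]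
    split_ifs with h1 h2
    · exact absurd (h1.symm.trans h2) h
    · rfl
    · rfl

/-! ### The bilinear pairing -/

theorem summable_bilin (V W : Hinf2) (s : ℝ) :
    Summable (fun p : Fin 2 × ℤ => ‖(V p.1).1 p.2 * (W p.1).1 (-p.2)‖) ∧
    ∑' p : Fin 2 × ℤ, ‖(V p.1).1 p.2 * (W p.1).1 (-p.2)‖ ≤ sobNorm2 s V * sobNorm2 (-s) W := by
  have hV := summable_pair s V
  have hW : Summable fun p : Fin 2 × ℤ => (‖(W p.1).1 (-p.2)‖ * |(p.2 : ℝ)| ^ (-s)) ^ 2 := by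
    have := ((Equiv.refl (Fin 2)).prodCongr (Equiv.neg ℤ)).summable_iff.2 (summable_pair (-s) W)
    refine this.congr fun p => ?_
    simp
  have hWn : sobNorm2 (-s) W = (∑' p : Fin 2 × ℤ,
      (‖(W p.1).1 (-p.2)‖ * |(p.2 : ℝ)| ^ (-s)) ^ (2 : ℝ)) ^ (1 / (2 : ℝ)) := by
    rw [sobNorm2_eq, ← ((Equiv.refl (Fin 2)).prodCongr (Equiv.neg ℤ)).tsum_eq]
    simp
  have H0 := Real.summable_mul_of_Lp_Lq_of_nonneg (p := 2) (q := 2) Real.HolderConjugate.two_two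
    (f := fun p : Fin 2 × ℤ => ‖(V p.1).1 p.2‖ * |(p.2 : ℝ)| ^ s)
    (g := fun p : Fin 2 × ℤ => ‖(W p.1).1 (-p.2)‖ * |(p.2 : ℝ)| ^ (-s))
    (fun _ => by positivity) (fun _ => by positivity) (by simpa using hV) (by simpa using hW)
  have H := Real.inner_le_Lp_mul_Lq_tsum_of_nonneg (p := 2) (q := 2) Real.HolderConjugate.two_two
    (f := fun p : Fin 2 × ℤ => ‖(V p.1).1 p.2‖ * |(p.2 : ℝ)| ^ s)
    (g := fun p : Fin 2 × ℤ => ‖(W p.1).1 (-p.2)‖ * |(p.2 : ℝ)| ^ (-s))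
    (fun _ => by positivity) (fun _ => by positivity) (by simpa using hV) (by simpa using hW)
  rw [← sobNorm2_eq, ← hWn] at H
  have e : ∀ p : Fin 2 × ℤ, ‖(V p.1).1 p.2‖ * |(p.2 : ℝ)| ^ s *
      (‖(W p.1).1 (-p.2)‖ * |(p.2 : ℝ)| ^ (-s)) = ‖(V p.1).1 p.2 * (W p.1).1 (-p.2)‖ := by
    intro p
    rcases eq_or_ne p.2 0 with h0 | h0
    · rw [h0, Hinf.apply_zero]; simp
    · have hp : 0 < |(p.2 : ℝ)| := by positivity
      rw [norm_mul, mul_mul_mul_comm, ← Real.rpow_add hp, add_neg_cancel, Real.rpow_zero, mul_one]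
  simp only [e] at H H0
  exact ⟨H0, H⟩

theorem bilin_eq (V W : Hinf2) :
    bilin V W = ∑' p : Fin 2 × ℤ, (V p.1).1 p.2 * (W p.1).1 (-p.2) := by
  rw [(summable_bilin V W 0).1.of_norm.tsum_prod, tsum_fintype]
  rfl

theorem norm_bilin_le (s : ℝ) (V W : Hinf2) : ‖bilin V W‖ ≤ sobNorm2 s V * sobNorm2 (-s) W := by
  rw [bilin_eq]
  exact (norm_tsum_le_tsum_norm (summable_bilin V W 0).1).trans (summable_bilin V W s).2

theorem bilin_comm (V W : Hinf2) : bilin V W = bilin W V := by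
  rw [bilin_eq, bilin_eq, ← ((Equiv.refl (Fin 2)).prodCongr (Equiv.neg ℤ)).tsum_eq]
  refine tsum_congr fun p => ?_
  simp [mul_comm]

/-- The pairing as a bilinear map. -/
def bilinL : Hinf2 →ₗ[ℂ] Hinf2 →ₗ[ℂ] ℂ :=
  LinearMap.mk₂ ℂ bilin
    (fun V V' W => by
      rw [bilin_eq, bilin_eq, bilin_eq, ← (summable_bilin V W 0).1.of_norm.tsum_add
        (summable_bilin V' W 0).1.of_norm]
      exact tsum_congr fun p => add_mul _ _ _)
    (fun c V W => by
      rw [bilin_eq, bilin_eq, smul_eq_mul, ← tsum_mul_left]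
      exact tsum_congr fun p => mul_assoc _ _ _)
    (fun V W W' => by
      rw [bilin_eq, bilin_eq, bilin_eq, ← (summable_bilin V W 0).1.of_norm.tsum_add
        (summable_bilin V W' 0).1.of_norm]
      exact tsum_congr fun p => mul_add _ _ _)
    (fun c V W => by
      rw [bilin_eq, bilin_eq, smul_eq_mul, ← tsum_mul_left]
      exact tsum_congr fun p => mul_left_comm _ _ _)

theorem bilinL_apply (V W : Hinf2) : bilinL V W = bilin V W := rfl

/-! ### Fourier modes and duality -/

/-- The Fourier mode `e^{ijx}/√(2π)` in the component `σ` (zero if `j = 0`). -/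
def mode (σ : Fin 2) (j : ℤ) : Hinf2 :=
  Pi.single σ ⟨fun i => if i = j ∧ j ≠ 0 then 1 else 0, mem_Hinf_of_decay
    (by rw [if_neg]; rintro ⟨h, h'⟩; exact h' h.symm)
    fun s => ⟨|(j : ℝ)| ^ s, fun i _ => by
      by_cases h : i = j ∧ j ≠ 0
      · rw [if_pos h, h.1]; simp
      · rw [if_neg h, norm_zero, zero_mul]; positivity⟩⟩

theorem mode_coeff (σ σ' : Fin 2) (j i : ℤ) :
    (mode σ j σ').1 i = if σ' = σ ∧ i = j ∧ j ≠ 0 then 1 else 0 := by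
  by_cases h : σ' = σ
  · subst h
    simp [mode]
  · rw [if_neg (fun h' => h h'.1), mode, Pi.single_eq_of_ne h]; rfl

theorem bilin_mode (y : Hinf2) (σ : Fin 2) (j : ℤ) : bilin y (mode σ (-j)) = (y σ).1 j := by
  rw [bilin_eq, tsum_eq_single (σ, j)]
  · rw [mode_coeff]
    rcases eq_or_ne j 0 with rfl | hj
    · rw [Hinf.apply_zero, zero_mul]
    · rw [if_pos ⟨rfl, rfl, neg_ne_zero.2 hj⟩, mul_one]
  · rintro ⟨σ', i⟩ h
    rw [mode_coeff, if_neg, mul_zero]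
    rintro ⟨h1, h2, -⟩
    exact h (Prod.ext h1 (neg_injective h2))

theorem sobNorm2_mode_le (s : ℝ) (σ : Fin 2) (j : ℤ) : sobNorm2 s (mode σ j) ≤ |(j : ℝ)| ^ s := by
  refine le_of_sq_le_sq ?_ (by positivity)
  rw [sobNorm2_sq, tsum_eq_single (σ, j)]
  · rw [mode_coeff]
    have h : ‖(if σ = σ ∧ j = j ∧ j ≠ 0 then (1 : ℂ) else 0)‖ ≤ 1 := by split_ifs <;> simp
    have h2 : 0 ≤ |(j : ℝ)| ^ s := by positivity
    gcongr
    exact mul_le_of_le_one_left h2 h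
  · rintro ⟨σ', i⟩ h
    rw [mode_coeff, if_neg, norm_zero, zero_mul, zero_pow two_ne_zero]
    rintro ⟨h1, h2, -⟩
    exact h (Prod.ext h1 h2)

theorem ext_modes {U V : Hinf2} (h : ∀ σ j, (U σ).1 j = (V σ).1 j) : U = V :=
  funext fun σ => Subtype.ext (funext fun j => h σ j)

/-- The mode of frequency -j has `Ḣ⁻ˢ` norm at most |j|⁻ˢ, so a bound against that norm is decay of
the coefficient. -/
theorem coeff_le_of_mode_bound {s K : ℝ} {c : ℂ} {σ : Fin 2} {j : ℤ} (hj : j ≠ 0)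
    (hK : 0 ≤ K) (h : ‖c‖ ≤ K * sobNorm2 (-s) (mode σ (-j))) : ‖c‖ * |(j : ℝ)| ^ s ≤ K := by
  have hp : 0 < |(j : ℝ)| := by positivity
  have h1 := sobNorm2_mode_le (-s) σ (-j)
  rw [Int.cast_neg, abs_neg] at h1
  have h2 : ‖c‖ ≤ K * |(j : ℝ)| ^ (-s) := h.trans (by gcongr)
  calc ‖c‖ * |(j : ℝ)| ^ s ≤ K * |(j : ℝ)| ^ (-s) * |(j : ℝ)| ^ s := by gcongr
    _ = K := by rw [mul_assoc, ← Real.rpow_add hp]; simp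

/-- The constant lost in passing from a bound of coefficients to a bound of the norm. -/
def dualConst : ℝ := 1 + 2 * zetaConst

theorem dualConst_nonneg : 0 ≤ dualConst := by
  have := zetaConst_nonneg
  unfold dualConst; positivity

/-- Duality tested on Fourier modes only. It loses one derivative, which is harmless here because
later estimates allow arbitrary orders or ask only for some order. -/
theorem sobNorm2_le_of_dual {s K : ℝ} (hK : 0 ≤ K) {y : Hinf2}
    (h : ∀ Z, ‖bilin y Z‖ ≤ K * sobNorm2 (-(s + 1)) Z) : sobNorm2 s y ≤ dualConst * K :=
  sobNorm2_le_of_decay hK fun σ j hj =>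
    coeff_le_of_mode_bound hj hK (by rw [← bilin_mode]; exact h _)

/-! ### Extension of bounds from frequency blocks -/

theorem sum_projL_coeff (J : ℕ) (V : Hinf2) (σ : Fin 2) (j : ℤ) :
    ((∑ n ∈ Finset.range J, proj2 n V) σ).1 j = if j.natAbs < J then (V σ).1 j else 0 := by
  rw [Finset.sum_apply, Submodule.coe_sum, Finset.sum_apply]
  simp only [proj2_coeff]
  rw [Finset.sum_ite_eq]
  simp

/-- The tail lives at frequencies at least J, where one extra derivative is worth a factor J. -/
theorem tail_le (s : ℝ) {J : ℕ} (hJ : 1 ≤ J) (V : Hinf2) :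
    sobNorm2 s (V - ∑ n ∈ Finset.range J, proj2 n V) ≤ (J : ℝ)⁻¹ * sobNorm2 (s + 1) V := by
  have hJ' : (0 : ℝ) < J := by exact_mod_cast hJ
  refine sobNorm2_le_of_coeff (by positivity) fun σ j hj => ?_
  have hc : ((V - ∑ n ∈ Finset.range J, proj2 n V) σ).1 j
      = (V σ).1 j - if j.natAbs < J then (V σ).1 j else 0 := by
    rw [← sum_projL_coeff]; rfl
  rw [hc]
  have hp : 0 < |(j : ℝ)| := by positivity
  split_ifs with h
  · rw [sub_self, norm_zero, zero_mul]; positivity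
  · rw [sub_zero, Real.rpow_add hp, Real.rpow_one]
    have h1 : (J : ℝ) ≤ |(j : ℝ)| := by
      rw [← Int.cast_abs, Int.abs_eq_natAbs]; exact_mod_cast not_lt.1 h
    have h2 : 1 ≤ (J : ℝ)⁻¹ * |(j : ℝ)| := by
      rw [inv_mul_eq_div, le_div_iff₀ hJ']; linarith
    calc ‖(V σ).1 j‖ * |(j : ℝ)| ^ s = ‖(V σ).1 j‖ * |(j : ℝ)| ^ s * 1 := by ring
      _ ≤ ‖(V σ).1 j‖ * |(j : ℝ)| ^ s * ((J : ℝ)⁻¹ * |(j : ℝ)|) := by gcongr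
      _ = _ := by ring

theorem sum_zeta_le (J : ℕ) : ∑ n ∈ Finset.range J, (n : ℝ) ^ (-2 : ℝ) ≤ zetaConst := by
  have h := summable_zeta.sum_le_tsum ((Finset.range J).map Nat.castEmbedding)
    fun _ _ => by positivity
  rw [Finset.sum_map] at h
  simpa [zetaConst] using h

/-- The bound `hb` serves only to make the tail of high frequencies tend to zero, so its constant
and order do not enter the conclusion. The blocks are summed with the weights n⁻², gained by giving
up two derivatives. -/
theorem norm_le_of_block_bound (l : Hinf2 →ₗ[ℂ] ℂ) {C s' A e : ℝ}
    (hb : ∀ V, ‖l V‖ ≤ C * sobNorm2 s' V) (hA : 0 ≤ A)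
    (h : ∀ n : ℕ, 1 ≤ n → ∀ V, ‖l (proj2 n V)‖ ≤ A * sobNorm2 e (proj2 n V)) (V : Hinf2) :
    ‖l V‖ ≤ A * zetaConst * sobNorm2 (e + 2) V := by
  have key : ∀ J : ℕ, 1 ≤ J →
      ‖l V‖ ≤ A * zetaConst * sobNorm2 (e + 2) V + |C| * sobNorm2 (s' + 1) V * (J : ℝ)⁻¹ := by
    intro J hJ
    have h1 : l V = ∑ n ∈ Finset.range J, l (proj2 n V) +
        l (V - ∑ n ∈ Finset.range J, proj2 n V) := by
      rw [map_sub, map_sum]; ring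
    rw [h1]
    refine (norm_add_le _ _).trans (add_le_add ?_ ?_)
    · have hterm : ∀ n : ℕ, ‖l (proj2 n V)‖ ≤ A * sobNorm2 (e + 2) V * (n : ℝ) ^ (-2 : ℝ) := by
        intro n
        rcases Nat.eq_zero_or_pos n with rfl | hn
        · rw [proj2_zero, map_zero, norm_zero]
          have := sobNorm2_nonneg (e + 2) V
          positivity
        · refine (h n hn V).trans ?_
          rw [sobNorm2_proj2 hn e (e + 2), show e - (e + 2) = -2 by ring]
          have := proj2_le n (e + 2) V
          calc A * ((n : ℝ) ^ (-2 : ℝ) * sobNorm2 (e + 2) (proj2 n V))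
              ≤ A * ((n : ℝ) ^ (-2 : ℝ) * sobNorm2 (e + 2) V) := by gcongr
            _ = _ := by ring
      calc ‖∑ n ∈ Finset.range J, l (proj2 n V)‖ ≤ ∑ n ∈ Finset.range J, ‖l (proj2 n V)‖ :=
            norm_sum_le _ _
        _ ≤ ∑ n ∈ Finset.range J, A * sobNorm2 (e + 2) V * (n : ℝ) ^ (-2 : ℝ) :=
            Finset.sum_le_sum fun n _ => hterm n
        _ = A * sobNorm2 (e + 2) V * ∑ n ∈ Finset.range J, (n : ℝ) ^ (-2 : ℝ) := by
            rw [Finset.mul_sum]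
        _ ≤ A * sobNorm2 (e + 2) V * zetaConst := by
            have := sobNorm2_nonneg (e + 2) V
            gcongr
            exact sum_zeta_le J
        _ = _ := by ring
    · refine (hb _).trans ?_
      have h2 := tail_le s' hJ V
      have h3 := sobNorm2_nonneg s' (V - ∑ n ∈ Finset.range J, proj2 n V)
      calc C * sobNorm2 s' (V - ∑ n ∈ Finset.range J, proj2 n V)
          ≤ |C| * sobNorm2 s' (V - ∑ n ∈ Finset.range J, proj2 n V) := by
            gcongr; exact le_abs_self C
        _ ≤ |C| * ((J : ℝ)⁻¹ * sobNorm2 (s' + 1) V) := by gcongr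
        _ = _ := by ring
  have hlim : Tendsto (fun J : ℕ => A * zetaConst * sobNorm2 (e + 2) V +
      |C| * sobNorm2 (s' + 1) V * (J : ℝ)⁻¹) atTop
      (𝓝 (A * zetaConst * sobNorm2 (e + 2) V + |C| * sobNorm2 (s' + 1) V * 0)) :=
    (tendsto_inv_atTop_nhds_zero_nat.const_mul _).const_add _
  rw [mul_zero, add_zero] at hlim
  exact ge_of_tendsto hlim (eventually_atTop.2 ⟨1, key⟩)

theorem proj2_eq_sum_modes {n : ℕ} (hn : 1 ≤ n) (V : Hinf2) :
    proj2 n V = ∑ σ, ((V σ).1 n • mode σ n + (V σ).1 (-n) • mode σ (-n)) := by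
  refine ext_modes fun σ j => ?_
  have hn' : n ≠ 0 := by omega
  have hc : ∀ (σ' : Fin 2), (((V σ').1 n • mode σ' n + (V σ').1 (-n) • mode σ' (-n)) σ).1 j
      = (V σ').1 n * (mode σ' n σ).1 j + (V σ').1 (-n) * (mode σ' (-n) σ).1 j := fun _ => rfl
  rw [Finset.sum_apply, Submodule.coe_sum, Finset.sum_apply]
  simp only [hc, mode_coeff, proj2_coeff]
  rw [Finset.sum_eq_single σ]
  · by_cases h1 : j = n
    · subst h1
      have : ¬ (n : ℤ) = -n := by omega
      simp [hn', this]
    · by_cases h2 : j = -n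
      · subst h2
        have : ¬ -(n : ℤ) = n := by omega
        simp [hn', this]
      · have : ¬ j.natAbs = n := by omega
        simp [h1, h2, this]
  · intro σ' _ h
    simp [h.symm]
  · simp

/-- Density of trigonometric polynomials: the difference vanishes on every frequency block, so
`norm_le_of_block_bound` applies to it with constant 0. -/
theorem eq_of_modes {l l' : Hinf2 →ₗ[ℂ] ℂ} {C C' s s' : ℝ} (hb : ∀ V, ‖l V‖ ≤ C * sobNorm2 s V)
    (hb' : ∀ V, ‖l' V‖ ≤ C' * sobNorm2 s' V) (h : ∀ σ j, l (mode σ j) = l' (mode σ j)) :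
    l = l' := by
  rw [← sub_eq_zero]
  refine LinearMap.ext fun V => ?_
  have hbb : ∀ V, ‖(l - l') V‖ ≤ (|C| + |C'|) * sobNorm2 (max s s') V := by
    intro V
    have h1 : sobNorm2 s V ≤ sobNorm2 (max s s') V := sobNorm2_mono (le_max_left _ _) V
    have h2 : sobNorm2 s' V ≤ sobNorm2 (max s s') V := sobNorm2_mono (le_max_right _ _) V
    have h3 := sobNorm2_nonneg s V
    have h4 := sobNorm2_nonneg s' V
    calc ‖(l - l') V‖ ≤ ‖l V‖ + ‖l' V‖ := norm_sub_le _ _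
      _ ≤ C * sobNorm2 s V + C' * sobNorm2 s' V := add_le_add (hb V) (hb' V)
      _ ≤ |C| * sobNorm2 s V + |C'| * sobNorm2 s' V := by
          gcongr <;> exact le_abs_self _
      _ ≤ |C| * sobNorm2 (max s s') V + |C'| * sobNorm2 (max s s') V := by gcongr
      _ = _ := by ring
  have hA : ∀ n : ℕ, 1 ≤ n → ∀ V, ‖(l - l') (proj2 n V)‖ ≤ 0 * sobNorm2 0 (proj2 n V) := by
    intro n hn V
    have : (l - l') (proj2 n V) = 0 := by
      rw [proj2_eq_sum_modes hn, map_sum]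
      refine Finset.sum_eq_zero fun σ _ => ?_
      simp [h]
    rw [this, norm_zero, zero_mul]
  have := norm_le_of_block_bound (l - l') hbb le_rfl hA V
  rw [zero_mul, zero_mul] at this
  simpa using this

/-- Boundedness of a multilinear form in a fixed Sobolev norm. -/
def FormBdd {ι : Type*} [Fintype ι] (A : MultilinearMap ℂ (fun _ : ι => Hinf2) ℂ) : Prop :=
  ∃ s C : ℝ, 0 ≤ s ∧ 0 ≤ C ∧ ∀ X, ‖A X‖ ≤ C * ∏ i, sobNorm2 s (X i)

theorem prod_update_eq {ι : Type*} [Fintype ι] [DecidableEq ι] (f : ι → Hinf2 → ℝ)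
    (X : ι → Hinf2) (a : ι) (V : Hinf2) :
    ∏ i, f i (Function.update X a V i) = f a V * ∏ i ∈ Finset.univ.erase a, f i (X i) := by
  rw [← Finset.mul_prod_erase _ _ (Finset.mem_univ a), Function.update_self]
  congr 1
  refine Finset.prod_congr rfl fun i hi => ?_
  rw [Function.update_of_ne (Finset.ne_of_mem_erase hi)]

/-- The one-variable extension is applied slot by slot; each slot costs a factor `zetaConst` and two
derivatives. This turns the block estimates of the operator classes into Sobolev bounds. -/
theorem form_le_of_block_bound {ι : Type*} [Fintype ι] [DecidableEq ι]
    {A : MultilinearMap ℂ (fun _ : ι => Hinf2) ℂ} (hb : FormBdd A) {K : ℝ} (hK : 0 ≤ K) (e : ι → ℝ)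
    (h : ∀ n : ι → ℕ, (∀ i, 1 ≤ n i) → ∀ X : ι → Hinf2,
      ‖A (fun i => proj2 (n i) (X i))‖ ≤ K * ∏ i, sobNorm2 (e i) (proj2 (n i) (X i)))
    (X : ι → Hinf2) :
    ‖A X‖ ≤ K * zetaConst ^ Fintype.card ι * ∏ i, sobNorm2 (e i + 2) (X i) := by
  obtain ⟨s, C, -, hC, hb⟩ := hb
  -- `T` is the set of slots already freed from their frequency projection.
  have key : ∀ T : Finset ι, ∀ (n : ι → ℕ), (∀ i, 1 ≤ n i) → ∀ X : ι → Hinf2,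
      ‖A (fun i => if i ∈ T then X i else proj2 (n i) (X i))‖ ≤ K * zetaConst ^ T.card *
        ∏ i, (if i ∈ T then sobNorm2 (e i + 2) (X i) else sobNorm2 (e i) (proj2 (n i) (X i))) := by
    intro T
    induction T using Finset.induction_on with
    | empty => intro n hn X; simpa using h n hn X
    | insert a T ha ih =>
      intro n hn X
      set Y : ι → Hinf2 := fun i => if i ∈ T then X i else proj2 (n i) (X i) with hY
      set w : ι → ℝ := fun i =>
        if i ∈ T then sobNorm2 (e i + 2) (X i) else sobNorm2 (e i) (proj2 (n i) (X i)) with hw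
      have hw0 : ∀ i, 0 ≤ w i := fun i => by
        simp only [hw]; split_ifs <;> exact sobNorm2_nonneg _ _
      have hz := zetaConst_nonneg
      have e1 : (fun i => if i ∈ insert a T then X i else proj2 (n i) (X i))
          = Function.update Y a (X a) := by
        funext i
        by_cases hi : i = a
        · subst hi; simp
        · simp [hi, hY]
      have e2 : ∏ i, (if i ∈ insert a T then sobNorm2 (e i + 2) (X i)
          else sobNorm2 (e i) (proj2 (n i) (X i)))
          = sobNorm2 (e a + 2) (X a) * ∏ i ∈ Finset.univ.erase a, w i := by
        rw [← Finset.mul_prod_erase _ _ (Finset.mem_univ a)]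
        congr 1
        · simp
        · refine Finset.prod_congr rfl fun i hi => ?_
          have := Finset.ne_of_mem_erase hi
          simp [this, hw]
      have hblock : ∀ m : ℕ, 1 ≤ m → ∀ V, ‖A.toLinearMap Y a (proj2 m V)‖ ≤
          (K * zetaConst ^ T.card * ∏ i ∈ Finset.univ.erase a, w i) *
            sobNorm2 (e a) (proj2 m V) := by
        intro m hm V
        have h1 := ih (Function.update n a m) (fun i => by
          by_cases hi : i = a
          · subst hi; simpa using hm
          · simpa [hi] using hn i) (Function.update X a V)
        have e3 : (fun i => if i ∈ T then Function.update X a V i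
            else proj2 (Function.update n a m i) (Function.update X a V i))
            = Function.update Y a (proj2 m V) := by
          funext i
          by_cases hi : i = a
          · subst hi; simp [ha]
          · simp [hi, hY]
        have e4 : ∏ i, (if i ∈ T then sobNorm2 (e i + 2) (Function.update X a V i)
            else sobNorm2 (e i) (proj2 (Function.update n a m i) (Function.update X a V i)))
            = sobNorm2 (e a) (proj2 m V) * ∏ i ∈ Finset.univ.erase a, w i := by
          rw [← Finset.mul_prod_erase _ _ (Finset.mem_univ a)]
          congr 1
          · simp [ha]
          · refine Finset.prod_congr rfl fun i hi => ?_
            have := Finset.ne_of_mem_erase hi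
            simp [this, hw]
        rw [e3, e4] at h1
        rw [MultilinearMap.toLinearMap_apply]
        refine h1.trans (le_of_eq (by ring))
      have hbd : ∀ V, ‖A.toLinearMap Y a V‖ ≤
          (C * ∏ i ∈ Finset.univ.erase a, sobNorm2 s (Y i)) * sobNorm2 s V := by
        intro V
        rw [MultilinearMap.toLinearMap_apply]
        refine (hb _).trans (le_of_eq ?_)
        rw [prod_update_eq (fun _ => sobNorm2 s)]
        ring
      have h2 := norm_le_of_block_bound (A.toLinearMap Y a) hbd
        (by have := Finset.prod_nonneg fun i (_ : i ∈ Finset.univ.erase a) => hw0 i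
            positivity) hblock (X a)
      rw [MultilinearMap.toLinearMap_apply] at h2
      rw [e1, e2, Finset.card_insert_of_notMem ha]
      refine h2.trans (le_of_eq ?_)
      ring
  -- With every slot freed the frequencies play no role, and 1 is an arbitrary admissible value.
  have := key Finset.univ (fun _ => 1) (fun _ => le_rfl) X
  simpa [Finset.card_univ] using this

/-! ### Translations -/

/-- `τ_ς` as a linear map. -/
def transL (ς : ℝ) : Hinf2 →ₗ[ℂ] Hinf2 :=
  multiplier (fun j => Complex.exp (((j * ς : ℝ) : ℂ) * Complex.I)) fun j => by
    rw [Complex.norm_exp_ofReal_mul_I]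

theorem transL_apply (ς : ℝ) (U : Hinf2) : transL ς U = trans2 ς U := rfl

theorem trans2_coeff (ς : ℝ) (U : Hinf2) (σ : Fin 2) (j : ℤ) :
    (trans2 ς U σ).1 j = Complex.exp (((j * ς : ℝ) : ℂ) * Complex.I) * (U σ).1 j := rfl

theorem bilin_trans2 (ς : ℝ) (V W : Hinf2) : bilin (trans2 ς V) (trans2 ς W) = bilin V W := by
  rw [bilin_eq, bilin_eq]
  refine tsum_congr fun p => ?_
  rw [trans2_coeff, trans2_coeff, mul_mul_mul_comm, ← Complex.exp_add]
  have : (((p.2 * ς : ℝ) : ℂ) * Complex.I + ((((-p.2 : ℤ) : ℝ) * ς : ℝ) : ℂ) * Complex.I) = 0 := by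
    push_cast; ring
  rw [this, Complex.exp_zero, one_mul]

/-! ### The symplectic form -/

theorem Ec_act_zero (V : Hinf2) : Ec.act V 0 = -(Complex.I • V 1) := by
  simp [LinMat.act, Ec, Fin.sum_univ_two]

theorem Ec_act_one (V : Hinf2) : Ec.act V 1 = Complex.I • V 0 := by
  simp [LinMat.act, Ec, Fin.sum_univ_two]

/-- `E_c` as a linear map. -/
def ecL : Hinf2 →ₗ[ℂ] Hinf2 where
  toFun V := Ec.act V
  map_add' V W := by
    funext σ
    match σ with
    | 0 => rw [Pi.add_apply, Ec_act_zero, Ec_act_zero, Ec_act_zero, Pi.add_apply, smul_add, neg_add]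
    | 1 => rw [Pi.add_apply, Ec_act_one, Ec_act_one, Ec_act_one, Pi.add_apply, smul_add]
  map_smul' c V := by
    funext σ
    match σ with
    | 0 =>
      rw [Pi.smul_apply, Ec_act_zero, Ec_act_zero, Pi.smul_apply, smul_comm, RingHom.id_apply,
        smul_neg]
    | 1 => rw [Pi.smul_apply, Ec_act_one, Ec_act_one, Pi.smul_apply, smul_comm, RingHom.id_apply]

theorem ecL_apply (V : Hinf2) : ecL V = Ec.act V := rfl

theorem ecL_coeff_zero (V : Hinf2) (j : ℤ) : (ecL V 0).1 j = -(Complex.I * (V 1).1 j) := by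
  rw [ecL_apply, Ec_act_zero]; rfl

theorem ecL_coeff_one (V : Hinf2) (j : ℤ) : (ecL V 1).1 j = Complex.I * (V 0).1 j := by
  rw [ecL_apply, Ec_act_one]; rfl

theorem ecL_ecL (V : Hinf2) : ecL (ecL V) = V := by
  refine ext_modes fun σ j => ?_
  match σ with
  | 0 => rw [ecL_coeff_zero, ecL_coeff_one, ← mul_assoc, Complex.I_mul_I]; ring
  | 1 => rw [ecL_coeff_one, ecL_coeff_zero, mul_neg, ← mul_assoc, Complex.I_mul_I]; ring

theorem ecL_trans2 (ς : ℝ) (V : Hinf2) : ecL (trans2 ς V) = trans2 ς (ecL V) := by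
  refine ext_modes fun σ j => ?_
  match σ with
  | 0 => rw [trans2_coeff, ecL_coeff_zero, ecL_coeff_zero, trans2_coeff]; ring
  | 1 => rw [trans2_coeff, ecL_coeff_one, ecL_coeff_one, trans2_coeff]; ring

theorem sobNorm2_ecL (s : ℝ) (V : Hinf2) : sobNorm2 s (ecL V) = sobNorm2 s V := by
  have h : ∀ u v : Hinf, (∀ j, ‖u.1 j‖ = ‖v.1 j‖) → sobNorm s u = sobNorm s v := by
    intro u v h
    simp only [sobNorm, h]
  rw [sobNorm2, sobNorm2, h (ecL V 0) (V 1) fun j => by rw [ecL_coeff_zero]; simp,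
    h (ecL V 1) (V 0) fun j => by rw [ecL_coeff_one]; simp, add_comm]

/-- `Ω_c` as a bilinear map. -/
def omegaL : Hinf2 →ₗ[ℂ] Hinf2 →ₗ[ℂ] ℂ := bilinL.comp ecL

theorem omegaL_apply (V W : Hinf2) : omegaL V W = Omegac V W := rfl

theorem omegaL_eq (V W : Hinf2) : omegaL V W = bilin (ecL V) W := rfl

theorem norm_omegaL_le (s : ℝ) (V W : Hinf2) : ‖omegaL V W‖ ≤ sobNorm2 s V * sobNorm2 (-s) W := by
  rw [← sobNorm2_ecL s V]
  exact norm_bilin_le s _ _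

theorem omegaL_antisymm (V W : Hinf2) : omegaL V W = -omegaL W V := by
  rw [omegaL_eq, omegaL_eq, bilin_comm (ecL W) V, bilin_eq, bilin_eq,
    (summable_bilin _ _ 0).1.of_norm.tsum_prod, (summable_bilin _ _ 0).1.of_norm.tsum_prod,
    tsum_fintype, tsum_fintype, Fin.sum_univ_two, Fin.sum_univ_two, neg_add, ← tsum_neg, ← tsum_neg,
    add_comm]
  congr 1
  · refine tsum_congr fun j => ?_
    simp only [ecL_coeff_zero, ecL_coeff_one]; ring
  · refine tsum_congr fun j => ?_
    simp only [ecL_coeff_zero, ecL_coeff_one]; ring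

theorem omegaL_trans2 (ς : ℝ) (V W : Hinf2) :
    omegaL (trans2 ς V) (trans2 ς W) = omegaL V W := by
  rw [omegaL_eq, ecL_trans2, bilin_trans2, omegaL_eq]

/-! ### Real pairs -/

theorem isRealPair_iff {U : Hinf2} :
    IsRealPair U ↔ ∀ j, (U 1).1 j = (starRingEnd ℂ) ((U 0).1 (-j)) :=
  ⟨fun h j => by rw [h]; rfl, fun h => Subtype.ext (funext h)⟩

theorem IsRealPair.add {U V : Hinf2} (hU : IsRealPair U) (hV : IsRealPair V) :
    IsRealPair (U + V) := by
  rw [isRealPair_iff] at *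
  intro j
  change (U 1).1 j + (V 1).1 j = (starRingEnd ℂ) ((U 0).1 (-j) + (V 0).1 (-j))
  rw [hU, hV, map_add]

theorem isRealPair_zero : IsRealPair 0 := by
  rw [isRealPair_iff]
  intro j
  exact (map_zero _).symm

theorem IsRealPair.smul (r : ℝ) {U : Hinf2} (hU : IsRealPair U) : IsRealPair ((r : ℂ) • U) := by
  rw [isRealPair_iff] at *
  intro j
  change (r : ℂ) * (U 1).1 j = (starRingEnd ℂ) ((r : ℂ) * (U 0).1 (-j))
  rw [hU, map_mul, Complex.conj_ofReal]

theorem IsRealPair.sum {ι : Type*} {T : Finset ι} {f : ι → Hinf2} (h : ∀ i ∈ T, IsRealPair (f i)) :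
    IsRealPair (∑ i ∈ T, f i) :=
  Finset.sum_induction f IsRealPair (fun _ _ => IsRealPair.add) isRealPair_zero h

theorem IsRealPair.multiplier {m : ℤ → ℂ} {hm : ∀ j, ‖m j‖ ≤ 1}
    (h : ∀ j, m j = (starRingEnd ℂ) (m (-j))) {U : Hinf2} (hU : IsRealPair U) :
    IsRealPair (multiplier m hm U) := by
  rw [isRealPair_iff] at *
  intro j
  rw [multiplier_apply, multiplier_apply, hU, map_mul, ← h]

theorem IsRealPair.ecL {U : Hinf2} (hU : IsRealPair U) : IsRealPair (ecL U) := by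
  rw [isRealPair_iff] at *
  intro j
  rw [ecL_coeff_one, ecL_coeff_zero, hU, map_neg, map_mul, Complex.conj_conj, Complex.conj_I, neg_neg]
  ring

theorem bilin_im_of_real {V W : Hinf2} (hV : IsRealPair V) (hW : IsRealPair W) :
    (bilin V W).im = 0 := by
  rw [← Complex.conj_eq_iff_im, bilin_eq, (summable_bilin _ _ 0).1.of_norm.tsum_prod, tsum_fintype,
    Fin.sum_univ_two, map_add, Complex.conj_tsum, Complex.conj_tsum, add_comm]
  rw [isRealPair_iff] at hV hW
  have h0 : ∀ j, (V 0).1 j = (starRingEnd ℂ) ((V 1).1 (-j)) := fun j => by simp [hV]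
  have h1 : ∀ j, (W 0).1 j = (starRingEnd ℂ) ((W 1).1 (-j)) := fun j => by simp [hW]
  congr 1
  · rw [← (Equiv.neg ℤ).tsum_eq]
    refine tsum_congr fun j => ?_
    simp [hV, hW]
  · rw [← (Equiv.neg ℤ).tsum_eq]
    refine tsum_congr fun j => ?_
    simp [hV, hW]

theorem omegaL_im_of_real {V W : Hinf2} (hV : IsRealPair V) (hW : IsRealPair W) :
    (omegaL V W).im = 0 := bilin_im_of_real hV.ecL hW

/-- Two real test pairs supported on the relevant modes suffice: one gives the imaginary part of the
relation between coefficients, the other, twisted by ∓i, gives the real part. -/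
theorem isRealPair_of_bilin {y : Hinf2} (h : ∀ V, IsRealPair V → (bilin y V).im = 0) :
    IsRealPair y := by
  rw [isRealPair_iff]
  intro j
  have hr1 : IsRealPair (mode 1 (-j) + mode 0 j) := by
    rw [isRealPair_iff]
    intro i
    change (mode 1 (-j) 1).1 i + (mode 0 j 1).1 i
      = (starRingEnd ℂ) ((mode 1 (-j) 0).1 (-i) + (mode 0 j 0).1 (-i))
    simp [mode_coeff, neg_eq_iff_eq_neg]
  have hr2 : IsRealPair (-Complex.I • mode 1 (-j) + Complex.I • mode 0 j) := by
    rw [isRealPair_iff]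
    intro i
    change -Complex.I * (mode 1 (-j) 1).1 i + Complex.I * (mode 0 j 1).1 i
      = (starRingEnd ℂ) (-Complex.I * (mode 1 (-j) 0).1 (-i) + Complex.I * (mode 0 j 0).1 (-i))
    simp [mode_coeff, neg_eq_iff_eq_neg, apply_ite (starRingEnd ℂ)]
  have e0 : bilin y (mode 0 j) = (y 0).1 (-j) := by rw [← bilin_mode, neg_neg]
  have h1 := h _ hr1
  have h2 := h _ hr2
  rw [← bilinL_apply, map_add, bilinL_apply, bilinL_apply, bilin_mode, e0] at h1
  rw [← bilinL_apply, map_add, map_smul, map_smul, bilinL_apply, bilinL_apply, bilin_mode, e0] at h2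
  apply Complex.ext
  · simp at h2 ⊢; linarith
  · simp at h1 ⊢; linarith

/-! ### Symmetric multilinear maps -/

section Multilinear

variable {H E : Type*} [AddCommGroup H] [Module ℂ H] [AddCommGroup E] [Module ℂ E]

/-- Symmetry of a multilinear map in all its arguments. -/
def IsSymm {n : ℕ} (F : MultilinearMap ℂ (fun _ : Fin n => H) E) : Prop :=
  ∀ (π : Equiv.Perm (Fin n)) (X : Fin n → H), F (fun i => X (π i)) = F X

/-- The derivative of `U ↦ F(U, …, U)`. -/
def der {ι : Type*} [Fintype ι] [DecidableEq ι] (F : MultilinearMap ℂ (fun _ : ι => H) E)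
    (U V : H) : E :=
  ∑ i, F (Function.update (fun _ => U) i V)

theorem der_domDomCongr {ι κ : Type*} [Fintype ι] [DecidableEq ι] [Fintype κ] [DecidableEq κ]
    (e : ι ≃ κ) (F : MultilinearMap ℂ (fun _ : ι => H) E) (U V : H) :
    der (F.domDomCongr e) U V = der F U V := by
  unfold der
  rw [← e.sum_comp]
  refine Finset.sum_congr rfl fun i _ => ?_
  rw [MultilinearMap.domDomCongr_apply]
  congr 1
  funext j
  by_cases h : j = i
  · subst h; simp
  · simp [h]

theorem der_smul {ι : Type*} [Fintype ι] [DecidableEq ι] (c : ℂ)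
    (F : MultilinearMap ℂ (fun _ : ι => H) E) (U V : H) : der (c • F) U V = c • der F U V := by
  simp [der, Finset.smul_sum]

theorem der_sum {ι κ : Type*} [Fintype ι] [DecidableEq ι] (T : Finset κ)
    (F : κ → MultilinearMap ℂ (fun _ : ι => H) E) (U V : H) :
    der (∑ k ∈ T, F k) U V = ∑ k ∈ T, der (F k) U V := by
  simp only [der, sum_apply]
  rw [Finset.sum_comm]

/-- The symmetrization of a multilinear map. -/
def symmetrize {n : ℕ} (F : MultilinearMap ℂ (fun _ : Fin n => H) E) :
    MultilinearMap ℂ (fun _ : Fin n => H) E :=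
  ((n.factorial : ℂ)⁻¹) • ∑ π : Equiv.Perm (Fin n), F.domDomCongr π

theorem symmetrize_apply {n : ℕ} (F : MultilinearMap ℂ (fun _ : Fin n => H) E) (X : Fin n → H) :
    symmetrize F X = ((n.factorial : ℂ)⁻¹) • ∑ π : Equiv.Perm (Fin n), F (fun i => X (π i)) := by
  rw [symmetrize, smul_apply, sum_apply]
  rfl

theorem isSymm_symmetrize {n : ℕ} (F : MultilinearMap ℂ (fun _ : Fin n => H) E) :
    IsSymm (symmetrize F) := by
  intro π X
  rw [symmetrize_apply, symmetrize_apply]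
  congr 1
  exact Fintype.sum_equiv (Equiv.mulLeft π) _ _ fun ρ => rfl

theorem factorial_smul_inv {n : ℕ} (x : E) :
    ((n.factorial : ℂ)⁻¹) • ∑ _π : Equiv.Perm (Fin n), x = x := by
  rw [Finset.sum_const, Finset.card_univ, Fintype.card_perm, Fintype.card_fin,
    ← Nat.cast_smul_eq_nsmul ℂ, smul_smul, inv_mul_cancel₀, one_smul]
  exact_mod_cast n.factorial_ne_zero

theorem symmetrize_diag {n : ℕ} (F : MultilinearMap ℂ (fun _ : Fin n => H) E) (U : H) :
    symmetrize F (fun _ => U) = F (fun _ => U) := by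
  rw [symmetrize_apply, factorial_smul_inv]

theorem der_symmetrize {n : ℕ} (F : MultilinearMap ℂ (fun _ : Fin n => H) E) (U V : H) :
    der (symmetrize F) U V = der F U V := by
  rw [symmetrize, der_smul, der_sum]
  simp only [der_domDomCongr]
  exact factorial_smul_inv _

theorem snoc_const_eq {H : Type*} {n : ℕ} (U V : H) :
    (Fin.snoc (fun _ : Fin n => U) V : Fin (n + 1) → H)
      = Function.update (fun _ => U) (Fin.last n) V := by
  funext i
  induction i using Fin.lastCases with
  | last => simp
  | cast i => simp [Fin.castSucc_ne_last]

theorem IsSymm.update_eq {n : ℕ} {F : MultilinearMap ℂ (fun _ : Fin (n + 1) => H) E}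
    (hF : IsSymm F) (U V : H) (i : Fin (n + 1)) :
    F (Function.update (fun _ => U) i V) = F (Fin.snoc (fun _ : Fin n => U) V) := by
  rw [snoc_const_eq, ← hF (Equiv.swap i (Fin.last n)) (Function.update _ (Fin.last n) V)]
  congr 1
  funext j
  by_cases h : j = i
  · subst h; simp
  · rw [Function.update_of_ne h]
    by_cases h' : j = Fin.last n
    · subst h'
      rw [Equiv.swap_apply_right, Function.update_of_ne (Ne.symm h)]
    · rw [Equiv.swap_apply_of_ne_of_ne h h', Function.update_of_ne h']

theorem IsSymm.der_eq {n : ℕ} {F : MultilinearMap ℂ (fun _ : Fin (n + 1) => H) E}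
    (hF : IsSymm F) (U V : H) :
    der F U V = ((n : ℂ) + 1) • F (Fin.snoc (fun _ : Fin n => U) V) := by
  unfold der
  simp only [hF.update_eq]
  rw [Finset.sum_const, Finset.card_univ, Fintype.card_fin, ← Nat.cast_smul_eq_nsmul ℂ]
  push_cast
  rfl

/-- Toggling a fixed element outside `S` preserves the condition `S ⊆ T` and flips the sign. -/
theorem sum_neg_one_pow_superset {ι : Type*} [Fintype ι] [DecidableEq ι] {S : Finset ι}
    (hS : S ≠ Finset.univ) :
    ∑ T : Finset ι, (if S ⊆ T then (-1 : ℝ) ^ T.card else 0) = 0 := by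
  obtain ⟨a, ha⟩ : ∃ a, a ∉ S := by
    by_contra! h
    exact hS (Finset.eq_univ_of_forall h)
  refine Finset.sum_involution (fun T _ => if a ∈ T then T.erase a else insert a T) ?_ ?_ ?_ ?_
  · intro T _
    by_cases h : a ∈ T
    · have h1 : S ⊆ T.erase a ↔ S ⊆ T :=
        ⟨fun h' => h'.trans (Finset.erase_subset _ _), fun h' => Finset.subset_erase.2 ⟨h', ha⟩⟩
      rw [if_pos h]
      simp only [h1]
      rw [← Finset.card_erase_add_one h, pow_succ]
      split_ifs <;> ring
    · have h1 : S ⊆ insert a T ↔ S ⊆ T :=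
        ⟨fun h' => (Finset.subset_insert_iff_of_notMem ha).1 h',
          fun h' => h'.trans (Finset.subset_insert _ _)⟩
      rw [if_neg h]
      simp only [h1]
      rw [Finset.card_insert_of_notMem h, pow_succ]
      split_ifs <;> ring
  · intro T _ _
    by_cases h : a ∈ T
    · rw [if_pos h]
      exact fun h' => Finset.notMem_erase a T (h'.symm ▸ h)
    · rw [if_neg h]
      exact fun h' => h (h' ▸ Finset.mem_insert_self a T)
  · intro T _; exact Finset.mem_univ _
  · intro T _
    by_cases h : a ∈ T
    · simp [h, Finset.insert_erase h]
    · simp [h, Finset.erase_insert h]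

/-- Polarization: a symmetric multilinear map is a combination of its values on the diagonal. -/
theorem exists_polarization (n : ℕ) : ∃ c : ℝ, c ≠ 0 ∧
    ∀ F : MultilinearMap ℂ (fun _ : Fin n => H) E, IsSymm F → ∀ X : Fin n → H,
      (c : ℂ) • F X = ∑ T : Finset (Fin n), (((-1 : ℝ) ^ T.card : ℝ) : ℂ) • F (fun _ => ∑ i ∈ T, X i) := by
  classical
  -- The number of surjections of `Fin n` to itself. Only its non-vanishing matters, and the
  -- identity is a witness.
  set N := (Finset.univ.filter fun r : Fin n → Fin n => Function.Surjective r).card with hN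
  refine ⟨(-1 : ℝ) ^ n * N, mul_ne_zero (by simp) ?_, fun F hF X => ?_⟩
  · have : id ∈ Finset.univ.filter fun r : Fin n → Fin n => Function.Surjective r := by
      simpa using Function.surjective_id
    exact_mod_cast (Finset.card_pos.2 ⟨_, this⟩).ne'
  have h1 : ∀ T : Finset (Fin n), F (fun _ => ∑ i ∈ T, X i)
      = ∑ r : Fin n → Fin n, if Finset.univ.image r ⊆ T then F (fun i => X (r i)) else 0 := by
    intro T
    rw [MultilinearMap.map_sum_finset F (fun _ => X) (fun _ => T), ← Finset.sum_filter]
    refine Finset.sum_congr ?_ fun _ _ => rfl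
    ext r
    simp [Fintype.mem_piFinset, Finset.image_subset_iff]
  -- After exchanging the sums, inclusion-exclusion over `T` kills every choice of indices `r` that
  -- misses some value. The surjective ones are permutations and give `F X` by symmetry.
  simp only [h1, Finset.smul_sum]
  rw [Finset.sum_comm]
  have h2 : ∀ r : Fin n → Fin n, (∑ T : Finset (Fin n), (((-1 : ℝ) ^ T.card : ℝ) : ℂ) •
      if Finset.univ.image r ⊆ T then F (fun i => X (r i)) else 0)
      = if Function.Surjective r then (((-1 : ℝ) ^ n : ℝ) : ℂ) • F X else 0 := by
    intro r
    have h3 : ∀ T : Finset (Fin n), ((((-1 : ℝ) ^ T.card : ℝ) : ℂ) •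
        if Finset.univ.image r ⊆ T then F (fun i => X (r i)) else 0)
        = (((if Finset.univ.image r ⊆ T then (-1 : ℝ) ^ T.card else 0 : ℝ)) : ℂ) •
          F (fun i => X (r i)) := by
      intro T; split_ifs <;> simp
    simp only [h3]
    rw [← Finset.sum_smul, ← Complex.ofReal_sum]
    by_cases hr : Function.Surjective r
    · rw [if_pos hr, Finset.image_univ_of_surjective hr]
      have h4 : ∀ T : Finset (Fin n), (if Finset.univ ⊆ T then (-1 : ℝ) ^ T.card else 0)
          = if T = Finset.univ then (-1 : ℝ) ^ n else 0 := by
        intro T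
        simp only [Finset.univ_subset_iff]
        split_ifs with h
        · subst h; simp
        · rfl
      simp only [h4]
      rw [Finset.sum_ite_eq']
      simp only [Finset.mem_univ, if_true]
      congr 1
      exact hF (Equiv.ofBijective r (Finite.surjective_iff_bijective.1 hr)) X
    · rw [if_neg hr, sum_neg_one_pow_superset, Complex.ofReal_zero, zero_smul]
      intro h
      refine hr fun a => ?_
      have := h ▸ Finset.mem_univ a
      simpa using this
  simp only [h2]
  rw [← Finset.sum_filter, Finset.sum_const, ← hN, ← Nat.cast_smul_eq_nsmul ℂ, smul_smul]
  push_cast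
  rw [mul_comm]

theorem IsSymm.eq_of_diag {n : ℕ} {F G : MultilinearMap ℂ (fun _ : Fin n => H) E}
    (hF : IsSymm F) (hG : IsSymm G) (h : ∀ U, F (fun _ => U) = G (fun _ => U)) : F = G := by
  have hs : IsSymm (F - G) := fun π X => by
    rw [sub_apply, sub_apply, hF π X, hG π X]
  obtain ⟨c, hc, hp⟩ := exists_polarization (H := H) (E := E) n
  ext X
  have h1 := hp _ hs X
  simp only [sub_apply, h, sub_self, smul_zero, Finset.sum_const_zero] at h1
  rw [← sub_eq_zero]
  exact (smul_eq_zero.1 h1).resolve_left (by exact_mod_cast hc)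

/-- The polarization identity has real coefficients, so properties stable under real combinations,
such as reality, pass from the diagonal to arbitrary arguments. -/
theorem IsSymm.mem_of_diag {n : ℕ} {F : MultilinearMap ℂ (fun _ : Fin n => H) E}
    (hF : IsSymm F) {P : H → Prop} {Q : E → Prop} (hP0 : P 0) (hPadd : ∀ x y, P x → P y → P (x + y))
    (hQ0 : Q 0) (hQadd : ∀ x y, Q x → Q y → Q (x + y)) (hQsmul : ∀ (r : ℝ) x, Q x → Q ((r : ℂ) • x))
    (h : ∀ U, P U → Q (F (fun _ => U))) (X : Fin n → H) (hX : ∀ i, P (X i)) : Q (F X) := by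
  obtain ⟨c, hc, hp⟩ := exists_polarization (H := H) (E := E) n
  have h1 : F X = ((c⁻¹ : ℝ) : ℂ) • ((c : ℂ) • F X) := by
    rw [smul_smul, ← Complex.ofReal_mul, inv_mul_cancel₀ hc, Complex.ofReal_one, one_smul]
  rw [h1, hp F hF]
  refine hQsmul _ _ (Finset.sum_induction _ Q hQadd hQ0 fun T _ => hQsmul _ _ (h _ ?_))
  exact Finset.sum_induction _ P hPadd hP0 fun i _ => hX i

end Multilinear

/-- Rescale the arguments to unit norm and polarize: a sum of |T| unit vectors has norm at most |T|.
The constant depends on n alone, so further variables may be frozen in `F` without losing uniformity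
in them. -/
theorem exists_bound_of_diag (n : ℕ) : ∃ c : ℝ, 0 ≤ c ∧
    ∀ F : MultilinearMap ℂ (fun _ : Fin n => Hinf2) ℂ, IsSymm F → ∀ s K : ℝ, 0 ≤ K →
      (∀ U, ‖F (fun _ => U)‖ ≤ K * sobNorm2 s U ^ n) →
      ∀ X, ‖F X‖ ≤ c * K * ∏ i, sobNorm2 s (X i) := by
  obtain ⟨c, hc, hp⟩ := exists_polarization (H := Hinf2) (E := ℂ) n
  refine ⟨|c|⁻¹ * ∑ T : Finset (Fin n), (T.card : ℝ) ^ n, by positivity, fun F hF s K hK h X => ?_⟩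
  have key : ∀ Y : Fin n → Hinf2, (∀ i, sobNorm2 s (Y i) = 1) →
      ‖F Y‖ ≤ |c|⁻¹ * (∑ T : Finset (Fin n), (T.card : ℝ) ^ n) * K := by
    intro Y hY
    have h1 : |c| * ‖F Y‖ ≤ ∑ T : Finset (Fin n), K * (T.card : ℝ) ^ n := by
      have h2 : |c| * ‖F Y‖ = ‖(c : ℂ) • F Y‖ := by
        rw [norm_smul, Complex.norm_real, Real.norm_eq_abs]
      rw [h2, hp F hF]
      refine (norm_sum_le _ _).trans (Finset.sum_le_sum fun T _ => ?_)
      rw [norm_smul, Complex.norm_real, norm_pow, norm_neg, norm_one, one_pow, one_mul]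
      refine (h _).trans ?_
      have h3 : sobNorm2 s (∑ i ∈ T, Y i) ≤ T.card := by
        refine (sobNorm2_sum_le s T Y).trans ?_
        simp [hY]
      have := sobNorm2_nonneg s (∑ i ∈ T, Y i)
      gcongr
    have hc' : 0 < |c| := abs_pos.2 hc
    rw [← Finset.mul_sum] at h1
    rw [mul_assoc, inv_mul_eq_div, le_div_iff₀ hc']
    linarith
  -- An argument of zero norm cannot be normalized, but it is zero and both sides vanish.
  by_cases hX : ∃ i, sobNorm2 s (X i) = 0
  · obtain ⟨i, hi⟩ := hX
    rw [F.map_coord_zero i (eq_zero_of_sobNorm2_eq_zero hi), norm_zero,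
      Finset.prod_eq_zero (Finset.mem_univ i) hi, mul_zero]
  · push Not at hX
    have hX' : ∀ i, (sobNorm2 s (X i) : ℂ) ≠ 0 := fun i => by exact_mod_cast hX i
    have e : X = fun i => (sobNorm2 s (X i) : ℂ) • ((sobNorm2 s (X i) : ℂ)⁻¹ • X i) := by
      funext i
      rw [smul_smul, mul_inv_cancel₀ (hX' i), one_smul]
    have h1 := key (fun i => (sobNorm2 s (X i) : ℂ)⁻¹ • X i) fun i => by
      rw [sobNorm2_smul, norm_inv, Complex.norm_real, Real.norm_eq_abs,
        abs_of_nonneg (sobNorm2_nonneg _ _), inv_mul_cancel₀ (hX i)]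
    have e' : F X = (∏ i, (sobNorm2 s (X i) : ℂ)) •
        F (fun i => (sobNorm2 s (X i) : ℂ)⁻¹ • X i) := by
      rw [← F.map_smul_univ, ← e]
    rw [e', norm_smul, norm_prod]
    simp only [Complex.norm_real, Real.norm_eq_abs, abs_of_nonneg (sobNorm2_nonneg s _)]
    have h2 : 0 ≤ ∏ i, sobNorm2 s (X i) := Finset.prod_nonneg fun i _ => sobNorm2_nonneg _ _
    rw [mul_comm]
    exact mul_le_mul_of_nonneg_right h1 h2

/-! ### Multilinear vector fields -/

/-- Multilinear maps with values in `Ḣ^∞(𝕋; ℂ²)`. -/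
abbrev VF (n : ℕ) : Type := MultilinearMap ℂ (fun _ : Fin n => Hinf2) Hinf2

/-- Continuity in `Ḣ^∞`, equivariance under translations, and reality. -/
structure IsNice {ι : Type*} [Fintype ι] (F : MultilinearMap ℂ (fun _ : ι => Hinf2) Hinf2) :
    Prop where
  bdd : ∀ s : ℝ, ∃ s' C : ℝ, 0 ≤ C ∧ ∀ X, sobNorm2 s (F X) ≤ C * ∏ i, sobNorm2 s' (X i)
  trans : ∀ (ς : ℝ) X, F (fun i => trans2 ς (X i)) = trans2 ς (F X)
  real : ∀ X, (∀ i, IsRealPair (X i)) → IsRealPair (F X)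

/-- A multilinear vector field which regularizes with respect to each of its arguments. -/
def IsRegularizing {n : ℕ} (F : VF n) : Prop :=
  ∀ (i : Fin n) (s t : ℝ), ∃ s' C : ℝ, 0 ≤ C ∧ ∀ X,
    sobNorm2 s (F X) ≤ C * sobNorm2 t (X i) * ∏ l ∈ Finset.univ.erase i, sobNorm2 s' (X l)

/-- `bilin_mode` forces the coefficients of the representing field. Boundedness of `η` in V on every
Sobolev space makes them decrease rapidly, and `eq_of_modes` extends the identity from modes to all
V. -/
theorem exists_riesz {n : ℕ}
    (η : MultilinearMap ℂ (fun _ : Fin n => Hinf2) (Hinf2 →ₗ[ℂ] ℂ))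
    (h : ∀ s : ℝ, ∃ s' C : ℝ, 0 ≤ C ∧ ∀ X V, ‖η X V‖ ≤ C * (∏ i, sobNorm2 s' (X i)) * sobNorm2 s V) :
    ∃ F : VF n, ∀ X V, bilin (F X) V = η X V := by
  have hmem : ∀ X σ, (fun j : ℤ => η X (mode σ (-j))) ∈ Hinf := by
    intro X σ
    -- The convention that the mode of frequency 0 is zero gives the zero average.
    have hm : mode σ (-0) = 0 := by
      refine ext_modes fun σ' i => ?_
      rw [mode_coeff, if_neg (by simp)]; rfl
    refine mem_Hinf_of_decay (by rw [hm, map_zero]) fun s => ?_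
    obtain ⟨s', C, hC, hb⟩ := h (-s)
    have h0 : 0 ≤ ∏ i, sobNorm2 s' (X i) := Finset.prod_nonneg fun i _ => sobNorm2_nonneg _ _
    exact ⟨C * ∏ i, sobNorm2 s' (X i), fun j hj =>
      coeff_le_of_mode_bound hj (by positivity) (hb X _)⟩
  let F : VF n := MultilinearMap.mk' (fun X σ => ⟨fun j => η X (mode σ (-j)), hmem X σ⟩)
    (fun X i x y => by
      refine ext_modes fun σ j => ?_
      change η _ (mode σ (-j)) = η _ (mode σ (-j)) + η _ (mode σ (-j))
      rw [MultilinearMap.map_update_add]; rfl)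
    (fun X i c x => by
      refine ext_modes fun σ j => ?_
      change η _ (mode σ (-j)) = c * η _ (mode σ (-j))
      rw [MultilinearMap.map_update_smul]; rfl)
  refine ⟨F, fun X V => ?_⟩
  obtain ⟨s', C, hC, hb⟩ := h 0
  have he : bilinL (F X) = η X := by
    refine eq_of_modes (C := sobNorm2 0 (F X)) (s := -0) (fun V => norm_bilin_le 0 _ _) (hb X)
      fun σ j => ?_
    have h1 := bilin_mode (F X) σ (-j)
    rw [neg_neg] at h1
    rw [bilinL_apply, h1]
    change η X (mode σ (- -j)) = _
    rw [neg_neg]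
  rw [← he]; rfl

theorem trans2_neg_trans2 (ς : ℝ) (V : Hinf2) : trans2 ς (trans2 (-ς) V) = V := by
  refine ext_modes fun σ j => ?_
  rw [trans2_coeff, trans2_coeff, ← mul_assoc, ← Complex.exp_add]
  have : (((j * ς : ℝ) : ℂ) * Complex.I + ((j * -ς : ℝ) : ℂ) * Complex.I) = 0 := by
    push_cast; ring
  rw [this, Complex.exp_zero, one_mul]

theorem eq_of_bilin {y z : Hinf2} (h : ∀ V, bilin y V = bilin z V) : y = z :=
  ext_modes fun σ j => by rw [← bilin_mode, ← bilin_mode, h]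

/-- A regularizing form with values in the dual is represented by a nice vector field. -/
theorem exists_nice_riesz {n : ℕ}
    (η : MultilinearMap ℂ (fun _ : Fin (n + 1) => Hinf2) (Hinf2 →ₗ[ℂ] ℂ))
    (hreg : ∀ (i : Fin (n + 1)) (s : ℝ), ∃ s' C : ℝ, 0 ≤ C ∧ ∀ X V, ‖η X V‖ ≤
      C * sobNorm2 (-s) (X i) * (∏ l ∈ Finset.univ.erase i, sobNorm2 s' (X l)) * sobNorm2 (-s) V)
    (htrans : ∀ (ς : ℝ) X V, η (fun i => trans2 ς (X i)) (trans2 ς V) = η X V)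
    (hreal : ∀ X V, (∀ i, IsRealPair (X i)) → IsRealPair V → (η X V).im = 0) :
    ∃ F : VF (n + 1), (∀ X V, bilin (F X) V = η X V) ∧ IsNice F ∧ IsRegularizing F := by
  have h : ∀ s : ℝ, ∃ s' C : ℝ, 0 ≤ C ∧
      ∀ X V, ‖η X V‖ ≤ C * (∏ i, sobNorm2 s' (X i)) * sobNorm2 s V := by
    intro s
    -- Any slot would do. The sign makes V appear in `Ḣˢ`, and the slot 0 is then absorbed into the
    -- common exponent `max s' s`.
    obtain ⟨s', C, hC, hb⟩ := hreg 0 (-s)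
    refine ⟨max s' s, C, hC, fun X V => (hb X V).trans ?_⟩
    rw [neg_neg, ← Finset.mul_prod_erase _ _ (Finset.mem_univ (0 : Fin (n + 1))), ← mul_assoc]
    have h1 := sobNorm2_mono (le_max_right s' s) (X 0)
    have h2 := sobNorm2_nonneg s (X 0)
    have h3 := sobNorm2_nonneg s V
    have h4 : ∏ l ∈ Finset.univ.erase 0, sobNorm2 s' (X l)
        ≤ ∏ l ∈ Finset.univ.erase 0, sobNorm2 (max s' s) (X l) :=
      Finset.prod_le_prod (fun _ _ => sobNorm2_nonneg _ _)
        fun l _ => sobNorm2_mono (le_max_left _ _) _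
    have h5 : 0 ≤ ∏ l ∈ Finset.univ.erase 0, sobNorm2 s' (X l) :=
      Finset.prod_nonneg fun _ _ => sobNorm2_nonneg _ _
    have h6 := mul_nonneg hC (h2.trans h1)
    exact mul_le_mul_of_nonneg_right (mul_le_mul (mul_le_mul_of_nonneg_left h1 hC) h4 h5 h6) h3
  obtain ⟨F, hF⟩ := exists_riesz η h
  refine ⟨F, hF, ⟨fun s => ?_, fun ς X => ?_, fun X hX => ?_⟩, fun i s t => ?_⟩
  · obtain ⟨s', C, hC, hb⟩ := h (-(s + 1))
    refine ⟨s', dualConst * C, mul_nonneg dualConst_nonneg hC, fun X => ?_⟩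
    rw [mul_assoc]
    refine sobNorm2_le_of_dual
      (mul_nonneg hC (Finset.prod_nonneg fun _ _ => sobNorm2_nonneg _ _)) fun Z => ?_
    rw [hF]; exact hb X Z
  · refine eq_of_bilin fun V => ?_
    rw [hF, ← trans2_neg_trans2 ς V, htrans, bilin_trans2, hF]
  · refine isRealPair_of_bilin fun V hV => ?_
    rw [hF]; exact hreal X V hX hV
  -- The order must be at least s + 1 for the dual estimate of the output, and at least -t so that
  -- the argument in slot i is measured no more strongly than in `Ḣᵗ`.
  · obtain ⟨s', C, hC, hb⟩ := hreg i (max (s + 1) (-t))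
    refine ⟨s', dualConst * C, mul_nonneg dualConst_nonneg hC, fun X => ?_⟩
    have h5 : 0 ≤ ∏ l ∈ Finset.univ.erase i, sobNorm2 s' (X l) :=
      Finset.prod_nonneg fun _ _ => sobNorm2_nonneg _ _
    have h6 := sobNorm2_nonneg t (X i)
    have h7 := hb X
    generalize ∏ l ∈ Finset.univ.erase i, sobNorm2 s' (X l) = P at h5 h7 ⊢
    rw [mul_assoc, mul_assoc]
    refine sobNorm2_le_of_dual (mul_nonneg hC (mul_nonneg h6 h5)) fun Z => ?_
    rw [hF]
    refine (h7 Z).trans ?_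
    have h1 : sobNorm2 (-max (s + 1) (-t)) (X i) ≤ sobNorm2 t (X i) :=
      sobNorm2_mono (by have := le_max_right (s + 1) (-t); linarith) _
    have h2 : sobNorm2 (-max (s + 1) (-t)) Z ≤ sobNorm2 (-(s + 1)) Z :=
      sobNorm2_mono (by have := le_max_left (s + 1) (-t); linarith) _
    have h3 := sobNorm2_nonneg (-max (s + 1) (-t)) (X i)
    have h4 := sobNorm2_nonneg (-max (s + 1) (-t)) Z
    rw [← mul_assoc C]
    exact mul_le_mul (mul_le_mul_of_nonneg_right (mul_le_mul_of_nonneg_left h1 hC) h5) h2 h4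
      (mul_nonneg (mul_nonneg hC h6) h5)

/-! ### Correction of a primitive by an exact form -/

/-- The symbol which is `1` below frequency `n`, `1/2` at `n` and `0` above. -/
def halfSymbol (n : ℕ) (k : ℕ) : ℝ := if k < n then 1 else if k = n then 1 / 2 else 0

theorem halfSymbol_nonneg (n k : ℕ) : 0 ≤ halfSymbol n k := by
  unfold halfSymbol; split_ifs <;> norm_num

theorem halfSymbol_le_one (n k : ℕ) : halfSymbol n k ≤ 1 := by
  unfold halfSymbol; split_ifs <;> norm_num

/-- The multiplier with symbol `halfSymbol n`. -/
def halfL (n : ℕ) : Hinf2 →ₗ[ℂ] Hinf2 :=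
  multiplier (fun j => (halfSymbol n j.natAbs : ℂ)) fun j => by
    rw [Complex.norm_real, Real.norm_eq_abs, abs_of_nonneg (halfSymbol_nonneg _ _)]
    exact halfSymbol_le_one _ _

theorem halfL_proj2 (n m : ℕ) (U : Hinf2) :
    halfL n (proj2 m U) = (halfSymbol n m : ℂ) • proj2 m U := by
  refine ext_modes fun σ j => ?_
  change (halfSymbol n j.natAbs : ℂ) * (proj2 m U σ).1 j = (halfSymbol n m : ℂ) * (proj2 m U σ).1 j
  rw [proj2_coeff]
  split_ifs with h
  · rw [h]
  · simp

theorem multiplier_trans2 (m : ℤ → ℂ) (hm : ∀ j, ‖m j‖ ≤ 1) (ς : ℝ) (U : Hinf2) :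
    multiplier m hm (trans2 ς U) = trans2 ς (multiplier m hm U) := by
  refine ext_modes fun σ j => ?_
  rw [multiplier_apply, trans2_coeff, trans2_coeff, multiplier_apply]
  ring

variable {ι : Type*} [DecidableEq ι]

/-- The cut-off in the `b`-th argument when the `a`-th one has the highest frequency `n`. -/
def cutoff (n : ℕ) (a b : ι) : Hinf2 →ₗ[ℂ] Hinf2 := if b = a then projL n else halfL n

theorem cutoff_le (n : ℕ) (a b : ι) (s : ℝ) (U : Hinf2) :
    sobNorm2 s (cutoff n a b U) ≤ sobNorm2 s U := by
  unfold cutoff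
  split_ifs
  · exact multiplier_le _ _ _ _
  · exact multiplier_le _ _ _ _

theorem cutoff_trans2 (n : ℕ) (a b : ι) (ς : ℝ) (U : Hinf2) :
    cutoff n a b (trans2 ς U) = trans2 ς (cutoff n a b U) := by
  unfold cutoff
  split_ifs
  · exact multiplier_trans2 _ _ _ _
  · exact multiplier_trans2 _ _ _ _

theorem IsRealPair.cutoff (n : ℕ) (a b : ι) {U : Hinf2} (hU : IsRealPair U) :
    IsRealPair (cutoff n a b U) := by
  unfold PluriHom.cutoff
  split_ifs
  · refine hU.multiplier fun j => ?_
    rw [Int.natAbs_neg]; split_ifs <;> simp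
  · refine hU.multiplier fun j => ?_
    rw [Int.natAbs_neg, Complex.conj_ofReal]

/-- The `a`-th argument, at frequency `n`, is moved to the slot `o`. -/
def topTerm (A : MultilinearMap ℂ (fun _ : ι => Hinf2) ℂ) (o : ι) (n : ℕ) (a : ι) :
    MultilinearMap ℂ (fun _ : ι => Hinf2) ℂ :=
  (A.domDomCongr (Equiv.swap o a)).compLinearMap (cutoff n a)

theorem topTerm_apply (A : MultilinearMap ℂ (fun _ : ι => Hinf2) ℂ) (o : ι) (n : ℕ) (a : ι)
    (X : ι → Hinf2) : topTerm A o n a X =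
      A (fun i => cutoff n a (Equiv.swap o a i) (X (Equiv.swap o a i))) := rfl

variable [Fintype ι]

/-- The slot `a` is projected on frequency n, so giving up two derivatives there yields n⁻². This
makes the series over n defining `topForm` converge; the other cut-offs do not increase norms. -/
theorem norm_topTerm_le {A : MultilinearMap ℂ (fun _ : ι => Hinf2) ℂ} {s C : ℝ}
    (hb : ∀ X, ‖A X‖ ≤ C * ∏ i, sobNorm2 s (X i)) (hC : 0 ≤ C) (o : ι) (n : ℕ) (a : ι)
    (X : ι → Hinf2) :
    ‖topTerm A o n a X‖ ≤ C * (∏ b, sobNorm2 (s + 2) (X b)) * (n : ℝ) ^ (-2 : ℝ) := by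
  rw [topTerm_apply]
  refine (hb _).trans ?_
  rw [mul_assoc]
  refine mul_le_mul_of_nonneg_left ?_ hC
  rw [Equiv.prod_comp (Equiv.swap o a) fun b => sobNorm2 s (cutoff n a b (X b))]
  rw [← Finset.mul_prod_erase _ _ (Finset.mem_univ a),
    ← Finset.mul_prod_erase Finset.univ (fun b => sobNorm2 (s + 2) (X b)) (Finset.mem_univ a),
    mul_right_comm]
  refine mul_le_mul ?_ ?_ (Finset.prod_nonneg fun _ _ => sobNorm2_nonneg _ _)
    (mul_nonneg (sobNorm2_nonneg _ _) (by positivity))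
  · rw [cutoff, if_pos rfl, projL_apply]
    rcases Nat.eq_zero_or_pos n with rfl | hn
    · rw [proj2_zero, sobNorm2_zero]
      exact mul_nonneg (sobNorm2_nonneg _ _) (by positivity)
    · rw [sobNorm2_proj2 hn s (s + 2), show s - (s + 2) = -2 by ring, mul_comm]
      exact mul_le_mul_of_nonneg_right (proj2_le _ _ _) (by positivity)
  · exact Finset.prod_le_prod (fun _ _ => sobNorm2_nonneg _ _) fun b _ =>
      (cutoff_le _ _ _ _ _).trans (sobNorm2_mono (by linarith) _)

theorem summable_topTerm {A : MultilinearMap ℂ (fun _ : ι => Hinf2) ℂ} (hA : FormBdd A) (o a : ι)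
    (X : ι → Hinf2) : Summable fun n => topTerm A o n a X := by
  obtain ⟨s, C, hs, hC, hb⟩ := hA
  have hsum : Summable fun n : ℕ => C * (∏ b, sobNorm2 (s + 2) (X b)) * (n : ℝ) ^ (-2 : ℝ) :=
    (Real.summable_nat_rpow.2 (by norm_num)).mul_left _
  exact Summable.of_norm_bounded hsum fun n => norm_topTerm_le hb hC o n a X

/-- The symmetric form which takes the argument of highest frequency to the slot `o` of `A`. -/
def topForm {A : MultilinearMap ℂ (fun _ : ι => Hinf2) ℂ} (hA : FormBdd A) (o : ι) :
    MultilinearMap ℂ (fun _ : ι => Hinf2) ℂ :=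
  ∑ a, MultilinearMap.mk' (fun X => ∑' n, topTerm A o n a X)
    (fun X i x y => by
      simp only [MultilinearMap.map_update_add]
      exact (summable_topTerm hA o a _).tsum_add (summable_topTerm hA o a _))
    (fun X i c x => by
      simp only [MultilinearMap.map_update_smul, smul_eq_mul]
      exact tsum_mul_left)

theorem topForm_apply {A : MultilinearMap ℂ (fun _ : ι => Hinf2) ℂ} (hA : FormBdd A) (o : ι)
    (X : ι → Hinf2) : topForm hA o X = ∑ a, ∑' n, topTerm A o n a X := by
  rw [topForm, sum_apply]
  rfl

/-- Permuting the arguments by `π` carries the term of `a` to that of `π a`. The two ways of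
bringing this argument to the slot `o` differ by a permutation fixing `o`, under which `A` is
invariant. -/
theorem topForm_symm {A : MultilinearMap ℂ (fun _ : ι => Hinf2) ℂ} (hA : FormBdd A) {o : ι}
    (hsym : ∀ π : Equiv.Perm ι, π o = o → ∀ X, A (fun i => X (π i)) = A X)
    (π : Equiv.Perm ι) (X : ι → Hinf2) : topForm hA o (fun i => X (π i)) = topForm hA o X := by
  rw [topForm_apply, topForm_apply, ← Equiv.sum_comp π fun a => ∑' n, topTerm A o n a X]
  refine Finset.sum_congr rfl fun a _ => tsum_congr fun n => ?_
  rw [topTerm_apply, topTerm_apply]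
  refine Eq.trans ?_ (hsym ((Equiv.swap o a).trans (π.trans (Equiv.swap o (π a)))) (by simp) _)
  congr 1
  funext i
  simp only [Equiv.trans_apply, Equiv.swap_apply_self]
  unfold cutoff
  simp

theorem topForm_trans {A : MultilinearMap ℂ (fun _ : ι => Hinf2) ℂ} (hA : FormBdd A) {o : ι}
    (ht : ∀ (ς : ℝ) X, A (fun i => trans2 ς (X i)) = A X) (ς : ℝ) (X : ι → Hinf2) :
    topForm hA o (fun i => trans2 ς (X i)) = topForm hA o X := by
  rw [topForm_apply, topForm_apply]
  refine Finset.sum_congr rfl fun a _ => tsum_congr fun n => ?_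
  simp only [topTerm_apply, cutoff_trans2]
  exact ht ς _

theorem topForm_real {A : MultilinearMap ℂ (fun _ : ι => Hinf2) ℂ} (hA : FormBdd A) {o : ι}
    (hr : ∀ X, (∀ i, IsRealPair (X i)) → (A X).im = 0) (X : ι → Hinf2)
    (hX : ∀ i, IsRealPair (X i)) : (topForm hA o X).im = 0 := by
  rw [topForm_apply, ← Complex.conj_eq_iff_im, map_sum]
  refine Finset.sum_congr rfl fun a _ => ?_
  rw [Complex.conj_tsum]
  refine tsum_congr fun n => ?_
  rw [Complex.conj_eq_iff_im, topTerm_apply]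
  exact hr _ fun i => (hX _).cutoff _ _ _

/-- The weight of `topForm` on a frequency block. -/
def topWeight (ν : ι → ℕ) (a : ι) : ℝ := ∏ b, if b = a then 1 else halfSymbol (ν a) (ν b)

/-- On a block only the frequency n = ν a survives in the term of `a`, and the remaining cut-offs
act as scalars. -/
theorem topForm_block {A : MultilinearMap ℂ (fun _ : ι => Hinf2) ℂ} (hA : FormBdd A) (o : ι)
    (ν : ι → ℕ) (X : ι → Hinf2) : topForm hA o (fun i => proj2 (ν i) (X i)) =
      ∑ a, (topWeight ν a : ℂ) *
        A (fun i => proj2 (ν (Equiv.swap o a i)) (X (Equiv.swap o a i))) := by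
  rw [topForm_apply]
  refine Finset.sum_congr rfl fun a _ => ?_
  rw [tsum_eq_single (ν a)]
  · rw [topTerm_apply]
    have h1 : ∀ b, cutoff (ν a) a b (proj2 (ν b) (X b)) =
        ((if b = a then 1 else halfSymbol (ν a) (ν b) : ℝ) : ℂ) • proj2 (ν b) (X b) := by
      intro b
      unfold cutoff
      by_cases h : b = a
      · subst h; simp [projL_apply, proj2_proj2]
      · rw [if_neg h, if_neg h, halfL_proj2]
    simp only [h1]
    rw [A.map_smul_univ, smul_eq_mul, Equiv.prod_comp (Equiv.swap o a)
      fun b => (((if b = a then 1 else halfSymbol (ν a) (ν b) : ℝ)) : ℂ), topWeight,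
      Complex.ofReal_prod]
  · intro n hn
    rw [topTerm_apply]
    refine A.map_coord_zero o ?_
    rw [Equiv.swap_apply_left, cutoff, if_pos rfl, projL_apply, proj2_proj2, if_neg hn]

theorem topWeight_nonneg (ν : ι → ℕ) (a : ι) : 0 ≤ topWeight ν a :=
  Finset.prod_nonneg fun b _ => by
    split_ifs
    · exact zero_le_one
    · exact halfSymbol_nonneg _ _

theorem topWeight_le_one (ν : ι → ℕ) (a : ι) : topWeight ν a ≤ 1 :=
  Finset.prod_le_one
    (fun b _ => by
      split_ifs
      · exact zero_le_one
      · exact halfSymbol_nonneg _ _)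
    (fun b _ => by
      split_ifs
      · exact le_rfl
      · exact halfSymbol_le_one _ _)

theorem topWeight_eq_one {ν : ι → ℕ} {a : ι} (h : ∀ b, b ≠ a → ν b < ν a) :
    topWeight ν a = 1 :=
  Finset.prod_eq_one fun b _ => by
    by_cases hb : b = a
    · rw [if_pos hb]
    · rw [if_neg hb, halfSymbol, if_pos (h b hb)]

theorem topWeight_eq_zero {ν : ι → ℕ} {a b : ι} (h : ν a < ν b) : topWeight ν a = 0 := by
  refine Finset.prod_eq_zero (Finset.mem_univ b) ?_
  have hb : b ≠ a := by rintro rfl; exact lt_irrefl _ h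
  rw [if_neg hb, halfSymbol, if_neg (by omega), if_neg (by omega)]

/-- When exactly two slots share the top frequency they have equal weights with sum one; this is the
purpose of the value 1/2 in `halfSymbol`. -/
theorem topWeight_eq_half {ν : ι → ℕ} {a b : ι} (hab : b ≠ a) (he : ν b = ν a)
    (h : ∀ c, c ≠ a → c ≠ b → ν c < ν a) : topWeight ν a = 1 / 2 := by
  rw [topWeight, Finset.prod_eq_single b]
  · rw [if_neg hab, halfSymbol, if_neg (by omega), if_pos he]
  · intro c _ hc
    by_cases hca : c = a
    · rw [if_pos hca]
    · rw [if_neg hca, halfSymbol, if_pos (h c hca hc)]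
  · intro hb; exact absurd (Finset.mem_univ b) hb

/-! ### Smoothness of a primitive after subtraction of its top-frequency form -/

/-- The exponent `-s` in the slots `o` and `i`, and `s'` in the other ones. -/
def pairExp (o i : ι) (s s' : ℝ) (b : ι) : ℝ := if b = o ∨ b = i then -s else s'

/-- Gaining s + s₁ derivatives in each of the slots `o` and `i` costs 2(s₁ + s) powers of frequency.
The slot `l`, whose frequency is at least theirs, pays for them on top of its own s₁; this gives the
threshold for s'. -/
theorem prod_block_le {o i l : ι} (hoi : i ≠ o) (hlo : l ≠ o) (hli : l ≠ i) {s s' s₁ : ℝ}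
    (hs : 0 ≤ s) (hs₁ : 0 ≤ s₁) (hs' : s₁ + 2 * (s₁ + s) ≤ s') {ν : ι → ℕ} (hν : ∀ b, 1 ≤ ν b)
    (ho : ν o ≤ ν l) (hi : ν i ≤ ν l) (X : ι → Hinf2) :
    ∏ b, sobNorm2 s₁ (proj2 (ν b) (X b)) ≤
      ∏ b, sobNorm2 (pairExp o i s s' b) (proj2 (ν b) (X b)) := by
  have hpos : ∀ b, (1 : ℝ) ≤ ν b := fun b => by exact_mod_cast hν b
  have hl0 : (0 : ℝ) < ν l := by linarith [hpos l]
  have e : ∀ b, sobNorm2 s₁ (proj2 (ν b) (X b)) =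
      (ν b : ℝ) ^ (s₁ - pairExp o i s s' b) *
        sobNorm2 (pairExp o i s s' b) (proj2 (ν b) (X b)) := fun b => sobNorm2_proj2 (hν b) _ _ _
  simp only [e]
  rw [Finset.prod_mul_distrib]
  refine mul_le_of_le_one_left (Finset.prod_nonneg fun _ _ => sobNorm2_nonneg _ _) ?_
  -- Comparison weights in powers of ν l alone: two factors of exponent s₁ + s against one of
  -- exponent -2(s₁ + s), so the product is 1.
  let g : ι → ℝ := fun b => if b = o ∨ b = i then (ν l : ℝ) ^ (s₁ + s) else
    if b = l then (ν l : ℝ) ^ (-(2 * (s₁ + s))) else 1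
  have h1 : ∏ b, (ν b : ℝ) ^ (s₁ - pairExp o i s s' b) ≤ ∏ b, g b := by
    refine Finset.prod_le_prod (fun b _ => by positivity) fun b _ => ?_
    simp only [g, pairExp]
    by_cases hb : b = o ∨ b = i
    · rw [if_pos hb, if_pos hb, sub_neg_eq_add]
      have : (ν b : ℝ) ≤ ν l := by
        rcases hb with rfl | rfl
        · exact_mod_cast ho
        · exact_mod_cast hi
      exact Real.rpow_le_rpow (by positivity) this (by positivity)
    · rw [if_neg hb, if_neg hb]
      by_cases hbl : b = l
      · rw [if_pos hbl, hbl]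
        exact Real.rpow_le_rpow_of_exponent_le (hpos l) (by linarith)
      · rw [if_neg hbl]
        exact Real.rpow_le_one_of_one_le_of_nonpos (hpos b) (by linarith)
  refine h1.trans (le_of_eq ?_)
  rw [← Finset.mul_prod_erase _ _ (Finset.mem_univ o),
    ← Finset.mul_prod_erase _ _ (Finset.mem_erase.2 ⟨hoi, Finset.mem_univ i⟩),
    ← Finset.mul_prod_erase _ _
      (Finset.mem_erase.2 ⟨hli, Finset.mem_erase.2 ⟨hlo, Finset.mem_univ l⟩⟩),
    Finset.prod_eq_one]
  · simp only [g, true_or, or_true, if_true, hlo, hli, or_self, if_false, mul_one]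
    rw [← Real.rpow_add hl0, ← Real.rpow_add hl0]
    ring_nf
    exact Real.rpow_zero _
  · intro b hb
    simp only [Finset.mem_erase] at hb
    simp [g, hb.1, hb.2.1, hb.2.2.1]

/-- The heart of the correction. The only hypothesis of smoothing type concerns the
antisymmetrization of `A` in the slots `o` and `i`, yet the conclusion concerns `A - topForm hA o`
itself. `topForm` replaces `A` by its value with the leading argument in `o`, so the difference
vanishes, is antisymmetrized, or involves a third argument of high frequency. -/
theorem sub_topForm_block_le {A : MultilinearMap ℂ (fun _ : ι => Hinf2) ℂ} (hA : FormBdd A)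
    {o i : ι} (hoi : i ≠ o) {s : ℝ} (hs : 0 ≤ s)
    (hpair : ∃ s' C : ℝ, 0 ≤ C ∧ ∀ X, ‖A X - A (fun b => X (Equiv.swap o i b))‖ ≤
      C * ∏ b, sobNorm2 (pairExp o i s s' b) (X b)) :
    ∃ s' C : ℝ, 0 ≤ C ∧ ∀ ν : ι → ℕ, (∀ b, 1 ≤ ν b) → ∀ X : ι → Hinf2,
      ‖(A - topForm hA o) (fun b => proj2 (ν b) (X b))‖ ≤
        C * ∏ b, sobNorm2 (pairExp o i s s' b) (proj2 (ν b) (X b)) := by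
  obtain ⟨s', C, hC, hp⟩ := hpair
  obtain ⟨s₁, C₁, hs₁, hC₁, hb⟩ := hA
  -- The factor 1 + card ι counts `A` and the terms of `topForm`, whose weights are at most one.
  refine ⟨max s' (s₁ + 2 * (s₁ + s)), C + (1 + Fintype.card ι) * C₁, by positivity,
    fun ν hν X => ?_⟩
  set Y : ι → Hinf2 := fun b => proj2 (ν b) (X b) with hY
  have hblock := topForm_block ⟨s₁, C₁, hs₁, hC₁, hb⟩ o ν X
  have hP0 : 0 ≤ ∏ b, sobNorm2 (pairExp o i s (max s' (s₁ + 2 * (s₁ + s))) b) (Y b) :=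
    Finset.prod_nonneg fun _ _ => sobNorm2_nonneg _ _
  rw [sub_apply]
  -- A third slot dominating both `o` and `i` makes a crude bound sufficient. Otherwise every other
  -- slot lies strictly below the larger of ν o and ν i.
  by_cases hl : ∃ l, l ≠ o ∧ l ≠ i ∧ ν o ≤ ν l ∧ ν i ≤ ν l
  · obtain ⟨l, hlo, hli, hol, hil⟩ := hl
    have h1 := prod_block_le hoi hlo hli hs hs₁ (le_max_right s' _) hν hol hil X
    have h2 : ∀ a, ‖A (fun b => Y (Equiv.swap o a b))‖ ≤ C₁ * ∏ b, sobNorm2 s₁ (Y b) := by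
      intro a
      refine (hb _).trans (le_of_eq ?_)
      rw [Equiv.prod_comp (Equiv.swap o a) fun b => sobNorm2 s₁ (Y b)]
    have h3 : ‖A Y - topForm ⟨s₁, C₁, hs₁, hC₁, hb⟩ o Y‖
        ≤ (1 + Fintype.card ι) * C₁ * ∏ b, sobNorm2 s₁ (Y b) := by
      refine (norm_sub_le _ _).trans ?_
      have h4 : ‖topForm ⟨s₁, C₁, hs₁, hC₁, hb⟩ o Y‖ ≤
          ∑ _a : ι, C₁ * ∏ b, sobNorm2 s₁ (Y b) := by
        rw [hblock]
        refine (norm_sum_le _ _).trans (Finset.sum_le_sum fun a _ => ?_)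
        rw [norm_mul, Complex.norm_real, Real.norm_eq_abs, abs_of_nonneg (topWeight_nonneg _ _)]
        exact (mul_le_of_le_one_left (norm_nonneg _) (topWeight_le_one _ _)).trans (h2 a)
      rw [Finset.sum_const, Finset.card_univ, nsmul_eq_mul] at h4
      have h5 := hb Y
      linarith
    refine h3.trans ?_
    refine (mul_le_mul_of_nonneg_left h1 (by positivity)).trans ?_
    refine mul_le_mul_of_nonneg_right ?_ hP0
    linarith
  · push Not at hl
    have hl' : ∀ l, l ≠ o → l ≠ i → ν l < max (ν o) (ν i) := by
      intro l h1 h2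
      by_cases h3 : ν o ≤ ν l
      · exact lt_max_of_lt_right (hl l h1 h2 h3)
      · exact lt_max_of_lt_left (not_le.1 h3)
    have hgood : ‖A Y - A (fun b => Y (Equiv.swap o i b))‖ ≤
        (C + (1 + Fintype.card ι) * C₁) *
          ∏ b, sobNorm2 (pairExp o i s (max s' (s₁ + 2 * (s₁ + s))) b) (Y b) := by
      refine (hp Y).trans (mul_le_mul ?_ ?_ (Finset.prod_nonneg fun _ _ => sobNorm2_nonneg _ _)
        (by positivity))
      · have : 0 ≤ (1 + (Fintype.card ι : ℝ)) * C₁ := by positivity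
        linarith
      · refine Finset.prod_le_prod (fun _ _ => sobNorm2_nonneg _ _) fun b _ =>
          sobNorm2_mono ?_ _
        unfold pairExp
        split_ifs
        · exact le_rfl
        · exact le_max_left _ _
    have hY' : topForm ⟨s₁, C₁, hs₁, hC₁, hb⟩ o Y = ∑ a, (topWeight ν a : ℂ) *
        A (fun b => Y (Equiv.swap o a b)) := hblock
    rcases lt_trichotomy (ν i) (ν o) with h | h | h
    -- The leading argument is already in `o`: `topForm` agrees with `A`.
    · have h1 : ∀ l, l ≠ o → ν l < ν o := by
        intro l hlo
        by_cases hli : l = i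
        · rw [hli]; exact h
        · have := hl' l hlo hli; rwa [max_eq_left h.le] at this
      rw [hY', Finset.sum_eq_single o]
      · rw [topWeight_eq_one h1]
        simp only [Equiv.swap_self, Equiv.refl_apply, Complex.ofReal_one, one_mul, sub_self, norm_zero]
        exact mul_nonneg (by positivity) hP0
      · intro a _ ha
        rw [topWeight_eq_zero (h1 a ha), Complex.ofReal_zero, zero_mul]
      · intro ho; exact absurd (Finset.mem_univ o) ho
    -- A tie: `topForm` is the mean of `A` and its transposition, so half of the antisymmetrization
    -- remains.
    · have h1 : ∀ l, l ≠ o → l ≠ i → ν l < ν o := by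
        intro l hlo hli
        have := hl' l hlo hli; rwa [h, max_self] at this
      rw [hY', ← Finset.add_sum_erase _ _ (Finset.mem_univ o), ← Finset.add_sum_erase _ _
        (Finset.mem_erase.2 ⟨hoi, Finset.mem_univ i⟩), Finset.sum_eq_zero]
      · rw [topWeight_eq_half hoi h fun c hc hc' => h1 c hc hc',
          topWeight_eq_half hoi.symm h.symm fun c hc hc' => by rw [h]; exact h1 c hc' hc]
        simp only [Equiv.swap_self, Equiv.refl_apply, add_zero]
        have h2 : A Y - (((1 / 2 : ℝ) : ℂ) * A (fun b => Y b) +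
            ((1 / 2 : ℝ) : ℂ) * A (fun b => Y (Equiv.swap o i b))) =
            ((1 / 2 : ℝ) : ℂ) * (A Y - A (fun b => Y (Equiv.swap o i b))) := by
          push_cast
          ring
        rw [h2, norm_mul, Complex.norm_real]
        refine (mul_le_of_le_one_left (norm_nonneg _) (by norm_num)).trans hgood
      · intro a ha
        simp only [Finset.mem_erase] at ha
        rw [topWeight_eq_zero (h1 a ha.2.1 ha.1), Complex.ofReal_zero, zero_mul]
    -- The leading argument is in `i`: `topForm` is the transposition of `A`, and the full
    -- antisymmetrization remains.
    · have h1 : ∀ l, l ≠ i → ν l < ν i := by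
        intro l hli
        by_cases hlo : l = o
        · rw [hlo]; exact h
        · have := hl' l hlo hli; rwa [max_eq_right h.le] at this
      rw [hY', Finset.sum_eq_single i]
      · rw [topWeight_eq_one h1, Complex.ofReal_one, one_mul]
        exact hgood
      · intro a _ ha
        rw [topWeight_eq_zero (h1 a ha), Complex.ofReal_zero, zero_mul]
      · intro ho; exact absurd (Finset.mem_univ i) ho

theorem formBdd_topForm {A : MultilinearMap ℂ (fun _ : ι => Hinf2) ℂ} (hA : FormBdd A) (o : ι) :
    FormBdd (topForm hA o) := by
  obtain ⟨s, C, hs, hC, hb⟩ := id hA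
  refine ⟨s + 2, ∑ _a : ι, C * ∑' n : ℕ, (n : ℝ) ^ (-2 : ℝ), by linarith,
    Finset.sum_nonneg fun _ _ => mul_nonneg hC (tsum_nonneg fun n => by positivity), fun X => ?_⟩
  rw [topForm_apply, Finset.sum_mul]
  refine (norm_sum_le _ _).trans (Finset.sum_le_sum fun a _ => ?_)
  have hP : 0 ≤ ∏ b, sobNorm2 (s + 2) (X b) := Finset.prod_nonneg fun _ _ => sobNorm2_nonneg _ _
  have hsum : Summable fun n : ℕ => C * (∏ b, sobNorm2 (s + 2) (X b)) * (n : ℝ) ^ (-2 : ℝ) :=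
    (Real.summable_nat_rpow.2 (by norm_num)).mul_left _
  rw [mul_right_comm, ← tsum_mul_left]
  refine tsum_of_norm_bounded hsum.hasSum fun n => ?_
  exact norm_topTerm_le hb hC o n a X

/-! ### Primitives represented by regularizing vector fields -/

theorem sobNorm2_neg (s : ℝ) (V : Hinf2) : sobNorm2 s (-V) = sobNorm2 s V := by
  rw [← neg_one_smul ℂ V, sobNorm2_smul, norm_neg, norm_one, one_mul]

theorem IsRealPair.neg {V : Hinf2} (hV : IsRealPair V) : IsRealPair (-V) := by
  have e : -V = ((-1 : ℝ) : ℂ) • V := by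
    rw [Complex.ofReal_neg, Complex.ofReal_one]; exact (neg_one_smul ℂ V).symm
  rw [e]
  exact hV.smul (-1)

theorem snoc_snoc_swap {α : Type*} {m : ℕ} (Y : Fin m → α) (V W : α) :
    (fun i => (Fin.snoc (Fin.snoc Y W : Fin (m + 1) → α) V : Fin (m + 2) → α)
      (Equiv.swap (Fin.last (m + 1)) (Fin.last m).castSucc i)) =
      Fin.snoc (Fin.snoc Y V : Fin (m + 1) → α) W := by
  funext i
  induction i using Fin.lastCases with
  | last => simp
  | cast i =>
    induction i using Fin.lastCases with
    | last => simp
    | cast i =>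
      rw [Equiv.swap_apply_of_ne_of_ne (Fin.castSucc_ne_last _)
        (fun h => Fin.castSucc_ne_last i (Fin.castSucc_injective _ h))]
      simp

theorem init_comp_swap {α : Type*} {m : ℕ} (X : Fin (m + 2) → α) (j : Fin (m + 1)) :
    ∃ Y : Fin m → α, (fun i => Fin.init X (Equiv.swap j (Fin.last m) i)) = Fin.snoc Y (X j.castSucc) ∧
      (fun i => Fin.init (fun b => X (Equiv.swap (Fin.last (m + 1)) j.castSucc b))
        (Equiv.swap j (Fin.last m) i)) = Fin.snoc Y (X (Fin.last (m + 1))) := by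
  refine ⟨fun i => X (Equiv.swap j (Fin.last m) i.castSucc).castSucc, ?_, ?_⟩
  · funext i
    induction i using Fin.lastCases with
    | last => simp [Fin.init]
    | cast i => simp [Fin.init]
  · funext i
    induction i using Fin.lastCases with
    | last => simp [Fin.init]
    | cast i =>
      rw [Fin.snoc_castSucc]
      simp only [Fin.init]
      rw [Equiv.swap_apply_of_ne_of_ne (Fin.castSucc_ne_last _)]
      intro h
      have h1 := Fin.castSucc_injective _ h
      rw [Equiv.swap_apply_eq_iff, Equiv.swap_apply_left] at h1
      exact Fin.castSucc_ne_last i h1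

theorem prod_snoc_pair {m : ℕ} (X : Fin (m + 2) → Hinf2) (j : Fin (m + 1)) (s s' : ℝ)
    {Y : Fin m → Hinf2}
    (hY : (fun i => Fin.init X (Equiv.swap j (Fin.last m) i)) = Fin.snoc Y (X j.castSucc)) :
    ∏ b, sobNorm2 (pairExp (Fin.last (m + 1)) j.castSucc s s' b) (X b) =
      (∏ i, sobNorm2 s' (Y i)) * sobNorm2 (-s) (X j.castSucc) *
        sobNorm2 (-s) (X (Fin.last (m + 1))) := by
  rw [Fin.prod_univ_castSucc]
  congr 1
  · rw [← Equiv.prod_comp (Equiv.swap j (Fin.last m)), Fin.prod_univ_castSucc]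
    congr 1
    · refine Finset.prod_congr rfl fun i _ => ?_
      have h1 := congrFun hY i.castSucc
      rw [Fin.snoc_castSucc] at h1
      rw [← h1, pairExp, if_neg]
      · rfl
      · rintro (h | h)
        · exact Fin.castSucc_ne_last _ h
        · have h1 := Fin.castSucc_injective _ h
          rw [Equiv.swap_apply_eq_iff, Equiv.swap_apply_left] at h1
          exact Fin.castSucc_ne_last i h1
    · rw [Equiv.swap_apply_right, pairExp, if_pos (Or.inr rfl)]
  · rw [pairExp, if_pos (Or.inl rfl)]

/-- The extension of a permutation of `Fin n` to `Fin (n + 1)` which fixes the last element. -/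
def extendPerm {n : ℕ} (π : Equiv.Perm (Fin n)) : Equiv.Perm (Fin (n + 1)) where
  toFun := Fin.lastCases (Fin.last n) fun i => (π i).castSucc
  invFun := Fin.lastCases (Fin.last n) fun i => (π.symm i).castSucc
  left_inv i := by induction i using Fin.lastCases <;> simp
  right_inv i := by induction i using Fin.lastCases <;> simp

theorem pairExp_add_two {ι : Type*} [DecidableEq ι] (o i : ι) (s s' : ℝ) (b : ι) :
    pairExp o i (s + 2) s' b + 2 = pairExp o i s (s' + 2) b := by
  unfold pairExp; split_ifs <;> ring

/-- `H` is a one-form of which only the antisymmetrization is smoothing. Subtracting a form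
symmetric in all slots leaves that antisymmetrization unchanged, and the choice `topForm` makes the
remainder `η` regularizing in every input slot together with the test slot. -/
theorem exists_correction {m : ℕ}
    (H : MultilinearMap ℂ (fun _ : Fin (m + 1) => Hinf2) (Hinf2 →ₗ[ℂ] ℂ)) (hsymm : IsSymm H)
    (hbdd : ∃ s C : ℝ, 0 ≤ s ∧ 0 ≤ C ∧
      ∀ X V, ‖H X V‖ ≤ C * (∏ i, sobNorm2 s (X i)) * sobNorm2 s V)
    (htrans : ∀ (ς : ℝ) X V, H (fun i => trans2 ς (X i)) (trans2 ς V) = H X V)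
    (hreal : ∀ X V, (∀ i, IsRealPair (X i)) → IsRealPair V → (H X V).im = 0)
    (hpair : ∀ s : ℝ, ∃ s' C : ℝ, 0 ≤ C ∧ ∀ (Y : Fin m → Hinf2) (V W : Hinf2),
      ‖H (Fin.snoc Y W) V - H (Fin.snoc Y V) W‖ ≤
        C * ((∏ i, sobNorm2 s' (Y i)) * sobNorm2 (-s) W * sobNorm2 (-s) V)) :
    ∃ G : VF (m + 1), IsSymm G ∧ IsNice G ∧ IsRegularizing G ∧ ∀ (Y : Fin m → Hinf2) (V W : Hinf2),
      omegaL (G (Fin.snoc Y V)) W + omegaL V (G (Fin.snoc Y W)) =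
        H (Fin.snoc Y W) V - H (Fin.snoc Y V) W := by
  let A : MultilinearMap ℂ (fun _ : Fin (m + 1 + 1) => Hinf2) ℂ := H.uncurryRight
  have hAapp : ∀ X, A X = H (Fin.init X) (X (Fin.last (m + 1))) := fun X => rfl
  have hA : FormBdd A := by
    obtain ⟨s, C, hs, hC, hb⟩ := hbdd
    refine ⟨s, C, hs, hC, fun X => ?_⟩
    rw [hAapp, Fin.prod_univ_castSucc, ← mul_assoc]
    exact hb _ _
  have hAsym : ∀ π : Equiv.Perm (Fin (m + 2)), π (Fin.last (m + 1)) = Fin.last (m + 1) →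
      ∀ X, A (fun i => X (π i)) = A X := by
    intro π hπ X
    rw [hAapp, hAapp, hπ]
    have hne : ∀ i : Fin (m + 1), π i.castSucc ≠ Fin.last (m + 1) := fun i h =>
      Fin.castSucc_ne_last i (π.injective (h.trans hπ.symm))
    let ρ : Fin (m + 1) → Fin (m + 1) := fun i => (π i.castSucc).castPred (hne i)
    have hρ : Function.Injective ρ := by
      intro i j hij
      have h1 : π i.castSucc = π j.castSucc := Fin.castPred_inj.1 hij
      exact Fin.castSucc_injective _ (π.injective h1)
    have h2 := hsymm (Equiv.ofBijective ρ (Finite.injective_iff_bijective.1 hρ)) (Fin.init X)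
    rw [← h2]
    congr 2
  let g := topForm hA (Fin.last (m + 1))
  have hgsym := topForm_symm hA hAsym
  let η := (A - g).curryRight
  have hηapp : ∀ X V, η X V = H X V - g (Fin.snoc X V) := by
    intro X V
    change A (Fin.snoc X V) - g (Fin.snoc X V) = _
    rw [hAapp, Fin.init_snoc, Fin.snoc_last]
  have hηsymm : IsSymm η := by
    intro π X
    refine LinearMap.ext fun V => ?_
    rw [hηapp, hηapp, hsymm π X]
    congr 1
    have h1 := hgsym (extendPerm π) (Fin.snoc X V)
    rw [← h1]
    congr 1
    funext i
    induction i using Fin.lastCases with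
    | last => simp [extendPerm]
    | cast i => simp [extendPerm]
  have hreg : ∀ (i : Fin (m + 1)) (s : ℝ), ∃ s' C : ℝ, 0 ≤ C ∧ ∀ X V, ‖η X V‖ ≤
      C * sobNorm2 (-s) (X i) * (∏ l ∈ Finset.univ.erase i, sobNorm2 s' (X l)) *
        sobNorm2 (-s) V := by
    intro j s
    -- The block estimate needs a non-negative order. It is invoked at s₀ + 2 because the extension
    -- from blocks loses two derivatives in each slot.
    set s₀ := max s 0 with hs₀
    have h1 : ∃ s' C : ℝ, 0 ≤ C ∧ ∀ X, ‖A X - A (fun b => X (Equiv.swap (Fin.last (m + 1))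
        j.castSucc b))‖ ≤
        C * ∏ b, sobNorm2 (pairExp (Fin.last (m + 1)) j.castSucc (s₀ + 2) s' b) (X b) := by
      obtain ⟨s', C, hC, hb⟩ := hpair (s₀ + 2)
      refine ⟨s', C, hC, fun X => ?_⟩
      obtain ⟨Y, hY1, hY2⟩ := init_comp_swap X j
      rw [prod_snoc_pair X j _ _ hY1, hAapp, hAapp,
        ← hsymm (Equiv.swap j (Fin.last m)) (Fin.init X), hY1,
        ← hsymm (Equiv.swap j (Fin.last m)) (Fin.init fun b => X (Equiv.swap (Fin.last (m + 1))
          j.castSucc b) : Fin (m + 1) → Hinf2), hY2, Equiv.swap_apply_left]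
      exact hb Y _ _
    obtain ⟨s', C, hC, hb⟩ := sub_topForm_block_le hA (Fin.castSucc_ne_last j)
      (by positivity) h1
    have hAg : FormBdd (A - g) := by
      obtain ⟨a, B, ha, hB, hb1⟩ := id hA
      obtain ⟨a', B', ha', hB', hb2⟩ := formBdd_topForm hA (Fin.last (m + 1))
      refine ⟨max a a', B + B', le_max_of_le_left ha, by positivity, fun X => ?_⟩
      rw [sub_apply, add_mul]
      refine (norm_sub_le _ _).trans (add_le_add ((hb1 X).trans ?_) ((hb2 X).trans ?_))
      · exact mul_le_mul_of_nonneg_left (Finset.prod_le_prod (fun _ _ => sobNorm2_nonneg _ _)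
          fun _ _ => sobNorm2_mono (le_max_left _ _) _) hB
      · exact mul_le_mul_of_nonneg_left (Finset.prod_le_prod (fun _ _ => sobNorm2_nonneg _ _)
          fun _ _ => sobNorm2_mono (le_max_right _ _) _) hB'
    have h2 := form_le_of_block_bound hAg hC _ hb
    refine ⟨s' + 2, C * zetaConst ^ Fintype.card (Fin (m + 1 + 1)),
      mul_nonneg hC (pow_nonneg zetaConst_nonneg _), fun X V => ?_⟩
    have h3 := h2 (Fin.snoc X V)
    simp only [pairExp_add_two] at h3
    refine (show ‖η X V‖ ≤ _ from h3).trans ?_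
    rw [mul_assoc (C * zetaConst ^ _) (sobNorm2 (-s) (X j)), mul_assoc (C * zetaConst ^ _)]
    refine mul_le_mul_of_nonneg_left ?_ (mul_nonneg hC (pow_nonneg zetaConst_nonneg _))
    rw [Fin.prod_univ_castSucc, Fin.snoc_last, ← Finset.mul_prod_erase _ _ (Finset.mem_univ j)]
    simp only [Fin.snoc_castSucc]
    have hs : -s₀ ≤ -s := neg_le_neg (le_max_left _ _)
    refine mul_le_mul (mul_le_mul ?_ (le_of_eq ?_) ?_ (sobNorm2_nonneg _ _)) ?_
      (sobNorm2_nonneg _ _) (mul_nonneg (sobNorm2_nonneg _ _)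
        (Finset.prod_nonneg fun _ _ => sobNorm2_nonneg _ _))
    · rw [pairExp, if_pos (Or.inr rfl)]
      exact sobNorm2_mono hs _
    · refine Finset.prod_congr rfl fun l hl => ?_
      rw [pairExp, if_neg]
      rintro (h | h)
      · exact Fin.castSucc_ne_last _ h
      · exact Finset.ne_of_mem_erase hl (Fin.castSucc_injective _ h)
    · exact Finset.prod_nonneg fun _ _ => sobNorm2_nonneg _ _
    · rw [pairExp, if_pos (Or.inl rfl)]
      exact sobNorm2_mono hs _
  have htr : ∀ (ς : ℝ) X, A (fun i => trans2 ς (X i)) = A X := fun ς X => htrans ς _ _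
  have hre : ∀ X, (∀ i, IsRealPair (X i)) → (A X).im = 0 := fun X hX => hreal _ _
    (fun i => hX _) (hX _)
  have hsnoc : ∀ (P : Hinf2 → Prop) (X : Fin (m + 1) → Hinf2) (V : Hinf2), (∀ i, P (X i)) → P V →
      ∀ i, P ((Fin.snoc X V : Fin (m + 2) → Hinf2) i) := by
    intro P X V hX hV i
    induction i using Fin.lastCases with
    | last => simpa using hV
    | cast i => simpa using hX i
  obtain ⟨F, hF, hFn, hFr⟩ := exists_nice_riesz η hreg
    (fun ς X V => by
      rw [hηapp, hηapp, htrans]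
      congr 1
      rw [← topForm_trans hA htr ς (Fin.snoc X V)]
      congr 1
      funext i
      induction i using Fin.lastCases with
      | last => simp
      | cast i => simp)
    (fun X V hX hV => by
      rw [hηapp, Complex.sub_im, hreal X V hX hV, topForm_real hA hre _ (hsnoc _ X V hX hV),
        sub_zero])
  have hFs : IsSymm F := fun π X => eq_of_bilin fun V => by rw [hF, hF, hηsymm π X]
  -- E_c is an involution, so Ω_c(-E_c F, V) = -⟨F, V⟩_r.
  let G : VF (m + 1) := (-ecL).compMultilinearMap F
  have hG : ∀ X, G X = -ecL (F X) := fun X => rfl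
  have hGO : ∀ X V, omegaL (G X) V = -η X V := by
    intro X V
    rw [hG, map_neg, LinearMap.neg_apply, omegaL_eq, ecL_ecL, hF]
  refine ⟨G, fun π X => by rw [hG, hG, hFs π X], ⟨fun s => ?_, fun ς X => ?_, fun X hX => ?_⟩,
    fun i s t => ?_, fun Y V W => ?_⟩
  · obtain ⟨s', C, hC, hb⟩ := hFn.bdd s
    exact ⟨s', C, hC, fun X => by rw [hG, sobNorm2_neg, sobNorm2_ecL]; exact hb X⟩
  · rw [hG, hG, hFn.trans, ecL_trans2, ← transL_apply, ← transL_apply, map_neg]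
  · rw [hG]
    exact (hFn.real X hX).ecL.neg
  · obtain ⟨s', C, hC, hb⟩ := hFr i s t
    exact ⟨s', C, hC, fun X => by rw [hG, sobNorm2_neg, sobNorm2_ecL]; exact hb X⟩
  -- The two contributions of `g` cancel because it is invariant under exchange of the last two
  -- slots.
  · rw [omegaL_antisymm V, hGO, hGO, hηapp, hηapp, ← snoc_snoc_swap Y V W,
      hgsym (Equiv.swap (Fin.last (m + 1)) (Fin.last m).castSucc)]
    ring

/-! ### Polynomial growth -/

/-- Polynomial growth of a nonlinear map in all Sobolev norms. -/
def Growing (f : Hinf2 → Hinf2) : Prop :=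
  ∀ s : ℝ, ∃ (s' C : ℝ) (n : ℕ), 0 ≤ C ∧ ∀ U, sobNorm2 s (f U) ≤ C * (1 + sobNorm2 s' U) ^ n

/-- `T(U)` maps every `Ḣᵗ` into some `Ḣˢ`, with polynomial dependence on `U`. -/
def Tame (T : Hinf2 → Hinf2 → Hinf2) : Prop :=
  ∀ t : ℝ, ∃ (s s' C : ℝ) (n : ℕ), 0 ≤ C ∧
    ∀ U V, sobNorm2 s (T U V) ≤ C * (1 + sobNorm2 s' U) ^ n * sobNorm2 t V

/-- `T(U)` maps every `Ḣᵗ` into every `Ḣˢ`, with polynomial dependence on `U`. -/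
def Smoothing (T : Hinf2 → Hinf2 → Hinf2) : Prop :=
  ∀ t s : ℝ, ∃ (s' C : ℝ) (n : ℕ), 0 ≤ C ∧
    ∀ U V, sobNorm2 s (T U V) ≤ C * (1 + sobNorm2 s' U) ^ n * sobNorm2 t V

/-- A `U`-dependent bilinear form bounded on all negative Sobolev spaces. -/
def PairSmoothing (ρ : Hinf2 → Hinf2 → Hinf2 → ℂ) : Prop :=
  ∀ s : ℝ, ∃ (s' C : ℝ) (n : ℕ), 0 ≤ C ∧
    ∀ U V W, ‖ρ U V W‖ ≤ C * (1 + sobNorm2 s' U) ^ n * sobNorm2 (-s) V * sobNorm2 (-s) W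

theorem growth_mono {s' s'' : ℝ} {n m : ℕ} (hs : s' ≤ s'') (hn : n ≤ m) (U : Hinf2) :
    (1 + sobNorm2 s' U) ^ n ≤ (1 + sobNorm2 s'' U) ^ m := by
  have h0 := sobNorm2_nonneg s' U
  have h1 := sobNorm2_mono hs U
  calc (1 + sobNorm2 s' U) ^ n ≤ (1 + sobNorm2 s'' U) ^ n := by gcongr
    _ ≤ (1 + sobNorm2 s'' U) ^ m := pow_le_pow_right₀ (by linarith) hn

theorem growth_nonneg (s : ℝ) (n : ℕ) (U : Hinf2) : 0 ≤ (1 + sobNorm2 s U) ^ n := by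
  have := sobNorm2_nonneg s U
  positivity

theorem growth_add {a b c d C C' s s' : ℝ} {n n' : ℕ} {U : Hinf2} (hC : 0 ≤ C) (hC' : 0 ≤ C')
    (hd : 0 ≤ d) (h : a ≤ C * (1 + sobNorm2 s U) ^ n * d)
    (h' : b ≤ C' * (1 + sobNorm2 s' U) ^ n' * d) (hc : c ≤ a + b) :
    c ≤ (C + C') * (1 + sobNorm2 (max s s') U) ^ (max n n') * d := by
  have h1 := mul_le_mul_of_nonneg_left (growth_mono (le_max_left s s') (le_max_left n n') U) hC
  have h2 := mul_le_mul_of_nonneg_left (growth_mono (le_max_right s s') (le_max_right n n') U) hC'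
  have h3 := mul_le_mul_of_nonneg_right h1 hd
  have h4 := mul_le_mul_of_nonneg_right h2 hd
  rw [add_mul, add_mul]
  linarith

theorem Growing.add {f g : Hinf2 → Hinf2} (hf : Growing f) (hg : Growing g) :
    Growing (fun U => f U + g U) := by
  intro s
  obtain ⟨a, C, n, hC, h1⟩ := hf s
  obtain ⟨b, C', n', hC', h2⟩ := hg s
  refine ⟨max a b, C + C', max n n', by positivity, fun U => ?_⟩
  have := growth_add hC hC' zero_le_one (by simpa using h1 U) (by simpa using h2 U)
    (sobNorm2_add_le s (f U) (g U))
  simpa using this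

theorem Growing.sum {ι : Type*} (T : Finset ι) {f : ι → Hinf2 → Hinf2}
    (h : ∀ i ∈ T, Growing (f i)) : Growing (fun U => ∑ i ∈ T, f i U) := by
  classical
  induction T using Finset.induction_on with
  | empty => exact fun s => ⟨0, 0, 0, le_rfl, fun U => by simp [sobNorm2_zero]⟩
  | insert a T ha ih =>
    simp only [Finset.sum_insert ha]
    exact (h a (Finset.mem_insert_self _ _)).add (ih fun i hi => h i (Finset.mem_insert_of_mem hi))

theorem Tame.add {f g : Hinf2 → Hinf2 → Hinf2} (hf : Tame f) (hg : Tame g) :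
    Tame (fun U V => f U V + g U V) := by
  intro t
  obtain ⟨s₁, a, C, n, hC, h1⟩ := hf t
  obtain ⟨s₂, b, C', n', hC', h2⟩ := hg t
  refine ⟨min s₁ s₂, max a b, C + C', max n n', by positivity, fun U V => ?_⟩
  refine growth_add hC hC' (sobNorm2_nonneg _ _)
    ((sobNorm2_mono (min_le_left _ _) _).trans (h1 U V))
    ((sobNorm2_mono (min_le_right _ _) _).trans (h2 U V)) (sobNorm2_add_le _ _ _)

theorem Tame.sum {ι : Type*} (T : Finset ι) {f : ι → Hinf2 → Hinf2 → Hinf2}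
    (h : ∀ i ∈ T, Tame (f i)) : Tame (fun U V => ∑ i ∈ T, f i U V) := by
  classical
  induction T using Finset.induction_on with
  | empty => exact fun t => ⟨0, 0, 0, 0, le_rfl, fun U V => by simp [sobNorm2_zero]⟩
  | insert a T ha ih =>
    simp only [Finset.sum_insert ha]
    exact (h a (Finset.mem_insert_self _ _)).add (ih fun i hi => h i (Finset.mem_insert_of_mem hi))

theorem Tame.snd : Tame (fun _ V => V) := fun t =>
  ⟨t, 0, 1, 0, zero_le_one, fun U V => by simp⟩

theorem Smoothing.add {f g : Hinf2 → Hinf2 → Hinf2} (hf : Smoothing f) (hg : Smoothing g) :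
    Smoothing (fun U V => f U V + g U V) := by
  intro t s
  obtain ⟨a, C, n, hC, h1⟩ := hf t s
  obtain ⟨b, C', n', hC', h2⟩ := hg t s
  refine ⟨max a b, C + C', max n n', by positivity, fun U V => ?_⟩
  exact growth_add hC hC' (sobNorm2_nonneg _ _) (h1 U V) (h2 U V) (sobNorm2_add_le _ _ _)

theorem Smoothing.zero : Smoothing (fun _ _ => 0) := fun t s =>
  ⟨0, 0, 0, le_rfl, fun U V => by simp [sobNorm2_zero]⟩

theorem Smoothing.sum {ι : Type*} (T : Finset ι) {f : ι → Hinf2 → Hinf2 → Hinf2}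
    (h : ∀ i ∈ T, Smoothing (f i)) : Smoothing (fun U V => ∑ i ∈ T, f i U V) := by
  classical
  induction T using Finset.induction_on with
  | empty => exact Smoothing.zero
  | insert a T ha ih =>
    simp only [Finset.sum_insert ha]
    exact (h a (Finset.mem_insert_self _ _)).add (ih fun i hi => h i (Finset.mem_insert_of_mem hi))

theorem Smoothing.tame {f : Hinf2 → Hinf2 → Hinf2} (hf : Smoothing f) : Tame f :=
  fun t => ⟨0, hf t 0⟩

/-- The tame factor lands in some `Ḣ^{s₁}`, possibly of very negative order; the smoothing factor
can start from there and reach any order. -/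
theorem Smoothing.comp {f g : Hinf2 → Hinf2 → Hinf2} {φ : Hinf2 → Hinf2} (hf : Smoothing f)
    (hφ : Growing φ) (hg : Tame g) : Smoothing (fun U V => f (φ U) (g U V)) := by
  intro t s
  obtain ⟨s₁, a, C, n, hC, h1⟩ := hg t
  obtain ⟨b, C', n', hC', h2⟩ := hf s₁ s
  obtain ⟨c, K, m, hK, h3⟩ := hφ b
  refine ⟨max a c, C' * (1 + K) ^ n' * C, m * n' + n, by positivity, fun U V => ?_⟩
  have hb0 := sobNorm2_nonneg b (φ U)
  have hg1 : 1 ≤ (1 + sobNorm2 (max a c) U) ^ m := by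
    have := sobNorm2_nonneg (max a c) U
    exact one_le_pow₀ (by linarith)
  have h4 : 1 + sobNorm2 b (φ U) ≤ (1 + K) * (1 + sobNorm2 (max a c) U) ^ m := by
    have := (h3 U).trans (mul_le_mul_of_nonneg_left
      (growth_mono (le_max_right a c) (le_refl m) U) hK)
    nlinarith
  have h5 : (1 + sobNorm2 b (φ U)) ^ n' ≤ (1 + K) ^ n' * (1 + sobNorm2 (max a c) U) ^ (m * n') := by
    rw [pow_mul, ← mul_pow]
    gcongr
  have h6 : sobNorm2 s₁ (g U V) ≤ C * (1 + sobNorm2 (max a c) U) ^ n * sobNorm2 t V :=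
    (h1 U V).trans (mul_le_mul_of_nonneg_right (mul_le_mul_of_nonneg_left
      (growth_mono (le_max_left a c) (le_refl n) U) hC) (sobNorm2_nonneg _ _))
  refine (h2 _ _).trans ((mul_le_mul (mul_le_mul_of_nonneg_left h5 hC') h6 (sobNorm2_nonneg _ _)
    (mul_nonneg hC' (mul_nonneg (by positivity) (growth_nonneg _ _ _)))).trans (le_of_eq ?_))
  rw [pow_add]; ring

theorem PairSmoothing.add {f g : Hinf2 → Hinf2 → Hinf2 → ℂ} (hf : PairSmoothing f)
    (hg : PairSmoothing g) : PairSmoothing (fun U V W => f U V W + g U V W) := by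
  intro s
  obtain ⟨a, C, n, hC, h1⟩ := hf s
  obtain ⟨b, C', n', hC', h2⟩ := hg s
  refine ⟨max a b, C + C', max n n', by positivity, fun U V W => ?_⟩
  have h1' := h1 U V W
  have h2' := h2 U V W
  rw [mul_assoc] at h1' h2' ⊢
  exact growth_add hC hC' (mul_nonneg (sobNorm2_nonneg _ _) (sobNorm2_nonneg _ _)) h1' h2'
    (norm_add_le _ _)

theorem PairSmoothing.neg_swap {f : Hinf2 → Hinf2 → Hinf2 → ℂ} (hf : PairSmoothing f) :
    PairSmoothing (fun U V W => -f U W V) := by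
  intro s
  obtain ⟨a, C, n, hC, h1⟩ := hf s
  refine ⟨a, C, n, hC, fun U V W => ?_⟩
  rw [norm_neg]
  exact (h1 U W V).trans (le_of_eq (by ring))

/-- Once the tame factor has landed in `Ḣ^{s₁}`, the smoothing one is asked to reach the dual space
`Ḣ^{-s₁}`. -/
theorem Smoothing.pair {f g : Hinf2 → Hinf2 → Hinf2} (hf : Smoothing f) (hg : Tame g) :
    PairSmoothing (fun U V W => omegaL (f U V) (g U W)) := by
  intro s
  obtain ⟨s₁, a, C, n, hC, h1⟩ := hg (-s)
  obtain ⟨b, C', n', hC', h2⟩ := hf (-s) (-s₁)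
  refine ⟨max a b, C' * C, n' + n, by positivity, fun U V W => ?_⟩
  refine (norm_omegaL_le (-s₁) _ _).trans ?_
  rw [neg_neg]
  have h3 := (h2 U V).trans (mul_le_mul_of_nonneg_right (mul_le_mul_of_nonneg_left
    (growth_mono (le_max_right a b) (le_refl n') U) hC') (sobNorm2_nonneg _ _))
  have h4 := (h1 U W).trans (mul_le_mul_of_nonneg_right (mul_le_mul_of_nonneg_left
    (growth_mono (le_max_left a b) (le_refl n) U) hC) (sobNorm2_nonneg _ _))
  refine (mul_le_mul h3 h4 (sobNorm2_nonneg _ _) (mul_nonneg (mul_nonneg hC'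
    (growth_nonneg _ _ _)) (sobNorm2_nonneg _ _))).trans (le_of_eq ?_)
  rw [pow_add]; ring

/-! ### Growth of multilinear maps -/

theorem prod_erase_const_le {n : ℕ} (i : Fin n) (s : ℝ) (U V : Hinf2) :
    ∏ l ∈ Finset.univ.erase i, sobNorm2 s (Function.update (fun _ => U) i V l)
      ≤ (1 + sobNorm2 s U) ^ n := by
  have h0 := sobNorm2_nonneg s U
  have h1 : ∏ l ∈ Finset.univ.erase i, sobNorm2 s (Function.update (fun _ => U) i V l)
      = sobNorm2 s U ^ (Finset.univ.erase i).card := by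
    rw [← Finset.prod_const]
    refine Finset.prod_congr rfl fun l hl => ?_
    rw [Function.update_of_ne (Finset.ne_of_mem_erase hl)]
  rw [h1]
  have h2 : (Finset.univ.erase i).card ≤ n := by
    refine (Finset.card_le_univ _).trans ?_
    simp
  calc sobNorm2 s U ^ (Finset.univ.erase i).card
      ≤ (1 + sobNorm2 s U) ^ (Finset.univ.erase i).card := by
        gcongr; linarith
    _ ≤ _ := pow_le_pow_right₀ (by linarith) h2

theorem smoothing_of_slot {n : ℕ} {F : VF n} {i : Fin n}
    (h : ∀ s t : ℝ, ∃ s' C : ℝ, 0 ≤ C ∧ ∀ X, sobNorm2 s (F X) ≤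
      C * sobNorm2 t (X i) * ∏ l ∈ Finset.univ.erase i, sobNorm2 s' (X l)) :
    Smoothing (fun U V => F (Function.update (fun _ => U) i V)) := by
  intro t s
  obtain ⟨s', C, hC, hb⟩ := h s t
  refine ⟨s', C, n, hC, fun U V => (hb _).trans ?_⟩
  rw [Function.update_self, mul_right_comm]
  exact mul_le_mul_of_nonneg_right (mul_le_mul_of_nonneg_left (prod_erase_const_le i s' U V) hC)
    (sobNorm2_nonneg _ _)

theorem tame_of_slot {n : ℕ} {F : VF n} {i : Fin n}
    (h : ∀ t : ℝ, ∃ s s' C : ℝ, 0 ≤ C ∧ ∀ X, sobNorm2 s (F X) ≤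
      C * sobNorm2 t (X i) * ∏ l ∈ Finset.univ.erase i, sobNorm2 s' (X l)) :
    Tame (fun U V => F (Function.update (fun _ => U) i V)) := by
  intro t
  obtain ⟨s, s', C, hC, hb⟩ := h t
  refine ⟨s, s', C, n, hC, fun U V => (hb _).trans ?_⟩
  rw [Function.update_self, mul_right_comm]
  exact mul_le_mul_of_nonneg_right (mul_le_mul_of_nonneg_left (prod_erase_const_le i s' U V) hC)
    (sobNorm2_nonneg _ _)

theorem growing_diag {n : ℕ} {F : VF n}
    (h : ∀ s : ℝ, ∃ s' C : ℝ, 0 ≤ C ∧ ∀ X, sobNorm2 s (F X) ≤ C * ∏ i, sobNorm2 s' (X i)) :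
    Growing (fun U => F (fun _ => U)) := by
  intro s
  obtain ⟨s', C, hC, hb⟩ := h s
  refine ⟨s', C, n, hC, fun U => (hb _).trans (mul_le_mul_of_nonneg_left ?_ hC)⟩
  have h0 := sobNorm2_nonneg s' U
  rw [Finset.prod_const, Finset.card_univ, Fintype.card_fin]
  gcongr
  linarith

/-! ### Spectrally localized operators -/

/-- The multilinear vector field attached to the entry `(σ, σ')` of a matrix of operators. -/
def entryVF {q : ℕ} (T : HomOp q) (σ σ' : Fin 2) : VF (q + 1) :=
  MultilinearMap.uncurryRight (M := fun _ => Hinf2) <|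
    LinearMap.compMultilinearMap
      ({ toFun := fun f => (LinearMap.single ℂ (fun _ : Fin 2 => Hinf) σ).comp
          (f.comp (LinearMap.proj σ'))
         map_add' := fun f g => by rw [LinearMap.add_comp, LinearMap.comp_add]
         map_smul' := fun c f => by rw [LinearMap.smul_comp, LinearMap.comp_smul]; rfl } :
        Module.End ℂ Hinf →ₗ[ℂ] (Hinf2 →ₗ[ℂ] Hinf2)) T

theorem entryVF_apply {q : ℕ} (T : HomOp q) (σ σ' : Fin 2) (X : Fin (q + 1) → Hinf2) :
    entryVF T σ σ' X = Pi.single σ (T (Fin.init X : Fin q → Hinf2) (X (Fin.last q) σ')) := rfl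

theorem entryVF_bdd {q : ℕ} {m : ℝ} {T : HomOp q} (hT : IsHomOp m T) (σ σ' : Fin 2) (s : ℝ) :
    ∃ s' C : ℝ, 0 ≤ C ∧ ∀ X, sobNorm2 s (entryVF T σ σ' X) ≤ C * ∏ i, sobNorm2 s' (X i) := by
  obtain ⟨s', C, hb⟩ := hT.bounded s
  refine ⟨s', |C|, abs_nonneg C, fun X => ?_⟩
  rw [entryVF_apply, sobNorm2_single, Fin.prod_univ_castSucc, ← mul_assoc]
  refine (hb _ _).trans ?_
  have h0 : 0 ≤ ∏ i, sobNorm2 s' ((Fin.init X : Fin q → Hinf2) i) :=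
    Finset.prod_nonneg fun _ _ => sobNorm2_nonneg _ _
  exact mul_le_mul (mul_le_mul_of_nonneg_right (le_abs_self C) h0) (sobNorm_le_sobNorm2 _ _ _)
    (sobNorm_nonneg _ _) (mul_nonneg (abs_nonneg C) h0)

theorem bilin_proj2 (n : ℕ) (y Z : Hinf2) :
    bilin y (proj2 n Z) = bilin (proj2 n y) (proj2 n Z) := by
  rw [bilin_eq, bilin_eq]
  refine tsum_congr fun p => ?_
  rw [proj2_coeff, proj2_coeff, Int.natAbs_neg]
  split_ifs <;> simp

theorem proj2_single (n : ℕ) (σ : Fin 2) (u : Hinf) :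
    proj2 n (Pi.single σ u) = Pi.single σ (proj n u) := by
  refine ext_modes fun σ' j => ?_
  rw [proj2_coeff]
  by_cases h : σ' = σ
  · subst h; rw [Pi.single_eq_same, Pi.single_eq_same]; rfl
  · rw [Pi.single_eq_of_ne h, Pi.single_eq_of_ne h]; simp

theorem maxTwo_le_maxOne {r : ℕ} (n : Fin r → ℕ) : maxTwo n ≤ maxOne n :=
  Finset.sup_le fun ij _ => (min_le_left _ _).trans (Finset.le_sup (Finset.mem_univ ij.1))

/-- Testing an operator against a function. -/
def entryForm {q : ℕ} (T : HomOp q) (σ σ' : Fin 2) :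
    MultilinearMap ℂ (fun _ : Fin (q + 1 + 1) => Hinf2) ℂ :=
  MultilinearMap.uncurryRight (M := fun _ => Hinf2) (bilinL.compMultilinearMap (entryVF T σ σ'))

theorem entryForm_apply {q : ℕ} (T : HomOp q) (σ σ' : Fin 2) (X : Fin (q + 1 + 1) → Hinf2) :
    entryForm T σ σ' X = bilin (entryVF T σ σ' (Fin.init X)) (X (Fin.last (q + 1))) := rfl

theorem formBdd_entryForm {q : ℕ} {m : ℝ} {T : HomOp q} (hT : IsHomOp m T) (σ σ' : Fin 2) :
    FormBdd (entryForm T σ σ') := by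
  obtain ⟨s', C, hC, hb⟩ := entryVF_bdd hT σ σ' 0
  refine ⟨max s' 0, C, le_max_right _ _, hC, fun X => ?_⟩
  rw [entryForm_apply, Fin.prod_univ_castSucc, ← mul_assoc]
  refine (norm_bilin_le 0 _ _).trans ?_
  rw [neg_zero]
  refine mul_le_mul ((hb _).trans (mul_le_mul_of_nonneg_left ?_ hC))
    (sobNorm2_mono (le_max_right _ _) _) (sobNorm2_nonneg _ _)
    (mul_nonneg hC (Finset.prod_nonneg fun _ _ => sobNorm2_nonneg _ _))
  exact Finset.prod_le_prod (fun _ _ => sobNorm2_nonneg _ _)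
    fun _ _ => sobNorm2_mono (le_max_left _ _) _

/-- Spectral localization bounds every frequency by a multiple of the one in the last operator slot,
so both maxima in the estimate can be replaced by it. The exponent uses |m| because m may be
negative and only an upper bound is wanted. -/
theorem entryForm_block {q : ℕ} {m : ℝ} {T : HomOp q} (hT : IsSpecLoc m T) (σ σ' : Fin 2) :
    ∃ M K D : ℝ, 0 ≤ M ∧ 0 ≤ K ∧ 1 ≤ D ∧ ∀ n : Fin (q + 1 + 1) → ℕ, (∀ i, 1 ≤ n i) →
      ∀ X : Fin (q + 1 + 1) → Hinf2, entryForm T σ σ' (fun i => proj2 (n i) (X i)) ≠ 0 →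
        ‖entryForm T σ σ' (fun i => proj2 (n i) (X i))‖ ≤
          K * (n (Fin.last q).castSucc : ℝ) ^ M * ∏ i, sobNorm2 0 (proj2 (n i) (X i)) ∧
        (∀ i : Fin q, (n i.castSucc.castSucc : ℝ) ≤ D * n (Fin.last q).castSucc) ∧
        (n (Fin.last (q + 1)) : ℝ) ≤ D * n (Fin.last q).castSucc ∧
        (n (Fin.last q).castSucc : ℝ) ≤ D * n (Fin.last (q + 1)) := by
  obtain ⟨μ, C, hμ, hC, hest⟩ := hT.estimate
  obtain ⟨δ, C', hδ, hC', hspec⟩ := hT.spectral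
  set D := max (max δ 1) C' with hD
  have hD1 : 1 ≤ D := le_max_of_le_left (le_max_right _ _)
  have hDδ : δ ≤ D := le_max_of_le_left (le_max_left _ _)
  have hDC : C' ≤ D := le_max_right _ _
  refine ⟨μ + |m|, C * D ^ (μ + |m|), D, by positivity, by positivity, hD1, fun n hn X hne => ?_⟩
  set n' : Fin (q + 1) → ℕ := fun i => n i.castSucc with hn'
  set N : ℝ := (n (Fin.last q).castSucc : ℝ) with hN
  set n₀ := n (Fin.last (q + 1)) with hn₀
  have hN1 : 1 ≤ N := by
    rw [hN]; exact_mod_cast hn (Fin.last q).castSucc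
  set U : Fin q → Hinf2 := fun i => X i.castSucc.castSucc with hU
  set v : Hinf := X (Fin.last q).castSucc σ' with hv
  have e : entryForm T σ σ' (fun i => proj2 (n i) (X i)) =
      bilin (Pi.single σ (block T n₀ n' U v)) (proj2 n₀ (X (Fin.last (q + 1)))) := by
    rw [entryForm_apply, bilin_proj2, entryVF_apply, proj2_single]
    rfl
  have hblock : block T n₀ n' U v ≠ 0 := by
    intro h
    apply hne
    rw [e, h, Pi.single_zero, ← bilinL_apply, map_zero, LinearMap.zero_apply]
  obtain ⟨h1, h2, h3⟩ := hspec n₀ n' U v (hn _) (fun i => hn _) hblock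
  have h1' : ∀ i : Fin q, (n i.castSucc.castSucc : ℝ) ≤ D * N := fun i =>
    (h1 i).trans (mul_le_mul_of_nonneg_right hDδ (by linarith))
  refine ⟨?_, h1', ?_, ?_⟩
  · rw [e]
    refine (norm_bilin_le 0 _ _).trans ?_
    rw [neg_zero, sobNorm2_single, Fin.prod_univ_castSucc, ← mul_assoc]
    refine mul_le_mul_of_nonneg_right ?_ (sobNorm2_nonneg _ _)
    refine (hest n₀ n' U v (hn _) (fun i => hn _)).trans ?_
    have hP : (∏ i : Fin q, sobNorm2 0 (proj2 (n' i.castSucc) (U i))) *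
        sobNorm 0 (proj (n' (Fin.last q)) v) ≤
        ∏ i : Fin (q + 1), sobNorm2 0 (proj2 (n i.castSucc) (X i.castSucc)) := by
      rw [Fin.prod_univ_castSucc]
      refine mul_le_mul_of_nonneg_left ?_ (Finset.prod_nonneg fun _ _ => sobNorm2_nonneg _ _)
      exact sobNorm_le_sobNorm2 0 (proj2 (n (Fin.last q).castSucc) (X (Fin.last q).castSucc)) σ'
    have hP0 : 0 ≤ (∏ i : Fin q, sobNorm2 0 (proj2 (n' i.castSucc) (U i))) *
        sobNorm 0 (proj (n' (Fin.last q)) v) :=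
      mul_nonneg (Finset.prod_nonneg fun _ _ => sobNorm2_nonneg _ _) (sobNorm_nonneg _ _)
    have hmax : (maxOne n' : ℝ) ≤ D * N := by
      have : ∀ i, (n' i : ℝ) ≤ D * N := by
        intro i
        induction i using Fin.lastCases with
        | last => exact le_mul_of_one_le_left (by linarith) hD1
        | cast i => exact h1' i
      obtain ⟨i, -, hi⟩ := Finset.exists_mem_eq_sup Finset.univ
        ⟨Fin.last q, Finset.mem_univ _⟩ n'
      rw [maxOne, hi]
      exact this i
    have hmax1 : (1 : ℝ) ≤ maxOne n' := by
      have : n' (Fin.last q) ≤ maxOne n' := Finset.le_sup (Finset.mem_univ _)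
      exact_mod_cast (hn _).trans this
    have hmax2 : (maxTwo n' : ℝ) ≤ maxOne n' := by exact_mod_cast maxTwo_le_maxOne n'
    have hcoef : C * (maxTwo n' : ℝ) ^ μ * (maxOne n' : ℝ) ^ m ≤ C * D ^ (μ + |m|) * N ^ (μ + |m|) := by
      rw [mul_assoc, mul_assoc]
      refine mul_le_mul_of_nonneg_left ?_ hC.le
      rw [← Real.mul_rpow (by linarith) (by linarith)]
      calc (maxTwo n' : ℝ) ^ μ * (maxOne n' : ℝ) ^ m
          ≤ (maxOne n' : ℝ) ^ μ * (maxOne n' : ℝ) ^ |m| := by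
            refine mul_le_mul (Real.rpow_le_rpow (by positivity) hmax2 hμ)
              (Real.rpow_le_rpow_of_exponent_le hmax1 (le_abs_self m)) (by positivity) (by positivity)
        _ = (maxOne n' : ℝ) ^ (μ + |m|) := (Real.rpow_add (by linarith) _ _).symm
        _ ≤ (D * N) ^ (μ + |m|) :=
            Real.rpow_le_rpow (by linarith) hmax (by positivity)
    exact mul_le_mul hcoef hP hP0 (by positivity)
  · have h4 : (n₀ : ℝ) ≤ C' * N := by
      rw [inv_mul_le_iff₀ (by linarith)] at h2
      exact h2
    exact h4.trans (mul_le_mul_of_nonneg_right hDC (by linarith))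
  · exact h3.trans (mul_le_mul_of_nonneg_right hDC (by positivity))

theorem rpow_le_of_comparable {x y c : ℝ} (hx : 1 ≤ x) (hy : 1 ≤ y) (hc : 1 ≤ c) (h : x ≤ c * y)
    (h' : y ≤ c * x) (r : ℝ) : x ^ r ≤ c ^ |r| * y ^ r := by
  rcases le_total 0 r with hr | hr
  · rw [abs_of_nonneg hr, ← Real.mul_rpow (by linarith) (by linarith)]
    exact Real.rpow_le_rpow (by linarith) h hr
  · rw [abs_of_nonpos hr]
    have h1 : (c * x) ^ r ≤ y ^ r := Real.rpow_le_rpow_of_nonpos (by linarith) h' hr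
    rw [Real.mul_rpow (by linarith) (by linarith)] at h1
    have h2 : c ^ (-r) * (c ^ r * x ^ r) ≤ c ^ (-r) * y ^ r :=
      mul_le_mul_of_nonneg_left h1 (by positivity)
    rwa [← mul_assoc, ← Real.rpow_add (by linarith), neg_add_cancel, Real.rpow_zero, one_mul] at h2

theorem one_le_rpow_mul {x y c : ℝ} (hx : 1 ≤ x) (hy : 1 ≤ y) (hc : 1 ≤ c) (h : x ≤ c * y)
    (t : ℝ) : 1 ≤ c ^ |t| * (x ^ t * y ^ |t|) := by
  have h1 : x ^ (-|t|) ≤ x ^ t := Real.rpow_le_rpow_of_exponent_le hx (neg_abs_le t)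
  have h2 : (c * y) ^ (-|t|) ≤ x ^ (-|t|) :=
    Real.rpow_le_rpow_of_nonpos (by linarith) h (by simp)
  have h3 : (c * y) ^ |t| * (c * y) ^ (-|t|) = 1 := by
    rw [← Real.rpow_add (by nlinarith), add_neg_cancel, Real.rpow_zero]
  rw [← h3, Real.mul_rpow (x := c) (y := y) (z := |t|) (by linarith) (by linarith)]
  calc c ^ |t| * y ^ |t| * (c * y) ^ (-|t|) ≤ c ^ |t| * y ^ |t| * x ^ t := by
        have : (c * y) ^ (-|t|) ≤ x ^ t := h2.trans h1
        gcongr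
    _ = _ := by ring

theorem prod_sobNorm2_zero {ι : Type*} [Fintype ι] (n : ι → ℕ) (hn : ∀ i, 1 ≤ n i) (e : ι → ℝ)
    (X : ι → Hinf2) : ∏ i, sobNorm2 (e i) (proj2 (n i) (X i)) =
      (∏ i, (n i : ℝ) ^ e i) * ∏ i, sobNorm2 0 (proj2 (n i) (X i)) := by
  rw [← Finset.prod_mul_distrib]
  refine Finset.prod_congr rfl fun i _ => ?_
  rw [sobNorm2_proj2 (hn i) (e i) 0, sub_zero]

/-- Reduces Sobolev bounds of a localized operator to an inequality between powers of the input
frequencies x and the output frequency y under the localization constraints. Each input loses two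
derivatives in the passage from blocks; the output loses these two and a third one by duality. -/
theorem entryVF_le {q : ℕ} {m : ℝ} {T : HomOp q} (hT : IsSpecLoc m T) (σ σ' : Fin 2) :
    ∃ M D : ℝ, 0 ≤ M ∧ 1 ≤ D ∧ ∀ (z K' : ℝ) (e : Fin (q + 1) → ℝ), 0 ≤ K' →
      (∀ (x : Fin (q + 1) → ℝ) (y : ℝ), (∀ i, 1 ≤ x i) → 1 ≤ y →
        (∀ i, x i ≤ D * x (Fin.last q)) → y ≤ D * x (Fin.last q) → x (Fin.last q) ≤ D * y →
        x (Fin.last q) ^ M ≤ K' * ((∏ i, x i ^ e i) * y ^ z)) →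
      ∃ C : ℝ, 0 ≤ C ∧ ∀ X, sobNorm2 (-(z + 3)) (entryVF T σ σ' X) ≤
        C * ∏ l, sobNorm2 (e l + 2) (X l) := by
  obtain ⟨M, K, D, hM, hK, hD, hblock⟩ := entryForm_block hT σ σ'
  refine ⟨M, D, hM, hD, fun z K' e hK' hcomb => ?_⟩
  have h := form_le_of_block_bound (formBdd_entryForm hT.toIsHomOp σ σ')
    (K := K * K') (by positivity) (Fin.snoc e z : Fin (q + 1 + 1) → ℝ) (fun n hn X => by
      have hP : 0 ≤ ∏ i, sobNorm2 0 (proj2 (n i) (X i)) :=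
        Finset.prod_nonneg fun _ _ => sobNorm2_nonneg _ _
      by_cases hne : entryForm T σ σ' (fun i => proj2 (n i) (X i)) = 0
      · rw [hne, norm_zero]
        exact mul_nonneg (by positivity) (Finset.prod_nonneg fun _ _ => sobNorm2_nonneg _ _)
      · obtain ⟨h1, h2, h3, h4⟩ := hblock n hn X hne
        refine h1.trans ?_
        rw [prod_sobNorm2_zero n hn (Fin.snoc e z : Fin (q + 1 + 1) → ℝ) X, ← mul_assoc]
        refine mul_le_mul_of_nonneg_right ?_ hP
        rw [mul_assoc]
        refine mul_le_mul_of_nonneg_left ?_ hK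
        have hpos : ∀ i, (1 : ℝ) ≤ n i := fun i => by exact_mod_cast hn i
        rw [Fin.prod_univ_castSucc]
        simp only [Fin.snoc_castSucc, Fin.snoc_last]
        refine hcomb (fun i => n i.castSucc) _ (fun i => hpos _) (hpos _) (fun i => ?_) h3 h4
        induction i using Fin.lastCases with
        | last => exact le_mul_of_one_le_left (by linarith [hpos (Fin.last q).castSucc]) hD
        | cast i => exact h2 i)
  have hK0 : 0 ≤ K * K' * zetaConst ^ Fintype.card (Fin (q + 1 + 1)) :=
    mul_nonneg (by positivity) (pow_nonneg zetaConst_nonneg _)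
  refine ⟨dualConst * (K * K' * zetaConst ^ Fintype.card (Fin (q + 1 + 1))),
    mul_nonneg dualConst_nonneg hK0, fun X => ?_⟩
  rw [mul_assoc dualConst]
  refine sobNorm2_le_of_dual
    (mul_nonneg hK0 (Finset.prod_nonneg fun _ _ => sobNorm2_nonneg _ _)) fun Z => ?_
  have h1 := h (Fin.snoc X Z)
  rw [entryForm_apply, Fin.init_snoc, Fin.snoc_last, Fin.prod_univ_castSucc, ← mul_assoc] at h1
  simp only [Fin.snoc_castSucc, Fin.snoc_last] at h1
  rwa [show -(-(z + 3) + 1) = z + 2 by ring]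

/-- Output and last input have comparable frequencies, so any power, of either sign, can be moved
from one to the other. -/
theorem entryVF_tame_last {q : ℕ} {m : ℝ} {T : HomOp q} (hT : IsSpecLoc m T) (σ σ' : Fin 2)
    (t : ℝ) : ∃ s s' C : ℝ, 0 ≤ C ∧ ∀ X, sobNorm2 s (entryVF T σ σ' X) ≤
      C * sobNorm2 t (X (Fin.last q)) * ∏ l ∈ Finset.univ.erase (Fin.last q), sobNorm2 s' (X l) := by
  obtain ⟨M, D, hM, hD, h⟩ := entryVF_le hT σ σ'
  obtain ⟨C, hC, hb⟩ := h (M - (t - 2)) (D ^ |M - (t - 2)|)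
    (fun l => if l = Fin.last q then t - 2 else 0) (by positivity) (fun x y hx hy _ h2 h3 => by
      rw [Fintype.prod_eq_single (Fin.last q) fun l hl => by rw [if_neg hl, Real.rpow_zero],
        if_pos rfl]
      have h0 : 0 < x (Fin.last q) := by linarith [hx (Fin.last q)]
      calc x (Fin.last q) ^ M = x (Fin.last q) ^ (t - 2) * x (Fin.last q) ^ (M - (t - 2)) := by
            rw [← Real.rpow_add h0]; ring_nf
        _ ≤ x (Fin.last q) ^ (t - 2) * (D ^ |M - (t - 2)| * y ^ (M - (t - 2))) :=
            mul_le_mul_of_nonneg_left (rpow_le_of_comparable (hx _) hy hD h3 h2 _) (by positivity)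
        _ = _ := by ring)
  refine ⟨_, 2, C, hC, fun X => (hb X).trans (le_of_eq ?_)⟩
  rw [mul_assoc, ← Finset.mul_prod_erase _ _ (Finset.mem_univ (Fin.last q)), if_pos rfl,
    sub_add_cancel]
  congr 2
  refine Finset.prod_congr rfl fun l hl => ?_
  rw [if_neg (Finset.ne_of_mem_erase hl), zero_add]

/-- An internal slot and the output have frequencies at most a multiple of that of the last slot.
Measuring the last argument strongly enough therefore pays for any gain in both. This is the
mechanism that makes dΦ(U) - B(U) smoothing. -/
theorem entryVF_smoothing {q : ℕ} {m : ℝ} {T : HomOp q} (hT : IsSpecLoc m T) (σ σ' : Fin 2)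
    {i : Fin (q + 1)} (hi : i ≠ Fin.last q) (s t : ℝ) :
    ∃ s' C : ℝ, 0 ≤ C ∧ ∀ X, sobNorm2 s (entryVF T σ σ' X) ≤
      C * sobNorm2 t (X i) * ∏ l ∈ Finset.univ.erase i, sobNorm2 s' (X l) := by
  obtain ⟨M, D, hM, hD, h⟩ := entryVF_le hT σ σ'
  -- Chosen so that the output order -(r + 3) equals s.
  set r := -s - 3 with hr
  -- The order of the operator, plus what is needed to compensate the slot i and the output in the
  -- worst case of sign.
  set w := M + |t - 2| + |r| with hw
  have hw0 : 0 ≤ w := by positivity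
  obtain ⟨C, hC, hb⟩ := h r (D ^ |t - 2| * D ^ |r|)
    (fun l => if l = i then t - 2 else if l = Fin.last q then w else 0) (by positivity)
    (fun x y hx hy h1 h2 h3 => by
      rw [Fintype.prod_eq_mul i (Fin.last q) hi
        fun l hl => by rw [if_neg hl.1, if_neg hl.2, Real.rpow_zero], if_pos rfl,
        if_neg hi.symm, if_pos rfl]
      have h0 : 0 < x (Fin.last q) := by linarith [hx (Fin.last q)]
      have h4 := one_le_rpow_mul (hx i) (hx (Fin.last q)) hD (h1 i) (t - 2)
      have h5 := one_le_rpow_mul hy (hx (Fin.last q)) hD h2 r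
      calc x (Fin.last q) ^ M = x (Fin.last q) ^ M * (1 * 1) := by ring
        _ ≤ x (Fin.last q) ^ M * ((D ^ |t - 2| * (x i ^ (t - 2) * x (Fin.last q) ^ |t - 2|)) *
            (D ^ |r| * (y ^ r * x (Fin.last q) ^ |r|))) :=
            mul_le_mul_of_nonneg_left (mul_le_mul h4 h5 zero_le_one (by positivity)) (by positivity)
        _ = _ := by
            rw [hw, Real.rpow_add h0, Real.rpow_add h0]; ring)
  refine ⟨w + 2, C, hC, fun X => ?_⟩
  have h1 := hb X
  rw [show -(r + 3) = s by rw [hr]; ring] at h1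
  refine h1.trans ?_
  rw [mul_assoc, ← Finset.mul_prod_erase _ _ (Finset.mem_univ i), if_pos rfl, sub_add_cancel]
  refine mul_le_mul_of_nonneg_left (mul_le_mul_of_nonneg_left ?_ (sobNorm2_nonneg _ _)) hC
  refine Finset.prod_le_prod (fun _ _ => sobNorm2_nonneg _ _) fun l hl => sobNorm2_mono ?_ _
  rw [if_neg (Finset.ne_of_mem_erase hl)]
  split_ifs
  · exact le_rfl
  · linarith

/-! ### Nice multilinear maps -/

theorem exists_forall_le_real {ι : Type*} [Finite ι] (f : ι → ℝ) : ∃ M, ∀ i, f i ≤ M := by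
  obtain ⟨M, hM⟩ := (Set.finite_range f).bddAbove
  exact ⟨M, fun i => hM ⟨i, rfl⟩⟩

theorem prod_sobNorm2_mono {ι : Type*} [Fintype ι] {s s' : ℝ} (h : s ≤ s') (X : ι → Hinf2) :
    ∏ i, sobNorm2 s (X i) ≤ ∏ i, sobNorm2 s' (X i) :=
  Finset.prod_le_prod (fun _ _ => sobNorm2_nonneg _ _) fun _ _ => sobNorm2_mono h _

theorem prod_sobNorm2_nonneg {ι : Type*} (T : Finset ι) (s : ℝ) (X : ι → Hinf2) :
    0 ≤ ∏ i ∈ T, sobNorm2 s (X i) := Finset.prod_nonneg fun _ _ => sobNorm2_nonneg _ _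

section Nice

variable {ι κ : Type*} [Fintype ι] [Fintype κ]

theorem isNice_zero : IsNice (0 : MultilinearMap ℂ (fun _ : ι => Hinf2) Hinf2) where
  bdd s := ⟨0, 0, le_rfl, fun X => by simp [sobNorm2_zero]⟩
  trans ς X := (map_zero (transL ς)).symm
  real _ _ := isRealPair_zero

theorem IsNice.add {F G : MultilinearMap ℂ (fun _ : ι => Hinf2) Hinf2} (hF : IsNice F)
    (hG : IsNice G) : IsNice (F + G) where
  bdd s := by
    obtain ⟨a, C, hC, h1⟩ := hF.bdd s
    obtain ⟨b, C', hC', h2⟩ := hG.bdd s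
    refine ⟨max a b, C + C', add_nonneg hC hC', fun X => (sobNorm2_add_le _ _ _).trans ?_⟩
    rw [add_mul]
    exact add_le_add
      ((h1 X).trans (mul_le_mul_of_nonneg_left (prod_sobNorm2_mono (le_max_left _ _) X) hC))
      ((h2 X).trans (mul_le_mul_of_nonneg_left (prod_sobNorm2_mono (le_max_right _ _) X) hC'))
  trans ς X := by
    rw [add_apply, add_apply, hF.trans, hG.trans]
    exact (map_add (transL ς) _ _).symm
  real X hX := (hF.real X hX).add (hG.real X hX)

theorem IsNice.smul {F : MultilinearMap ℂ (fun _ : ι => Hinf2) Hinf2} (hF : IsNice F) (r : ℝ) :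
    IsNice ((r : ℂ) • F) where
  bdd s := by
    obtain ⟨a, C, hC, h1⟩ := hF.bdd s
    refine ⟨a, ‖(r : ℂ)‖ * C, mul_nonneg (norm_nonneg _) hC, fun X => ?_⟩
    rw [smul_apply, sobNorm2_smul, mul_assoc]
    exact mul_le_mul_of_nonneg_left (h1 X) (norm_nonneg _)
  trans ς X := by
    rw [smul_apply, smul_apply, hF.trans]
    exact (map_smul (transL ς) _ _).symm
  real X hX := (hF.real X hX).smul r

theorem IsNice.sum {α : Type*} (T : Finset α)
    {F : α → MultilinearMap ℂ (fun _ : ι => Hinf2) Hinf2} (h : ∀ a ∈ T, IsNice (F a)) :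
    IsNice (∑ a ∈ T, F a) :=
  Finset.sum_induction F IsNice (fun _ _ => IsNice.add) isNice_zero h

theorem IsNice.domDomCongr {F : MultilinearMap ℂ (fun _ : ι => Hinf2) Hinf2} (hF : IsNice F)
    (e : ι ≃ κ) : IsNice (F.domDomCongr e) where
  bdd s := by
    obtain ⟨a, C, hC, h1⟩ := hF.bdd s
    refine ⟨a, C, hC, fun X => ?_⟩
    rw [← e.prod_comp]
    exact h1 _
  trans ς X := hF.trans ς _
  real X hX := hF.real _ fun i => hX (e i)

theorem IsNice.symmetrize {n : ℕ} {F : VF n} (hF : IsNice F) : IsNice (symmetrize F) := by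
  have := (IsNice.sum Finset.univ (fun (π : Equiv.Perm (Fin n)) _ => hF.domDomCongr π)).smul
    ((n.factorial : ℝ)⁻¹)
  rw [Complex.ofReal_inv, Complex.ofReal_natCast] at this
  exact this

end Nice

theorem IsNice.growing {n : ℕ} {F : VF n} (hF : IsNice F) : Growing (fun U => F (fun _ => U)) :=
  growing_diag hF.bdd

theorem IsRegularizing.smoothing {n : ℕ} {F : VF n} (hF : IsRegularizing F) :
    Smoothing (der F) :=
  Smoothing.sum Finset.univ fun i _ => smoothing_of_slot (hF i)

/-! ### Collecting multilinear maps by degree -/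

theorem der_add {ι : Type*} [Fintype ι] [DecidableEq ι] {H E : Type*} [AddCommGroup H] [Module ℂ H]
    [AddCommGroup E] [Module ℂ E] (F G : MultilinearMap ℂ (fun _ : ι => H) E) (U V : H) :
    der (F + G) U V = der F U V + der G U V := by
  simp [der, Finset.sum_add_distrib]

theorem der_zero {ι : Type*} [Fintype ι] [DecidableEq ι] {H E : Type*} [AddCommGroup H] [Module ℂ H]
    [AddCommGroup E] [Module ℂ E] (U V : H) :
    der (0 : MultilinearMap ℂ (fun _ : ι => H) E) U V = 0 := by
  simp [der]

theorem isSymm_zero {H E : Type*} [AddCommGroup H] [Module ℂ H] [AddCommGroup E] [Module ℂ E]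
    {n : ℕ} : IsSymm (0 : MultilinearMap ℂ (fun _ : Fin n => H) E) := fun _ _ => rfl

theorem IsSymm.add {H E : Type*} [AddCommGroup H] [Module ℂ H] [AddCommGroup E] [Module ℂ E]
    {n : ℕ} {F G : MultilinearMap ℂ (fun _ : Fin n => H) E} (hF : IsSymm F) (hG : IsSymm G) :
    IsSymm (F + G) := fun π X => by rw [add_apply, add_apply, hF, hG]

section Collect

variable {α : Type*} [Fintype α] {ι : α → Type*} [∀ a, Fintype (ι a)]

/-- The component of degree `q + 1` of a sum of multilinear maps. -/
def collect (T : ∀ a, MultilinearMap ℂ (fun _ : ι a => Hinf2) Hinf2) (q : ℕ) : VF (q + 1) :=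
  symmetrize (∑ a, if h : Fintype.card (ι a) = q + 1 then
    (T a).domDomCongr (Fintype.equivFinOfCardEq h) else 0)

variable (T : ∀ a, MultilinearMap ℂ (fun _ : ι a => Hinf2) Hinf2)

theorem isSymm_collect (q : ℕ) : IsSymm (collect T q) := isSymm_symmetrize _

theorem isNice_collect (hT : ∀ a, IsNice (T a)) (q : ℕ) : IsNice (collect T q) := by
  refine (IsNice.sum Finset.univ fun a _ => ?_).symmetrize
  split_ifs with h
  · exact (hT a).domDomCongr _
  · exact isNice_zero

theorem collect_diag (q : ℕ) (U : Hinf2) : collect T q (fun _ => U) =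
    ∑ a, if Fintype.card (ι a) = q + 1 then T a (fun _ => U) else 0 := by
  rw [collect, symmetrize_diag, sum_apply]
  refine Finset.sum_congr rfl fun a _ => ?_
  split_ifs <;> rfl

theorem der_collect [∀ a, DecidableEq (ι a)] (q : ℕ) (U V : Hinf2) : der (collect T q) U V =
    ∑ a, if Fintype.card (ι a) = q + 1 then der (T a) U V else 0 := by
  rw [collect, der_symmetrize, der_sum]
  refine Finset.sum_congr rfl fun a _ => ?_
  split_ifs
  · rw [der_domDomCongr]
  · rw [der_zero]

theorem collect_eq_zero (q : ℕ) (h : ∀ a, Fintype.card (ι a) ≠ q + 1) : collect T q = 0 := by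
  refine IsSymm.eq_of_diag (isSymm_collect T q) isSymm_zero fun U => ?_
  rw [collect_diag, Finset.sum_eq_zero fun a _ => if_neg (h a)]; rfl

theorem sum_collect_aux {E : Type*} [AddCommMonoid E] {L : ℕ}
    (h : ∀ a, Fintype.card (ι a) ∈ Finset.Icc 1 (L + 1)) (x : α → E) :
    ∑ q ∈ Finset.range (L + 1), ∑ a, (if Fintype.card (ι a) = q + 1 then x a else 0)
      = ∑ a, x a := by
  rw [Finset.sum_comm]
  refine Finset.sum_congr rfl fun a _ => ?_
  have ha := Finset.mem_Icc.1 (h a)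
  rw [Finset.sum_eq_single_of_mem (Fintype.card (ι a) - 1)
    (Finset.mem_range.2 (by omega)) fun q _ hq => if_neg (by omega), if_pos (by omega)]

end Collect

/-! ### Polynomial maps -/

/-- The polynomial map with components `D`. -/
def polyMap (L : ℕ) (D : (q : ℕ) → VF (q + 1)) (U : Hinf2) : Hinf2 :=
  ∑ q ∈ Finset.range (L + 1), D q (fun _ => U)

/-- The differential of a polynomial map. -/
def polyDer (L : ℕ) (D : (q : ℕ) → VF (q + 1)) (U V : Hinf2) : Hinf2 :=
  ∑ q ∈ Finset.range (L + 1), der (D q) U V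

theorem polyMap_of_le {L L' : ℕ} (h : L ≤ L') {D : (q : ℕ) → VF (q + 1)}
    (hD : ∀ q, L < q → D q = 0) : polyMap L' D = polyMap L D := by
  funext U
  refine (Finset.sum_subset (Finset.range_mono (by omega)) fun q _ hq => ?_).symm
  rw [hD q (by simpa using hq)]; rfl

theorem polyDer_of_le {L L' : ℕ} (h : L ≤ L') {D : (q : ℕ) → VF (q + 1)}
    (hD : ∀ q, L < q → D q = 0) : polyDer L' D = polyDer L D := by
  funext U V
  refine (Finset.sum_subset (Finset.range_mono (by omega)) fun q _ hq => ?_).symm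
  rw [hD q (by simpa using hq), der_zero]

section Comp

variable {k L : ℕ} (G : VF (k + 1)) (D : (q : ℕ) → VF (q + 1))

/-- The homogeneous terms of the composition of a homogeneous and a polynomial map. -/
def compTerm (r : Fin (k + 1) → Fin (L + 1)) :
    MultilinearMap ℂ (fun _ : (i : Fin (k + 1)) × Fin ((r i : ℕ) + 1) => Hinf2) Hinf2 :=
  G.compMultilinearMap fun i => D (r i)

theorem compTerm_apply (r : Fin (k + 1) → Fin (L + 1))
    (X : (i : Fin (k + 1)) × Fin ((r i : ℕ) + 1) → Hinf2) :
    compTerm G D r X = G fun i => D (r i) fun j => X ⟨i, j⟩ := rfl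

theorem isNice_compTerm (hG : IsNice G) (hD : ∀ q, IsNice (D q)) (r : Fin (k + 1) → Fin (L + 1)) :
    IsNice (compTerm G D r) where
  bdd s := by
    obtain ⟨a, C, hC, h⟩ := hG.bdd s
    choose b C' hC' h' using fun q => (hD q).bdd a
    obtain ⟨M, hM⟩ := exists_forall_le_real fun i => b (r i)
    refine ⟨M, C * ∏ i, C' (r i), mul_nonneg hC (Finset.prod_nonneg fun _ _ => hC' _),
      fun X => (h _).trans ?_⟩
    rw [mul_assoc, Fintype.prod_sigma, ← Finset.prod_mul_distrib]
    refine mul_le_mul_of_nonneg_left (Finset.prod_le_prod (fun _ _ => sobNorm2_nonneg _ _)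
      fun i _ => (h' _ _).trans ?_) hC
    exact mul_le_mul_of_nonneg_left (prod_sobNorm2_mono (hM i) _) (hC' _)
  trans ς X := by
    rw [compTerm_apply, compTerm_apply, ← hG.trans]
    simp only [(hD _).trans]
  real X hX := hG.real _ fun i => (hD _).real _ fun j => hX _

theorem sum_compTerm (U : Hinf2) :
    ∑ r, compTerm (L := L) G D r (fun _ => U) = G (fun _ => polyMap L D U) := by
  simp only [compTerm_apply, polyMap]
  simp only [← Fin.sum_univ_eq_sum_range (fun q => D q (fun _ => U))]
  rw [MultilinearMap.map_sum]

theorem der_compTerm (r : Fin (k + 1) → Fin (L + 1)) (U V : Hinf2) :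
    der (compTerm G D r) U V = ∑ i, G (Function.update (fun i' => D (r i') (fun _ => U)) i
      (der (D (r i)) U V)) := by
  simp only [der]
  rw [Fintype.sum_sigma]
  refine Finset.sum_congr rfl fun i _ => ?_
  rw [MultilinearMap.map_update_sum]
  refine Finset.sum_congr rfl fun j _ => ?_
  rw [compTerm_apply]
  congr 1
  funext i'
  by_cases h : i' = i
  · subst h
    rw [Function.update_self]
    congr 1
    funext j'
    by_cases h' : j' = j
    · subst h'; simp
    · rw [Function.update_of_ne h', Function.update_of_ne (by simpa using h')]
  · rw [Function.update_of_ne h]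
    congr 1
    funext j'
    rw [Function.update_of_ne fun h' => h (congrArg Sigma.fst h')]

/-- The chain rule. Expanding G by multilinearity, with dD in one slot and D in the others,
reproduces the derivatives of all homogeneous terms. -/
theorem sum_der_compTerm (U V : Hinf2) :
    ∑ r, der (compTerm (L := L) G D r) U V = der G (polyMap L D U) (polyDer L D U V) := by
  simp only [der_compTerm]
  rw [Finset.sum_comm, der]
  refine Finset.sum_congr rfl fun i _ => ?_
  have e : Function.update (fun _ => polyMap L D U) i (polyDer L D U V) =
      fun i' => ∑ a : Fin (L + 1), if i' = i then der (D a) U V else D a fun _ => U := by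
    funext i'
    by_cases h : i' = i
    · subst h
      rw [Function.update_self]
      simp only [if_true]
      rw [Fin.sum_univ_eq_sum_range (fun q => der (D q) U V)]; rfl
    · rw [Function.update_of_ne h]
      simp only [if_neg h]
      rw [Fin.sum_univ_eq_sum_range (fun q => D q (fun _ => U))]; rfl
  rw [e, MultilinearMap.map_sum]
  refine Finset.sum_congr rfl fun r _ => ?_
  congr 1
  funext i'
  by_cases h : i' = i
  · subst h; simp
  · simp [h]

/-- The composition of a homogeneous map and of a polynomial map tangent to the identity. -/
theorem exists_comp (hG : IsNice G) (hGs : IsSymm G) (hD : ∀ q, IsNice (D q))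
    (hD0 : ∀ U, D 0 (fun _ => U) = U) :
    ∃ (L' : ℕ) (E : (q : ℕ) → VF (q + 1)), (∀ q, IsSymm (E q)) ∧ (∀ q, IsNice (E q)) ∧
      (∀ q, L' < q → E q = 0) ∧ (∀ q, q < k → E q = 0) ∧ E k = G ∧
      (∀ U, polyMap L' E U = G (fun _ => polyMap L D U)) ∧
      ∀ U V, polyDer L' E U V = der G (polyMap L D U) (polyDer L D U V) := by
  have hcard : ∀ r : Fin (k + 1) → Fin (L + 1),
      Fintype.card ((i : Fin (k + 1)) × Fin ((r i : ℕ) + 1)) = ∑ i, (r i : ℕ) + (k + 1) := by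
    intro r
    rw [Fintype.card_sigma]
    simp [Finset.sum_add_distrib]
  have hle : ∀ r : Fin (k + 1) → Fin (L + 1), ∑ i, (r i : ℕ) ≤ (k + 1) * L := by
    intro r
    refine (Finset.sum_le_card_nsmul _ _ L fun i _ => by have := (r i).2; omega).trans ?_
    simp
  have hmem : ∀ r : Fin (k + 1) → Fin (L + 1),
      Fintype.card ((i : Fin (k + 1)) × Fin ((r i : ℕ) + 1)) ∈
        Finset.Icc 1 ((k + 1) * L + k + 1) := by
    intro r
    rw [hcard, Finset.mem_Icc]
    have := hle r
    omega
  -- The term of `r` has index ∑ rᵢ + k, with each rᵢ at most L.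
  refine ⟨(k + 1) * L + k, collect (compTerm (L := L) G D), isSymm_collect _,
    isNice_collect _ (isNice_compTerm G D hG hD), fun q hq => ?_, fun q hq => ?_, ?_,
    fun U => ?_, fun U V => ?_⟩
  · refine collect_eq_zero _ q fun r => ?_
    have := Finset.mem_Icc.1 (hmem r)
    omega
  · refine collect_eq_zero _ q fun r => ?_
    rw [hcard]; omega
  -- Index k forces all rᵢ = 0, and the component of index 0 of `D` is the identity on the diagonal.
  · refine IsSymm.eq_of_diag (isSymm_collect _ k) hGs fun U => ?_
    rw [collect_diag, Finset.sum_eq_single_of_mem (0 : Fin (k + 1) → Fin (L + 1))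
      (Finset.mem_univ _), if_pos (by rw [hcard]; simp), compTerm_apply]
    · congr 1
      funext i
      exact hD0 U
    · intro r _ hr
      rw [if_neg]
      rw [hcard]
      intro h
      refine hr (funext fun i => Fin.ext ?_)
      have h0 : ∑ i, (r i : ℕ) = 0 := by omega
      simpa using (Finset.sum_eq_zero_iff.1 h0) i (Finset.mem_univ i)
  · rw [← sum_compTerm, polyMap]
    simp only [collect_diag]
    exact sum_collect_aux hmem _
  · rw [← sum_der_compTerm, polyDer]
    simp only [der_collect]
    exact sum_collect_aux hmem _

end Comp

/-! ### Momentum conservation -/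

theorem proj2_eq_sum_units {n : ℕ} (hn : 1 ≤ n) (V : Hinf2) :
    proj2 n V = ∑ ε : ℤˣ, multiplier (fun j => if j = (ε : ℤ) * n then 1 else 0)
      (fun j => by split_ifs <;> simp) V := by
  refine ext_modes fun σ j => ?_
  rw [Finset.sum_apply, Submodule.coe_sum, Finset.sum_apply]
  simp only [multiplier_apply, proj2_coeff]
  have : (Finset.univ : Finset ℤˣ) = {1, -1} := rfl
  rw [this, Finset.sum_pair (by decide)]
  simp only [Units.val_one, one_mul, Units.val_neg, neg_mul]
  have h1 : j.natAbs = n ↔ j = n ∨ j = -n := by omega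
  simp only [h1]
  by_cases ha : j = n
  · simp [ha, show (n : ℤ) ≠ -n by omega]
  · simp [ha]

theorem trans2_multiplier_single (ς : ℝ) (k : ℤ) (V : Hinf2) :
    trans2 ς (multiplier (fun j => if j = k then 1 else 0) (fun j => by split_ifs <;> simp) V) =
      Complex.exp (((k * ς : ℝ) : ℂ) * Complex.I) •
        multiplier (fun j => if j = k then 1 else 0) (fun j => by split_ifs <;> simp) V := by
  refine ext_modes fun σ j => ?_
  change _ = Complex.exp _ * (multiplier _ _ V σ).1 j
  rw [trans2_coeff, multiplier_apply]
  split_ifs with h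
  · rw [h]
  · simp

/-- A translation invariant form only couples frequencies which cancel for some signs. -/
theorem exists_signs {r : ℕ} {A : MultilinearMap ℂ (fun _ : Fin r => Hinf2) ℂ}
    (hA : ∀ (ς : ℝ) X, A (fun i => trans2 ς (X i)) = A X) {n : Fin r → ℕ} (hn : ∀ i, 1 ≤ n i)
    {X : Fin r → Hinf2} (h : A (fun i => proj2 (n i) (X i)) ≠ 0) :
    ∃ ε : Fin r → ℤˣ, ∑ i, (ε i : ℤ) * (n i : ℤ) = 0 := by
  simp only [proj2_eq_sum_units (hn _), MultilinearMap.map_sum] at h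
  obtain ⟨ε, -, hε⟩ := Finset.exists_ne_zero_of_sum_ne_zero h
  refine ⟨ε, ?_⟩
  by_contra h0
  set k := ∑ i, (ε i : ℤ) * (n i : ℤ) with hk
  -- If the signed sum k were not zero, the translation by π/k would multiply the form by e^{iπ} =
  -- -1, so its value would vanish.
  have h1 := hA (Real.pi / k) (fun i => multiplier (fun j => if j = (ε i : ℤ) * n i then 1 else 0)
      (fun j => by split_ifs <;> simp) (X i))
  simp only [trans2_multiplier_single] at h1
  rw [MultilinearMap.map_smul_univ, ← Complex.exp_sum, ← Finset.sum_mul, ← Complex.ofReal_sum,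
    ← Finset.sum_mul] at h1
  have h2 : (∑ i, (((ε i : ℤ) * (n i : ℤ) : ℤ) : ℝ)) * (Real.pi / k) = Real.pi := by
    rw [← Int.cast_sum, ← hk]
    have : (k : ℝ) ≠ 0 := by exact_mod_cast h0
    field_simp
  rw [h2, Complex.exp_pi_mul_I, smul_eq_mul, neg_one_mul, neg_eq_iff_add_eq_zero,
    add_self_eq_zero] at h1
  exact hε h1

/-- The output is tested against a function of frequency n₀, which becomes one more argument of a
translation invariant form. -/
theorem exists_signs_vf {r : ℕ} {F : VF r} (hF : IsNice F) {n₀ : ℕ} (hn₀ : 1 ≤ n₀)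
    {n : Fin r → ℕ} (hn : ∀ i, 1 ≤ n i) {X : Fin r → Hinf2}
    (h : proj2 n₀ (F (fun i => proj2 (n i) (X i))) ≠ 0) :
    ∃ (ε₀ : ℤˣ) (ε : Fin r → ℤˣ), (ε₀ : ℤ) * n₀ + ∑ i, (ε i : ℤ) * (n i : ℤ) = 0 := by
  obtain ⟨W, hW⟩ : ∃ W, bilin (F (fun i => proj2 (n i) (X i))) (proj2 n₀ W) ≠ 0 := by
    by_contra! h'
    refine h (eq_of_bilin fun W => ?_)
    rw [bilin_comm, bilin_proj2, bilin_comm, ← bilin_proj2, h', bilin_comm]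
    exact (map_zero (bilinL W)).symm
  set A : MultilinearMap ℂ (fun _ : Fin (r + 1) => Hinf2) ℂ :=
    MultilinearMap.uncurryRight (M := fun _ => Hinf2) (bilinL.compMultilinearMap F) with hA
  have hAapp : ∀ X, A X = bilin (F (Fin.init X)) (X (Fin.last r)) := fun _ => rfl
  obtain ⟨ε, hε⟩ := exists_signs (A := A) (n := Fin.snoc n n₀) (X := Fin.snoc X W)
    (fun ς X => by
      rw [hAapp, hAapp, ← bilin_trans2 ς (F (Fin.init X)), ← hF.trans]; rfl)
    (fun i => by
      induction i using Fin.lastCases with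
      | last => simpa using hn₀
      | cast i => simpa using hn i)
    (by
      rw [hAapp]
      have e1 : (Fin.init fun i => proj2 ((Fin.snoc n n₀ : Fin (r + 1) → ℕ) i)
          ((Fin.snoc X W : Fin (r + 1) → Hinf2) i) : Fin r → Hinf2) =
          fun i => proj2 (n i) (X i) := by
        funext i; simp [Fin.init]
      rw [e1]
      simpa using hW)
  refine ⟨ε (Fin.last r), fun i => ε i.castSucc, ?_⟩
  rw [Fin.sum_univ_castSucc] at hε
  simp only [Fin.snoc_castSucc, Fin.snoc_last] at hε
  linarith

/-! ### Operators from vector fields -/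

/-- The matrix of operators `V ↦ F(U₁, …, U_q, V)`. -/
def opMat {q : ℕ} (F : VF (q + 1)) : OpMat q := fun σ σ' =>
  LinearMap.compMultilinearMap
    ({ toFun := fun f => (LinearMap.proj σ).comp (f.comp (LinearMap.single ℂ (fun _ => Hinf) σ'))
       map_add' := fun f g => by rw [LinearMap.add_comp, LinearMap.comp_add]
       map_smul' := fun c f => by rw [LinearMap.smul_comp, LinearMap.comp_smul]; rfl } :
      (Hinf2 →ₗ[ℂ] Hinf2) →ₗ[ℂ] Module.End ℂ Hinf) (MultilinearMap.curryRight F)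

theorem opMat_apply {q : ℕ} (F : VF (q + 1)) (σ σ' : Fin 2) (X : Fin q → Hinf2) (v : Hinf) :
    opMat F σ σ' X v = F (Fin.snoc X (Pi.single σ' v)) σ := rfl

theorem sum_single (V : Hinf2) : ∑ σ' : Fin 2, Pi.single σ' (V σ') = V :=
  Finset.univ_sum_single V

theorem opMat_sum {q : ℕ} (F : VF (q + 1)) (σ : Fin 2) (X : Fin q → Hinf2) (V : Hinf2) :
    ∑ σ', opMat F σ σ' X (V σ') = F (Fin.snoc X V) σ := by
  simp only [opMat_apply]
  have h := map_sum (MultilinearMap.curryRight F X) (fun σ' : Fin 2 => Pi.single σ' (V σ')) Finset.univ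
  rw [sum_single] at h
  exact ((congrFun h σ).trans (Finset.sum_apply _ _ _)).symm

theorem opMat_eval_act {q : ℕ} (F : VF (q + 1)) (U V : Hinf2) :
    LinMat.act ((opMat F).eval U) V = F (Fin.snoc (fun _ : Fin q => U) V) :=
  funext fun σ => opMat_sum F σ _ V

theorem opMat_dEval_act {q : ℕ} (F : VF (q + 1)) (U V : Hinf2) :
    LinMat.act ((opMat F).dEval U V) U =
      ∑ i : Fin q, F (Fin.snoc (Function.update (fun _ => U) i V) U) := by
  funext σ
  rw [Finset.sum_apply, LinMat.act]
  simp only [OpMat.dEval, MultilinearMap.linearDeriv_apply, LinearMap.sum_apply]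
  rw [Finset.sum_comm]
  exact Finset.sum_congr rfl fun i _ => opMat_sum F σ _ U

/-- Splits the derivative as in `dPluriMap`: the operator applied to V, and the variation of the
operator applied to U. -/
theorem der_eq_snoc {q : ℕ} (F : VF (q + 1)) (U V : Hinf2) :
    der F U V = F (Fin.snoc (fun _ : Fin q => U) V) +
      ∑ i : Fin q, F (Fin.snoc (Function.update (fun _ => U) i V) U) := by
  rw [der, Fin.sum_univ_castSucc, add_comm, snoc_const_eq]
  congr 1
  refine Finset.sum_congr rfl fun i _ => congrArg F ?_
  funext j
  induction j using Fin.lastCases with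
  | last => simp [(Fin.castSucc_ne_last i).symm]
  | cast j =>
    rw [Fin.snoc_castSucc]
    by_cases h : j = i
    · subst h; simp
    · rw [Function.update_of_ne h, Function.update_of_ne (fun h' => h (Fin.castSucc_injective _ h'))]

theorem block_opMat {q : ℕ} (F : VF (q + 1)) (σ σ' : Fin 2) (n₀ : ℕ) (n : Fin (q + 1) → ℕ)
    (U : Fin q → Hinf2) (V : Hinf) :
    block (opMat F σ σ') n₀ n U V = proj2 n₀ (F fun i =>
      proj2 (n i) ((Fin.snoc U (Pi.single σ' V) : Fin (q + 1) → Hinf2) i)) σ := by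
  have e : (Fin.snoc (fun i => proj2 (n i.castSucc) (U i))
      (Pi.single σ' (proj (n (Fin.last q)) V)) : Fin (q + 1) → Hinf2) =
      fun i => proj2 (n i) ((Fin.snoc U (Pi.single σ' V) : Fin (q + 1) → Hinf2) i) := by
    funext i
    induction i using Fin.lastCases with
    | last => rw [Fin.snoc_last, Fin.snoc_last, proj2_single]
    | cast i => rw [Fin.snoc_castSucc, Fin.snoc_castSucc]
  rw [← e]; rfl

theorem trans2_single (ς : ℝ) (σ : Fin 2) (u : Hinf) :
    trans2 ς (Pi.single σ u) = Pi.single σ (trans ς u) := by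
  refine ext_modes fun σ' j => ?_
  rw [trans2_coeff]
  by_cases h : σ' = σ
  · subst h; rw [Pi.single_eq_same, Pi.single_eq_same]; rfl
  · rw [Pi.single_eq_of_ne h, Pi.single_eq_of_ne h]; simp

theorem prod_snoc_single {q : ℕ} (s : ℝ) (σ' : Fin 2) (n : Fin (q + 1) → ℕ) (U : Fin q → Hinf2)
    (V : Hinf) : ∏ i, sobNorm2 s
      (proj2 (n i) ((Fin.snoc U (Pi.single σ' V) : Fin (q + 1) → Hinf2) i)) =
      (∏ i : Fin q, sobNorm2 s (proj2 (n i.castSucc) (U i))) *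
        sobNorm s (proj (n (Fin.last q)) V) := by
  rw [Fin.prod_univ_castSucc]
  simp only [Fin.snoc_castSucc, Fin.snoc_last]
  rw [proj2_single, sobNorm2_single]

theorem isHomOp_opMat {q : ℕ} {F : VF (q + 1)} (hs : IsSymm F) (hF : IsNice F) {m : ℝ}
    (hest : ∃ μ C : ℝ, 0 ≤ μ ∧ 0 ≤ C ∧ ∀ (n : Fin (q + 1) → ℕ) (X : Fin (q + 1) → Hinf2),
      (∀ i, 1 ≤ n i) → sobNorm2 0 (F fun i => proj2 (n i) (X i)) ≤
        C * (maxTwo n : ℝ) ^ μ * (maxOne n : ℝ) ^ m * ∏ i, sobNorm2 0 (proj2 (n i) (X i)))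
    (σ σ' : Fin 2) : IsHomOp m (opMat F σ σ') where
  symm π U := by
    refine LinearMap.ext fun v => ?_
    rw [opMat_apply, opMat_apply, ← hs (extendPerm π) (Fin.snoc U _)]
    refine congrFun (congrArg F (funext fun i => ?_)) σ
    induction i using Fin.lastCases with
    | last => simp [extendPerm]
    | cast i => simp [extendPerm]
  bounded s := by
    obtain ⟨s', C, hC, h⟩ := hF.bdd s
    refine ⟨s', C, fun U V => ?_⟩
    rw [opMat_apply]
    refine (sobNorm_le_sobNorm2 s _ σ).trans ((h _).trans (le_of_eq ?_))
    rw [Fin.prod_univ_castSucc]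
    simp only [Fin.snoc_castSucc, Fin.snoc_last, sobNorm2_single, mul_assoc]
  estimate := by
    obtain ⟨μ, C, hμ, hC, h⟩ := hest
    refine ⟨μ, C + 1, hμ, by positivity, fun n₀ n U V _ hn => ?_⟩
    rw [block_opMat]
    refine (sobNorm_le_sobNorm2 0 _ σ).trans ((proj2_le n₀ 0 _).trans ((h n _ hn).trans ?_))
    rw [prod_snoc_single]
    have h1 : 0 ≤ ∏ i : Fin q, sobNorm2 0 (proj2 (n i.castSucc) (U i)) :=
      prod_sobNorm2_nonneg _ _ _
    have h2 := sobNorm_nonneg 0 (proj (n (Fin.last q)) V)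
    generalize ∏ i : Fin q, sobNorm2 0 (proj2 (n i.castSucc) (U i)) = P at h1 ⊢
    gcongr
    linarith
  momentum n₀ n U V hn₀ hn hne := by
    rw [block_opMat] at hne
    exact exists_signs_vf hF hn₀ hn fun h => hne (by rw [h]; rfl)
  translation ς U V := by
    rw [opMat_apply, ← trans2_single]
    have e : (Fin.snoc (fun i => trans2 ς (U i)) (trans2 ς (Pi.single σ' V)) :
        Fin (q + 1) → Hinf2) = fun i => trans2 ς ((Fin.snoc U (Pi.single σ' V) :
          Fin (q + 1) → Hinf2) i) := by
      funext i
      induction i using Fin.lastCases with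
      | last => simp
      | cast i => simp
    rw [e, hF.trans]; rfl

theorem le_maxOne {r : ℕ} (n : Fin r → ℕ) (i : Fin r) : n i ≤ maxOne n :=
  Finset.le_sup (Finset.mem_univ i)

theorem le_maxTwo {r : ℕ} {n : Fin r → ℕ} {i o : Fin r} (hio : i ≠ o) (ho : n i ≤ n o) :
    n i ≤ maxTwo n := by
  have := Finset.le_sup (f := fun ij : Fin r × Fin r => min (n ij.1) (n ij.2))
    (b := (i, o)) (Finset.mem_offDiag.2 ⟨Finset.mem_univ i, Finset.mem_univ o, hio⟩)
  simp only [min_eq_left ho] at this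
  exact this

theorem prod_proj2_le {ι : Type*} (T : Finset ι) {s : ℝ} (hs : 0 ≤ s) {n : ι → ℕ} {M : ℕ}
    (hn : ∀ i ∈ T, 1 ≤ n i) (hM : ∀ i ∈ T, n i ≤ M) (X : ι → Hinf2) :
    ∏ i ∈ T, sobNorm2 s (proj2 (n i) (X i)) ≤
      (M : ℝ) ^ (T.card * s) * ∏ i ∈ T, sobNorm2 0 (proj2 (n i) (X i)) := by
  have h : (M : ℝ) ^ (T.card * s) = ∏ _i ∈ T, (M : ℝ) ^ s := by
    rw [Finset.prod_const, mul_comm, Real.rpow_mul_natCast (by positivity)]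
  rw [h, ← Finset.prod_mul_distrib]
  refine Finset.prod_le_prod (fun _ _ => sobNorm2_nonneg _ _) fun i hi => ?_
  rw [sobNorm2_proj2 (hn i hi) s 0, sub_zero]
  refine mul_le_mul_of_nonneg_right ?_ (sobNorm2_nonneg _ _)
  exact Real.rpow_le_rpow (by positivity) (by exact_mod_cast hM i hi) hs

/-- Continuity alone gives some order: on blocks every derivative costs at most the largest
frequency. -/
theorem isOp_opMat {q : ℕ} {F : VF (q + 1)} (hs : IsSymm F) (hF : IsNice F) :
    (opMat F).IsOp := by
  obtain ⟨s, C, hC, h⟩ := hF.bdd 0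
  refine ⟨(Finset.univ : Finset (Fin (q + 1))).card * max s 0, by positivity,
    isHomOp_opMat hs hF ⟨0, C, le_rfl, hC, fun n X hn => (h _).trans ?_⟩⟩
  rw [Real.rpow_zero, mul_one, mul_assoc]
  exact mul_le_mul_of_nonneg_left ((prod_sobNorm2_mono (le_max_left s 0) _).trans
    (prod_proj2_le _ (le_max_right s 0) (fun i _ => hn i) (fun i _ => le_maxOne n i) X)) hC

/-- The gain is taken in the slot of highest frequency, which yields the factor max^{-ϱ}. The other
slots have frequencies at most the second largest entry, so their derivatives are absorbed by its
power μ. -/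
theorem isSmoothing_opMat {q : ℕ} {F : VF (q + 1)} (hs : IsSymm F) (hF : IsNice F)
    (hr : IsRegularizing F) (ϱ : ℝ) : (opMat F).IsSmoothing ϱ := by
  choose s C hC h using fun i => hr i 0 (-ϱ)
  obtain ⟨K, hK⟩ := exists_forall_le_real C
  obtain ⟨S, hS⟩ := exists_forall_le_real s
  refine isHomOp_opMat hs hF ⟨q * max S 0, max K 0, by positivity, le_max_right _ _,
    fun n X hn => ?_⟩
  obtain ⟨o, ho⟩ := Finite.exists_max n
  have h1 : maxOne n = n o := le_antisymm (Finset.sup_le fun i _ => ho i) (le_maxOne n o)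
  have h2 := prod_proj2_le (Finset.univ.erase o) (s := max S 0) (le_max_right _ _)
    (M := maxTwo n) (fun i _ => hn i)
    (fun i hi => le_maxTwo (Finset.ne_of_mem_erase hi) (ho i)) X
  rw [Finset.card_erase_of_mem (Finset.mem_univ _), Finset.card_univ, Fintype.card_fin,
    Nat.add_sub_cancel] at h2
  have h3 : ∏ l ∈ Finset.univ.erase o, sobNorm2 (s o) (proj2 (n l) (X l)) ≤
      ∏ l ∈ Finset.univ.erase o, sobNorm2 (max S 0) (proj2 (n l) (X l)) :=
    Finset.prod_le_prod (fun _ _ => sobNorm2_nonneg _ _)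
      fun _ _ => sobNorm2_mono ((hS o).trans (le_max_left _ _)) _
  refine (h o _).trans ?_
  rw [← Finset.mul_prod_erase _ _ (Finset.mem_univ o), sobNorm2_proj2 (hn o) (-ϱ) 0, sub_zero, h1]
  have h4 : 0 ≤ ∏ l ∈ Finset.univ.erase o, sobNorm2 (s o) (proj2 (n l) (X l)) :=
    prod_sobNorm2_nonneg _ _ _
  have h5 := h3.trans h2
  have h6 := sobNorm2_nonneg 0 (proj2 (n o) (X o))
  have h7 : (0 : ℝ) ≤ (n o : ℝ) ^ (-ϱ) := by positivity
  have h8 := (hK o).trans (le_max_left K 0)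
  generalize ∏ l ∈ Finset.univ.erase o, sobNorm2 (s o) (proj2 (n l) (X l)) = P at h4 h5 ⊢
  generalize ∏ l ∈ Finset.univ.erase o, sobNorm2 0 (proj2 (n l) (X l)) = Q at h5 ⊢
  calc C o * ((n o : ℝ) ^ (-ϱ) * sobNorm2 0 (proj2 (n o) (X o))) * P
      ≤ max K 0 * ((n o : ℝ) ^ (-ϱ) * sobNorm2 0 (proj2 (n o) (X o))) *
          ((maxTwo n : ℝ) ^ (q * max S 0) * Q) :=
        mul_le_mul (mul_le_mul_of_nonneg_right h8 (mul_nonneg h7 h6)) h5 h4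
          (mul_nonneg (le_max_right _ _) (mul_nonneg h7 h6))
    _ = _ := by ring

/-! ### Two-forms -/

/-- The block estimate and the momentum condition are automatic: the first because Sobolev and `L²`
norms are comparable on blocks, the second by translation invariance and `exists_signs`. -/
theorem isForm2_of_bounded {r : ℕ} {Λ : Form2 r} (symm : IsSymm Λ)
    (antisymm : ∀ (U : Fin r → Hinf2) (V W : Hinf2), Λ U V W = -Λ U W V)
    (bounded : ∃ s C : ℝ, 0 ≤ s ∧ 0 ≤ C ∧ ∀ (U : Fin r → Hinf2) (V W : Hinf2),
      ‖Λ U V W‖ ≤ C * (∏ i, sobNorm2 s (U i)) * sobNorm2 s V * sobNorm2 s W)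
    (translation : ∀ (ς : ℝ) (U : Fin r → Hinf2) (V W : Hinf2),
      Λ (fun i => trans2 ς (U i)) (trans2 ς V) (trans2 ς W) = Λ U V W)
    (real : ∀ (U : Fin r → Hinf2) (V W : Hinf2),
      (∀ i, IsRealPair (U i)) → IsRealPair V → IsRealPair W → (Λ U V W).im = 0) : IsForm2 Λ where
  symm := symm
  antisymm := antisymm
  bounded := by
    obtain ⟨s, C, -, -, h⟩ := bounded
    exact ⟨s, C, h⟩
  estimate := by
    obtain ⟨s, C, hs, hC, h⟩ := bounded
    refine ⟨(Finset.univ : Finset (Fin r)).card * s + s + s, C + 1,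
      add_nonneg (add_nonneg (mul_nonneg (Nat.cast_nonneg _) hs) hs) hs, by positivity,
      fun n k l U V W hn hk hl => (h _ _ _).trans ?_⟩
    set M := max (maxOne n) (max k l) with hM
    have hkM : (k : ℝ) ≤ M := by
      exact_mod_cast (le_max_left k l).trans (le_max_right _ _)
    have hlM : (l : ℝ) ≤ M := by
      exact_mod_cast (le_max_right k l).trans (le_max_right _ _)
    have hM0 : (0 : ℝ) < M := lt_of_lt_of_le (by exact_mod_cast hk) hkM
    have h1 := prod_proj2_le Finset.univ hs (M := M) (fun i _ => hn i)
      (fun i _ => (le_maxOne n i).trans (le_max_left _ _)) U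
    have h2 : sobNorm2 s (proj2 k V) ≤ (M : ℝ) ^ s * sobNorm2 0 (proj2 k V) := by
      rw [sobNorm2_proj2 hk s 0, sub_zero]
      exact mul_le_mul_of_nonneg_right (Real.rpow_le_rpow (by positivity) hkM hs)
        (sobNorm2_nonneg _ _)
    have h3 : sobNorm2 s (proj2 l W) ≤ (M : ℝ) ^ s * sobNorm2 0 (proj2 l W) := by
      rw [sobNorm2_proj2 hl s 0, sub_zero]
      exact mul_le_mul_of_nonneg_right (Real.rpow_le_rpow (by positivity) hlM hs)
        (sobNorm2_nonneg _ _)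
    have h4 : 0 ≤ ∏ i, sobNorm2 s (proj2 (n i) (U i)) := prod_sobNorm2_nonneg _ _ _
    have h5 : 0 ≤ ∏ i, sobNorm2 0 (proj2 (n i) (U i)) := prod_sobNorm2_nonneg _ _ _
    rw [Real.rpow_add hM0, Real.rpow_add hM0]
    have h6 := sobNorm2_nonneg s (proj2 k V)
    have h7 := sobNorm2_nonneg s (proj2 l W)
    have h8 := sobNorm2_nonneg 0 (proj2 k V)
    have h9 := sobNorm2_nonneg 0 (proj2 l W)
    generalize ∏ i, sobNorm2 s (proj2 (n i) (U i)) = P at *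
    generalize ∏ i, sobNorm2 0 (proj2 (n i) (U i)) = Q at *
    calc C * P * sobNorm2 s (proj2 k V) * sobNorm2 s (proj2 l W)
        ≤ (C + 1) * ((M : ℝ) ^ ((Finset.univ : Finset (Fin r)).card * s) * Q) *
          ((M : ℝ) ^ s * sobNorm2 0 (proj2 k V)) * ((M : ℝ) ^ s * sobNorm2 0 (proj2 l W)) := by
          gcongr; linarith
      _ = _ := by ring
  momentum n k l U V W hn hk hl hne := by
    set A : MultilinearMap ℂ (fun _ : Fin (r + 1 + 1) => Hinf2) ℂ :=
      MultilinearMap.uncurryRight (M := fun _ => Hinf2)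
        (MultilinearMap.uncurryRight (M := fun _ => Hinf2) Λ) with hA
    have hAapp : ∀ X, A X = Λ (Fin.init (Fin.init X)) (Fin.init X (Fin.last r))
      (X (Fin.last (r + 1))) := fun _ => rfl
    obtain ⟨ε, hε⟩ := exists_signs (A := A) (n := Fin.snoc (Fin.snoc n k) l)
      (X := Fin.snoc (Fin.snoc U V) W)
      (fun ς X => by rw [hAapp, hAapp, ← translation ς (Fin.init (Fin.init X))]; rfl)
      (fun i => by
        induction i using Fin.lastCases with
        | last => simpa using hl
        | cast i =>
          induction i using Fin.lastCases with
          | last => simpa using hk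
          | cast i => simpa using hn i)
      (by
        rw [hAapp]
        simpa [Fin.init_def] using hne)
    refine ⟨fun i => ε i.castSucc.castSucc, ε (Fin.last r).castSucc, ε (Fin.last (r + 1)), ?_⟩
    rw [Fin.sum_univ_castSucc, Fin.sum_univ_castSucc] at hε
    simpa only [Fin.snoc_castSucc, Fin.snoc_last] using hε
  translation := translation
  real := real

/-! ### The homogeneous components of a pulled back symplectic form -/

/-- The component of degree `q` of the pullback of `Ω_c` by the map with components `D`. -/
def omegaComp (D : (q : ℕ) → VF (q + 1)) (q : ℕ) (U V W : Hinf2) : ℂ :=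
  ∑ p ∈ Finset.HasAntidiagonal.antidiagonal q, omegaL (der (D p.1) U V) (der (D p.2) U W)

theorem omegaComp_swap (D : (q : ℕ) → VF (q + 1)) (q : ℕ) (U V W : Hinf2) :
    omegaComp D q U V W = -omegaComp D q U W V := by
  rw [omegaComp, omegaComp, ← Finset.sum_neg_distrib,
    ← Finset.Nat.sum_antidiagonal_swap]
  exact Finset.sum_congr rfl fun p _ => omegaL_antisymm _ _

/-- Sorting the products by total degree gives whole antidiagonals, because the terms beyond L
vanish. -/
theorem omegaL_sum_sum {L : ℕ} {x y : ℕ → Hinf2} (hx : ∀ q, L < q → x q = 0)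
    (hy : ∀ q, L < q → y q = 0) :
    omegaL (∑ q ∈ Finset.range (L + 1), x q) (∑ q ∈ Finset.range (L + 1), y q) =
      ∑ q ∈ Finset.range (2 * L + 1), ∑ p ∈ Finset.HasAntidiagonal.antidiagonal q, omegaL (x p.1) (y p.2) := by
  simp only [map_sum, LinearMap.sum_apply]
  rw [Finset.sum_comm, ← Finset.sum_product',
    ← Finset.sum_fiberwise_of_maps_to (g := fun p : ℕ × ℕ => p.1 + p.2)
      (t := Finset.range (2 * L + 1)) (fun p hp => by
        rw [Finset.mem_product, Finset.mem_range, Finset.mem_range] at hp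
        rw [Finset.mem_range]; omega)]
  refine Finset.sum_congr rfl fun q _ => Finset.sum_subset (fun p hp => ?_) fun p hp hp' => ?_
  · rw [Finset.mem_filter] at hp
    exact Finset.HasAntidiagonal.mem_antidiagonal.2 hp.2
  · rw [Finset.HasAntidiagonal.mem_antidiagonal] at hp
    simp only [Finset.mem_filter, Finset.mem_product, Finset.mem_range, hp, and_true, not_and_or,
      not_lt] at hp'
    rcases hp' with h | h
    · rw [hx p.1 (by omega), map_zero, LinearMap.zero_apply]
    · rw [hy p.2 (by omega), map_zero]

theorem omegaL_polyDer {L : ℕ} {D : (q : ℕ) → VF (q + 1)} (hD : ∀ q, L < q → D q = 0)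
    (U V W : Hinf2) : omegaL (polyDer L D U V) (polyDer L D U W) =
      ∑ q ∈ Finset.range (2 * L + 1), omegaComp D q U V W :=
  omegaL_sum_sum (fun q hq => by rw [hD q hq, der_zero]) fun q hq => by rw [hD q hq, der_zero]

theorem der_smul_left {q : ℕ} {F : VF (q + 1)} (hF : IsSymm F) (c : ℂ) (U V : Hinf2) :
    der F (c • U) V = c ^ q • der F U V := by
  rw [hF.der_eq, hF.der_eq, smul_comm]
  congr 1
  have h := (MultilinearMap.curryRight F).map_smul_univ (fun _ => c) (fun _ => U)
  rw [Finset.prod_const, Finset.card_univ, Fintype.card_fin] at h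
  exact congrArg (fun f => f V) h

theorem omegaComp_smul {D : (q : ℕ) → VF (q + 1)} (hD : ∀ q, IsSymm (D q)) (q : ℕ) (c : ℂ)
    (U V W : Hinf2) : omegaComp D q (c • U) V W = c ^ q * omegaComp D q U V W := by
  rw [omegaComp, omegaComp, Finset.mul_sum]
  refine Finset.sum_congr rfl fun p hp => ?_
  rw [der_smul_left (hD _), der_smul_left (hD _), map_smul, map_smul, LinearMap.smul_apply,
    smul_eq_mul, smul_eq_mul, ← mul_assoc, ← pow_add, add_comm, Finset.HasAntidiagonal.mem_antidiagonal.1 hp]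

theorem IsNice.trans_der {n : ℕ} {F : VF n} (hF : IsNice F) (ς : ℝ) (U V : Hinf2) :
    der F (trans2 ς U) (trans2 ς V) = trans2 ς (der F U V) := by
  have h := map_sum (transL ς) (fun i => F (Function.update (fun _ => U) i V)) Finset.univ
  simp only [transL_apply] at h
  rw [der, der, h]
  refine Finset.sum_congr rfl fun i _ => ?_
  rw [← hF.trans]
  congr 1
  funext j
  by_cases h' : j = i
  · subst h'; simp
  · simp [h']

theorem IsNice.real_der {n : ℕ} {F : VF n} (hF : IsNice F) {U V : Hinf2} (hU : IsRealPair U)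
    (hV : IsRealPair V) : IsRealPair (der F U V) := by
  refine IsRealPair.sum fun i _ => hF.real _ fun j => ?_
  by_cases h' : j = i
  · subst h'; simpa using hV
  · simpa [h'] using hU

theorem IsNice.diag_le {n : ℕ} {F : VF n} (hF : IsNice F) (s : ℝ) :
    ∃ s' C : ℝ, 0 ≤ C ∧ ∀ U, sobNorm2 s (F fun _ => U) ≤ C * sobNorm2 s' U ^ n := by
  obtain ⟨s', C, hC, h⟩ := hF.bdd s
  refine ⟨s', C, hC, fun U => (h _).trans (le_of_eq ?_)⟩
  rw [Finset.prod_const, Finset.card_univ, Fintype.card_fin]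

theorem IsNice.der_le {q : ℕ} {F : VF (q + 1)} (hF : IsNice F) (hs : IsSymm F) (s : ℝ) :
    ∃ s' C : ℝ, 0 ≤ C ∧ ∀ U V, sobNorm2 s (der F U V) ≤ C * sobNorm2 s' U ^ q * sobNorm2 s' V := by
  obtain ⟨s', C, hC, h⟩ := hF.bdd s
  refine ⟨s', ‖(q : ℂ) + 1‖ * C, mul_nonneg (norm_nonneg _) hC, fun U V => ?_⟩
  rw [hs.der_eq, sobNorm2_smul, mul_assoc, mul_assoc]
  refine mul_le_mul_of_nonneg_left ((h _).trans (le_of_eq ?_)) (norm_nonneg _)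
  rw [Fin.prod_univ_castSucc]
  simp

theorem exists_common_le {P : ℕ → ℝ → ℝ → Prop}
    (hmono : ∀ q s C s' C', s ≤ s' → C ≤ C' → P q s C → P q s' C') (h : ∀ q, ∃ s C, P q s C)
    (k : ℕ) : ∃ s C, 0 ≤ s ∧ 0 ≤ C ∧ ∀ q ≤ k, P q s C := by
  choose s C hP using h
  obtain ⟨S, hS⟩ := exists_forall_le_real fun q : Fin (k + 1) => s q
  obtain ⟨K, hK⟩ := exists_forall_le_real fun q : Fin (k + 1) => C q
  exact ⟨max S 0, max K 0, le_max_right _ _, le_max_right _ _, fun q hq => hmono _ _ _ _ _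
    ((hS ⟨q, by omega⟩).trans (le_max_left _ _)) ((hK ⟨q, by omega⟩).trans (le_max_left _ _))
    (hP q)⟩

theorem omegaComp_trans {D : (q : ℕ) → VF (q + 1)} (hn : ∀ q, IsNice (D q)) (q : ℕ) (ς : ℝ)
    (U V W : Hinf2) : omegaComp D q (trans2 ς U) (trans2 ς V) (trans2 ς W) = omegaComp D q U V W :=
  Finset.sum_congr rfl fun p _ => by
    rw [(hn _).trans_der, (hn _).trans_der, omegaL_trans2]

theorem im_sum_eq_zero {ι : Type*} {T : Finset ι} {f : ι → ℂ} (h : ∀ i ∈ T, (f i).im = 0) :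
    (∑ i ∈ T, f i).im = 0 := by
  rw [Complex.im_sum, Finset.sum_eq_zero h]

theorem omegaComp_real {D : (q : ℕ) → VF (q + 1)} (hn : ∀ q, IsNice (D q)) (q : ℕ) {U V W : Hinf2}
    (hU : IsRealPair U) (hV : IsRealPair V) (hW : IsRealPair W) :
    (omegaComp D q U V W).im = 0 :=
  im_sum_eq_zero fun _ _ => omegaL_im_of_real ((hn _).real_der hU hV) ((hn _).real_der hU hW)

theorem norm_omegaL_le_mul {x y : Hinf2} {a b : ℝ} (hx : sobNorm2 0 x ≤ a) (hy : sobNorm2 0 y ≤ b) :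
    ‖omegaL x y‖ ≤ a * b := by
  refine (norm_omegaL_le 0 x y).trans ?_
  rw [neg_zero]
  exact mul_le_mul hx hy (sobNorm2_nonneg _ _) ((sobNorm2_nonneg _ _).trans hx)

theorem exists_der_le {D : (q : ℕ) → VF (q + 1)} (hs : ∀ q, IsSymm (D q)) (hn : ∀ q, IsNice (D q))
    (k : ℕ) : ∃ s C : ℝ, 0 ≤ s ∧ 0 ≤ C ∧ ∀ q ≤ k,
      (∀ U V, sobNorm2 0 (der (D q) U V) ≤ C * sobNorm2 s U ^ q * sobNorm2 s V) ∧
      ∀ U, sobNorm2 0 (D q fun _ => U) ≤ C * sobNorm2 s U ^ (q + 1) := by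
  refine exists_common_le (P := fun q s C =>
    (∀ U V, sobNorm2 0 (der (D q) U V) ≤ C * sobNorm2 s U ^ q * sobNorm2 s V) ∧
      ∀ U, sobNorm2 0 (D q fun _ => U) ≤ C * sobNorm2 s U ^ (q + 1)) ?_ (fun q => ?_) k
  · rintro q s C s' C' hss hCC ⟨h1, h2⟩
    have hm : ∀ (n : ℕ) U, C * sobNorm2 s U ^ n ≤ max C' 0 * sobNorm2 s' U ^ n := fun n U =>
      mul_le_mul (hCC.trans (le_max_left _ _)) (pow_le_pow_left₀ (sobNorm2_nonneg _ _)
        (sobNorm2_mono hss U) n) (pow_nonneg (sobNorm2_nonneg _ _) _) (le_max_right _ _)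
    rcases le_or_gt 0 C' with h0 | h0
    · rw [max_eq_left h0] at hm
      exact ⟨fun U V => (h1 U V).trans (mul_le_mul (hm q U) (sobNorm2_mono hss V)
        (sobNorm2_nonneg _ _) (mul_nonneg h0 (pow_nonneg (sobNorm2_nonneg _ _) _))),
        fun U => (h2 U).trans (hm _ U)⟩
    -- A negative constant would force all norms to vanish; this degenerate case appears because
    -- monotonicity in the constant is required without a sign.
    · have hmode : ∀ U, sobNorm2 s U = 0 := fun U => by
        by_contra hne
        have h3 := h2 U
        have h4 := sobNorm2_nonneg 0 (D q fun _ => U)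
        have h5 : 0 < sobNorm2 s U := lt_of_le_of_ne (sobNorm2_nonneg _ _) (Ne.symm hne)
        have h6 : C * sobNorm2 s U ^ (q + 1) < 0 :=
          mul_neg_of_neg_of_pos (by linarith) (by positivity)
        linarith
      have hz : ∀ U : Hinf2, U = 0 := fun U => eq_zero_of_sobNorm2_eq_zero (hmode U)
      exact ⟨fun U V => by rw [hz V, hz (der _ _ _)]; simp [sobNorm2_zero],
        fun U => by rw [hz U, hz (D q _)]; simp [sobNorm2_zero]⟩
  · obtain ⟨s, C, hC, h1⟩ := (hn q).der_le (hs q) 0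
    obtain ⟨s', C', hC', h2⟩ := (hn q).diag_le 0
    refine ⟨max s s', max C C', fun U V => (h1 U V).trans ?_, fun U => (h2 U).trans ?_⟩
    · exact mul_le_mul (mul_le_mul (le_max_left _ _) (pow_le_pow_left₀ (sobNorm2_nonneg _ _)
        (sobNorm2_mono (le_max_left _ _) U) q) (pow_nonneg (sobNorm2_nonneg _ _) _)
        (hC.trans (le_max_left _ _))) (sobNorm2_mono (le_max_left _ _) V) (sobNorm2_nonneg _ _)
        (mul_nonneg (hC.trans (le_max_left _ _)) (pow_nonneg (sobNorm2_nonneg _ _) _))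
    · exact mul_le_mul (le_max_right _ _) (pow_le_pow_left₀ (sobNorm2_nonneg _ _)
        (sobNorm2_mono (le_max_right _ _) U) _) (pow_nonneg (sobNorm2_nonneg _ _) _)
        (hC'.trans (le_max_right _ _))

theorem omegaComp_le {D : (q : ℕ) → VF (q + 1)} (hs : ∀ q, IsSymm (D q)) (hn : ∀ q, IsNice (D q))
    (k : ℕ) : ∃ s C : ℝ, 0 ≤ s ∧ 0 ≤ C ∧ ∀ U V W,
      ‖omegaComp D k U V W‖ ≤ C * sobNorm2 s U ^ k * sobNorm2 s V * sobNorm2 s W := by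
  obtain ⟨s, C, hs0, hC, h⟩ := exists_der_le hs hn k
  refine ⟨s, (Finset.HasAntidiagonal.antidiagonal k).card * (C * C), hs0, by positivity, fun U V W => ?_⟩
  refine (norm_sum_le_of_le _ (f := fun p : ℕ × ℕ => omegaL (der (D p.1) U V) (der (D p.2) U W))
    (n := fun _ => C * C * sobNorm2 s U ^ k * sobNorm2 s V * sobNorm2 s W)
    fun p hp => ?_).trans (le_of_eq ?_)
  · rw [Finset.HasAntidiagonal.mem_antidiagonal] at hp
    refine (norm_omegaL_le_mul ((h p.1 (by omega)).1 U V) ((h p.2 (by omega)).1 U W)).trans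
      (le_of_eq ?_)
    rw [← hp, pow_add]; ring
  · rw [Finset.sum_const, nsmul_eq_mul]; ring

/-- Evaluation of a multilinear map valued in bilinear forms. -/
def evalForm {r : ℕ} (Λ : Form2 r) (V W : Hinf2) : MultilinearMap ℂ (fun _ : Fin r => Hinf2) ℂ :=
  ((LinearMap.applyₗ W).comp (LinearMap.applyₗ V : (Hinf2 →ₗ[ℂ] Hinf2 →ₗ[ℂ] ℂ) →ₗ[ℂ] _)
    ).compMultilinearMap Λ

theorem evalForm_apply {r : ℕ} (Λ : Form2 r) (V W : Hinf2) (X : Fin r → Hinf2) :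
    evalForm Λ V W X = Λ X V W := rfl

theorem isSymm_evalForm {r : ℕ} {Λ : Form2 r} (h : IsSymm Λ) (V W : Hinf2) :
    IsSymm (evalForm Λ V W) := fun π X => by
  rw [evalForm_apply, evalForm_apply, h]

theorem isSymm_comp_trans {r : ℕ} {E : Type*} [AddCommGroup E] [Module ℂ E]
    {A : MultilinearMap ℂ (fun _ : Fin r => Hinf2) E} (h : IsSymm A) (ς : ℝ) :
    IsSymm (A.compLinearMap fun _ => transL ς) := fun π X => by
  rw [MultilinearMap.compLinearMap_apply, MultilinearMap.compLinearMap_apply]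
  exact h π fun i => transL ς (X i)

/-- The form `(U, V, W) ↦ Ω_c(F(U, V), G(U, W))`. -/
def pairForm {a b : ℕ} (F : VF (a + 1)) (G : VF (b + 1)) : Form2 (a + b) :=
  ((TensorProduct.lift (LinearMap.mk₂ ℂ (fun f g => omegaL.compl₁₂ f g)
      (fun _ _ _ => LinearMap.ext₂ fun _ _ => by simp)
      (fun _ _ _ => LinearMap.ext₂ fun _ _ => by simp)
      (fun _ _ _ => LinearMap.ext₂ fun _ _ => by simp)
      (fun _ _ _ => LinearMap.ext₂ fun _ _ => by simp)) :
    TensorProduct ℂ (Hinf2 →ₗ[ℂ] Hinf2) (Hinf2 →ₗ[ℂ] Hinf2) →ₗ[ℂ] _).compMultilinearMap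
    ((MultilinearMap.curryRight F).domCoprod (MultilinearMap.curryRight G))).domDomCongr
      finSumFinEquiv

theorem pairForm_diag {a b : ℕ} (F : VF (a + 1)) (G : VF (b + 1)) (U V W : Hinf2) :
    pairForm F G (fun _ => U) V W = omegaL (F (Fin.snoc (fun _ : Fin a => U) V))
      (G (Fin.snoc (fun _ : Fin b => U) W)) := rfl

/-- `omegaComp` is given on the diagonal in U. Symmetrized pairings supply a multilinear extension,
and each property of a 2-form is checked on the diagonal with V and W frozen, then polarized. -/
theorem exists_omegaComp_form {D : (q : ℕ) → VF (q + 1)} (hs : ∀ q, IsSymm (D q))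
    (hn : ∀ q, IsNice (D q)) (k : ℕ) :
    ∃ Λ : Form2 k, IsForm2 Λ ∧ ∀ U V W, Λ (fun _ => U) V W = omegaComp D k U V W := by
  -- The factors `p.1.1 + 1` and `p.1.2 + 1` turn `F(U, …, U, V)` into the derivative, by
  -- `IsSymm.der_eq`.
  set Λ : Form2 k := symmetrize (∑ p ∈ (Finset.HasAntidiagonal.antidiagonal k).attach,
    (((p.1.1 : ℂ) + 1) * ((p.1.2 : ℂ) + 1)) • (pairForm (D p.1.1) (D p.1.2)).domDomCongr
      (finCongr (Finset.HasAntidiagonal.mem_antidiagonal.1 p.2))) with hΛ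
  have hdiag : ∀ U V W, Λ (fun _ => U) V W = omegaComp D k U V W := by
    intro U V W
    rw [hΛ, symmetrize_diag, sum_apply, LinearMap.sum_apply, LinearMap.sum_apply, omegaComp,
      ← Finset.sum_attach (Finset.HasAntidiagonal.antidiagonal k)]
    refine Finset.sum_congr rfl fun p _ => ?_
    rw [(hs _).der_eq, (hs _).der_eq, map_smul, map_smul, LinearMap.smul_apply, smul_apply,
      MultilinearMap.domDomCongr_apply, LinearMap.smul_apply, LinearMap.smul_apply, pairForm_diag,
      smul_smul, mul_comm]
  have hsymm : IsSymm Λ := isSymm_symmetrize _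
  refine ⟨Λ, isForm2_of_bounded hsymm (fun U V W => ?_) ?_ (fun ς U V W => ?_) fun U V W hU hV hW => ?_,
    hdiag⟩
  · have h : evalForm Λ V W = ((-1 : ℂ) • evalForm Λ W V) := by
      refine (isSymm_evalForm hsymm V W).eq_of_diag (fun π X => ?_) fun U => ?_
      · rw [smul_apply, smul_apply, isSymm_evalForm hsymm W V]
      · rw [smul_apply, evalForm_apply, evalForm_apply, hdiag, hdiag, omegaComp_swap]
        simp
    have h' := congrArg (fun A => A U) h
    simpa [evalForm_apply] using h'
  · obtain ⟨s, C, hs0, hC, h⟩ := omegaComp_le hs hn k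
    obtain ⟨c, hc, hb⟩ := exists_bound_of_diag k
    refine ⟨s, c * C, hs0, mul_nonneg hc hC, fun U V W => ?_⟩
    have := hb _ (isSymm_evalForm hsymm V W) s (C * sobNorm2 s V * sobNorm2 s W)
      (mul_nonneg (mul_nonneg hC (sobNorm2_nonneg _ _)) (sobNorm2_nonneg _ _))
      (fun U => by
        rw [evalForm_apply, hdiag]
        exact (h U V W).trans (le_of_eq (by ring))) U
    exact this.trans (le_of_eq (by ring))
  · have h : (evalForm Λ (trans2 ς V) (trans2 ς W)).compLinearMap (fun _ => transL ς) =
        evalForm Λ V W := by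
      refine (isSymm_comp_trans (isSymm_evalForm hsymm _ _) ς).eq_of_diag
        (isSymm_evalForm hsymm V W) fun U => ?_
      rw [MultilinearMap.compLinearMap_apply, evalForm_apply, evalForm_apply, hdiag, hdiag]
      exact omegaComp_trans hn k ς U V W
    exact congrArg (fun A => A U) h
  · exact (isSymm_evalForm hsymm V W).mem_of_diag (P := IsRealPair) (Q := fun z : ℂ => z.im = 0)
      isRealPair_zero (fun _ _ => IsRealPair.add) rfl
      (fun x y hx hy => by rw [Complex.add_im, hx, hy, add_zero])
      (fun r x hx => by simp [hx])
      (fun U hU => by rw [evalForm_apply, hdiag]; exact omegaComp_real hn k hU hV hW) U hU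

/-! ### An explicit primitive of the pulled back symplectic form -/

/-- `½ ∑ Ω_c(D_a(U), d_U D_b(U)[V])` over `a + b = k`. -/
def primComp (D : (q : ℕ) → VF (q + 1)) (k : ℕ) (U V : Hinf2) : ℂ :=
  ∑ p ∈ Finset.HasAntidiagonal.antidiagonal k,
    (1 / 2) * omegaL (D p.1 fun _ => U) (der (D p.2) U V)

/-- The form `(U, V) ↦ Ω_c(F(U), G(U, V))`. -/
def primForm {a b : ℕ} (F : VF (a + 1)) (G : VF (b + 1)) :
    MultilinearMap ℂ (fun _ : Fin (a + 1) ⊕ Fin b => Hinf2) (Hinf2 →ₗ[ℂ] ℂ) :=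
  ((TensorProduct.lift (LinearMap.mk₂ ℂ (fun x g => (omegaL x).comp g)
      (fun _ _ _ => LinearMap.ext fun _ => by simp)
      (fun _ _ _ => LinearMap.ext fun _ => by simp)
      (fun _ _ _ => LinearMap.ext fun _ => by simp)
      (fun _ _ _ => LinearMap.ext fun _ => by simp)) :
    TensorProduct ℂ Hinf2 (Hinf2 →ₗ[ℂ] Hinf2) →ₗ[ℂ] _).compMultilinearMap
    (F.domCoprod (MultilinearMap.curryRight G)))

theorem primForm_apply {a b : ℕ} (F : VF (a + 1)) (G : VF (b + 1))
    (X : Fin (a + 1) ⊕ Fin b → Hinf2) (V : Hinf2) : primForm F G X V =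
      omegaL (F fun i => X (Sum.inl i)) (G (Fin.snoc (fun i : Fin b => X (Sum.inr i)) V)) := rfl

theorem der_primForm {a b : ℕ} (F : VF (a + 1)) (G : VF (b + 1)) (U W V : Hinf2) :
    der (primForm F G) U W V = omegaL (der F U W) (G (Fin.snoc (fun _ : Fin b => U) V)) +
      omegaL (F fun _ => U) (∑ i : Fin b, G (Fin.snoc (Function.update (fun _ => U) i W) V)) := by
  rw [der, Fintype.sum_sum_type, LinearMap.add_apply, LinearMap.sum_apply, LinearMap.sum_apply,
    der, map_sum, map_sum, LinearMap.sum_apply]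
  congr 1
  · refine Finset.sum_congr rfl fun i _ => ?_
    rw [primForm_apply]
    congr 2
    · congr 1
      funext j
      by_cases h : j = i
      · subst h; simp
      · simp [h]
  · refine Finset.sum_congr rfl fun i _ => ?_
    rw [primForm_apply]
    congr 1
    congr 1
    congr 1
    funext j
    by_cases h : j = i
    · subst h; simp
    · simp [h]

/-- Symmetry of second derivatives; it cancels the second-order terms in the exterior derivative of
the primitive. -/
theorem IsSymm.sum_update_snoc {b : ℕ} {G : VF (b + 1)} (hG : IsSymm G) (U V W : Hinf2) :
    ∑ i : Fin b, G (Fin.snoc (Function.update (fun _ => U) i W) V) =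
      ∑ i : Fin b, G (Fin.snoc (Function.update (fun _ => U) i V) W) := by
  refine Finset.sum_congr rfl fun i _ => ?_
  rw [← hG (Equiv.swap i.castSucc (Fin.last b))
    (Fin.snoc (Function.update (fun _ => U) i V) W)]
  congr 1
  funext j
  induction j using Fin.lastCases with
  | last => simp
  | cast j =>
    by_cases h : j = i
    · subst h; simp
    · rw [Equiv.swap_apply_of_ne_of_ne (fun h' => h (Fin.castSucc_injective _ h'))
        (Fin.castSucc_ne_last _)]
      simp [h]

section Primitive

open Finset.HasAntidiagonal

theorem primComp_le {D : (q : ℕ) → VF (q + 1)} (hs : ∀ q, IsSymm (D q)) (hn : ∀ q, IsNice (D q))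
    (k : ℕ) : ∃ s C : ℝ, 0 ≤ s ∧ 0 ≤ C ∧ ∀ U V,
    ‖primComp D k U V‖ ≤ C * sobNorm2 s U ^ (k + 1) * sobNorm2 s V := by
  obtain ⟨s, C, hs0, hC, h⟩ := exists_der_le hs hn k
  refine ⟨s, (antidiagonal k).card * (1 / 2 * (C * C)), hs0, by positivity, fun U V => ?_⟩
  refine (norm_sum_le_of_le _ (f := fun p : ℕ × ℕ =>
      (1 / 2) * omegaL (D p.1 fun _ => U) (der (D p.2) U V))
    (n := fun _ => 1 / 2 * (C * C) * sobNorm2 s U ^ (k + 1) * sobNorm2 s V)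
    fun p hp => ?_).trans (le_of_eq ?_)
  · rw [mem_antidiagonal] at hp
    rw [norm_mul]
    have h1 := norm_omegaL_le_mul ((h p.1 (by omega)).2 U) ((h p.2 (by omega)).1 U V)
    have h2 : ‖(1 / 2 : ℂ)‖ = 1 / 2 := by norm_num
    rw [h2]
    refine (mul_le_mul_of_nonneg_left h1 (by norm_num)).trans (le_of_eq ?_)
    rw [← hp, show p.1 + p.2 + 1 = (p.1 + 1) + p.2 by ring, pow_add _ (p.1 + 1)]; ring
  · rw [Finset.sum_const, nsmul_eq_mul]; ring

theorem primForm_index {k : ℕ} {p : ℕ × ℕ} (hp : p ∈ antidiagonal k) : p.1 + 1 + p.2 = k + 1 := by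
  rw [mem_antidiagonal] at hp; omega

/-- Ω_c is the differential of the one-form ½Ω_c(U, ·), and pullback commutes with differentiation:
½Ω_c(D(U), dD(U)[V]) has the pulled back form as its differential. `H` is its part of index k, and
the factor k + 1 comes from differentiating along the diagonal. -/
theorem exists_primitive {D : (q : ℕ) → VF (q + 1)} (hs : ∀ q, IsSymm (D q)) (hn : ∀ q, IsNice (D q))
    (k : ℕ) :
    ∃ H : MultilinearMap ℂ (fun _ : Fin (k + 1) => Hinf2) (Hinf2 →ₗ[ℂ] ℂ), IsSymm H ∧
      (∃ s C : ℝ, 0 ≤ s ∧ 0 ≤ C ∧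
        ∀ X V, ‖H X V‖ ≤ C * (∏ i, sobNorm2 s (X i)) * sobNorm2 s V) ∧
      (∀ (ς : ℝ) X V, H (fun i => trans2 ς (X i)) (trans2 ς V) = H X V) ∧
      (∀ X V, (∀ i, IsRealPair (X i)) → IsRealPair V → (H X V).im = 0) ∧
      ∀ U V W, ((k : ℂ) + 1) * (H (Fin.snoc (fun _ : Fin k => U) W) V -
        H (Fin.snoc (fun _ : Fin k => U) V) W) = -omegaComp D k U V W := by
  set H : MultilinearMap ℂ (fun _ : Fin (k + 1) => Hinf2) (Hinf2 →ₗ[ℂ] ℂ) :=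
    symmetrize (∑ p ∈ (antidiagonal k).attach, ((1 / 2 : ℂ) * ((p.1.2 : ℂ) + 1)) •
      (primForm (D p.1.1) (D p.1.2)).domDomCongr
        (finSumFinEquiv.trans (finCongr (primForm_index p.2)))) with hH
  have hdiag : ∀ U V, H (fun _ => U) V = primComp D k U V := by
    intro U V
    rw [hH, symmetrize_diag, sum_apply, LinearMap.sum_apply, primComp,
      ← Finset.sum_attach (antidiagonal k)]
    refine Finset.sum_congr rfl fun p _ => ?_
    rw [(hs _).der_eq, map_smul, smul_apply, MultilinearMap.domDomCongr_apply,
      LinearMap.smul_apply, primForm_apply, smul_eq_mul, smul_eq_mul, mul_assoc]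
  have hder : ∀ U V W, der H U W V = ∑ p ∈ antidiagonal k, (1 / 2 : ℂ) *
      (omegaL (der (D p.1) U W) (der (D p.2) U V) + ((p.2 : ℂ) + 1) * omegaL (D p.1 fun _ => U)
        (∑ i : Fin p.2, D p.2 (Fin.snoc (Function.update (fun _ => U) i W) V))) := by
    intro U V W
    rw [hH, der_symmetrize, der_sum, LinearMap.sum_apply, ← Finset.sum_attach (antidiagonal k)]
    refine Finset.sum_congr rfl fun p _ => ?_
    rw [der_smul, der_domDomCongr, LinearMap.smul_apply, der_primForm, (hs p.1.2).der_eq, map_smul,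
      smul_eq_mul, smul_eq_mul]
    ring
  have hsymm : IsSymm H := isSymm_symmetrize _
  have hev : ∀ V, IsSymm ((LinearMap.applyₗ V).compMultilinearMap H) := fun V π X => by
    change H _ V = H _ V
    rw [hsymm]
  refine ⟨H, hsymm, ?_, fun ς X V => ?_, fun X V hX hV => ?_, fun U V W => ?_⟩
  · obtain ⟨s, C, hs0, hC, h⟩ := primComp_le hs hn k
    obtain ⟨c, hc, hb⟩ := exists_bound_of_diag (k + 1)
    refine ⟨s, c * C, hs0, mul_nonneg hc hC, fun X V => ?_⟩
    have := hb _ (hev V) s (C * sobNorm2 s V) (mul_nonneg hC (sobNorm2_nonneg _ _))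
      (fun U => by
        change ‖H _ V‖ ≤ _
        rw [hdiag]
        exact (h U V).trans (le_of_eq (by ring))) X
    exact this.trans (le_of_eq (by ring))
  · have h : ((LinearMap.applyₗ (trans2 ς V)).compMultilinearMap H).compLinearMap
        (fun _ => transL ς) = (LinearMap.applyₗ V).compMultilinearMap H := by
      refine (isSymm_comp_trans (hev _) ς).eq_of_diag (hev V) fun U => ?_
      change H (fun _ => trans2 ς U) (trans2 ς V) = H (fun _ => U) V
      rw [hdiag, hdiag]
      refine Finset.sum_congr rfl fun p _ => ?_
      rw [(hn _).trans_der, (hn _).trans, omegaL_trans2]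
    exact congrArg (fun A => A X) h
  · refine (hev V).mem_of_diag (P := IsRealPair) (Q := fun z : ℂ => z.im = 0)
      isRealPair_zero (fun _ _ => IsRealPair.add) rfl
      (fun x y hx hy => by rw [Complex.add_im, hx, hy, add_zero])
      (fun r x hx => by simp [hx]) (fun U hU => ?_) X hX
    change (H _ V).im = 0
    rw [hdiag]
    refine im_sum_eq_zero fun p _ => ?_
    have h1 := omegaL_im_of_real ((hn p.1).real _ fun _ => hU) ((hn p.2).real_der hU hV)
    have h2 : (1 / 2 : ℂ) = ((1 / 2 : ℝ) : ℂ) := by push_cast; rfl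
    rw [h2, Complex.im_ofReal_mul, h1, mul_zero]
  · have e : ∀ V W, ((k : ℂ) + 1) * H (Fin.snoc (fun _ : Fin k => U) W) V = der H U W V := by
      intro V W
      rw [hsymm.der_eq, LinearMap.smul_apply, smul_eq_mul]
    rw [mul_sub, e, e, hder, hder, ← Finset.sum_sub_distrib]
    have h1 : ∑ p ∈ antidiagonal k, omegaL (der (D p.1) U W) (der (D p.2) U V) =
        -omegaComp D k U V W := by
      rw [omegaComp_swap, neg_neg]; rfl
    have h2 : ∑ p ∈ antidiagonal k, omegaL (der (D p.1) U V) (der (D p.2) U W) =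
        omegaComp D k U V W := rfl
    have h3 : -omegaComp D k U V W = (1 / 2) * (-omegaComp D k U V W) -
        (1 / 2) * omegaComp D k U V W := by ring
    rw [h3]
    nth_rw 1 [← h1]
    rw [← h2, Finset.mul_sum, Finset.mul_sum, ← Finset.sum_sub_distrib]
    refine Finset.sum_congr rfl fun p _ => ?_
    rw [(hs p.2).sum_update_snoc U V W]
    ring

/-- A smooth component of the pulled back form is removed by a regularizing vector field. -/
theorem exists_correction_of_omegaComp {D : (q : ℕ) → VF (q + 1)} (hs : ∀ q, IsSymm (D q)) (hn : ∀ q, IsNice (D q))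
    (k : ℕ)
    (hω : ∀ s : ℝ, ∃ s' C : ℝ, 0 ≤ C ∧ ∀ U V W, ‖omegaComp D k U V W‖ ≤
      C * sobNorm2 s' U ^ k * sobNorm2 (-s) V * sobNorm2 (-s) W) :
    ∃ G : VF (k + 1), IsSymm G ∧ IsNice G ∧ IsRegularizing G ∧ ∀ U V W,
      omegaL (der G U V) W + omegaL V (der G U W) = -omegaComp D k U V W := by
  obtain ⟨H, hsymm, hbdd, htrans, hreal, hH⟩ := exists_primitive hs hn k
  have hk : (k : ℂ) + 1 ≠ 0 := by exact_mod_cast k.succ_ne_zero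
  -- The hypothesis holds on the diagonal in U; polarization with V and W frozen gives it for all
  -- `Y`. The factor k + 1 has modulus at least one and can be dropped.
  have hpair : ∀ s : ℝ, ∃ s' C : ℝ, 0 ≤ C ∧ ∀ (Y : Fin k → Hinf2) V W,
      ‖H (Fin.snoc Y W) V - H (Fin.snoc Y V) W‖ ≤
        C * ((∏ i, sobNorm2 s' (Y i)) * sobNorm2 (-s) W * sobNorm2 (-s) V) := by
    intro s
    obtain ⟨s', C, hC, h⟩ := hω s
    obtain ⟨c, hc, hb⟩ := exists_bound_of_diag k
    refine ⟨s', c * C, mul_nonneg hc hC, fun Y V W => ?_⟩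
    set J : Form2 k := MultilinearMap.curryRight H with hJ
    have hJs : IsSymm J := fun π X => by
      refine LinearMap.ext fun V => ?_
      change H _ = H _
      rw [← hsymm (extendPerm π) (Fin.snoc X V)]
      congr 1
      funext i
      induction i using Fin.lastCases with
      | last => simp [extendPerm]
      | cast i => simp [extendPerm]
    have hs2 : IsSymm (evalForm J W V - evalForm J V W) := fun π X => by
      rw [sub_apply, sub_apply, isSymm_evalForm hJs, isSymm_evalForm hJs]
    have := hb _ hs2 s' (C * sobNorm2 (-s) V * sobNorm2 (-s) W)
      (mul_nonneg (mul_nonneg hC (sobNorm2_nonneg _ _)) (sobNorm2_nonneg _ _)) (fun U => ?_) Y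
    · exact this.trans (le_of_eq (by ring))
    · have h1 : ‖(k : ℂ) + 1‖ * ‖(evalForm J W V - evalForm J V W) fun _ => U‖ =
          ‖omegaComp D k U V W‖ := by
        rw [← norm_mul, ← norm_neg (omegaComp D k U V W), ← hH]; rfl
      have h2 : 1 ≤ ‖(k : ℂ) + 1‖ := by
        have : (k : ℂ) + 1 = ((k + 1 : ℕ) : ℂ) := by push_cast; rfl
        rw [this, Complex.norm_natCast]
        exact_mod_cast Nat.le_add_left 1 k
      calc ‖(evalForm J W V - evalForm J V W) fun _ => U‖
          ≤ ‖(k : ℂ) + 1‖ * ‖(evalForm J W V - evalForm J V W) fun _ => U‖ :=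
            le_mul_of_one_le_left (norm_nonneg _) h2
        _ ≤ C * sobNorm2 s' U ^ k * sobNorm2 (-s) V * sobNorm2 (-s) W := h1 ▸ h U V W
        _ = _ := by ring
  obtain ⟨G, hG1, hG2, hG3, hG⟩ := exists_correction H hsymm hbdd htrans hreal hpair
  refine ⟨G, hG1, hG2, hG3, fun U V W => ?_⟩
  rw [← hH, ← hG, hG1.der_eq, hG1.der_eq, map_smul, map_smul, LinearMap.smul_apply, smul_eq_mul,
    smul_eq_mul, mul_add]

end Primitive

/-! ### Coefficients of polynomials -/

/-- The weights are the rows of the inverse of the Vandermonde matrix at the distinct nodes 1/n,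
2/n, …, 1. They are real, so coefficients of vector-valued polynomials can be extracted without
destroying reality. -/
theorem exists_weights (n : ℕ) : ∃ (t : Fin n → ℝ) (w : ℕ → Fin n → ℝ),
    (∀ j, 0 < t j ∧ t j ≤ 1) ∧
      ∀ k < n, ∀ q < n, ∑ j, w k j * t j ^ q = if k = q then 1 else 0 := by
  set t : Fin n → ℝ := fun j => ((j : ℕ) + 1 : ℝ) / n with ht
  have hpos : ∀ j : Fin n, (0 : ℝ) < n := fun j => by exact_mod_cast (Nat.zero_le _).trans_lt j.2
  have hinj : Function.Injective t := by
    intro i j h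
    have h1 := (div_left_inj' (hpos i).ne').1 h
    exact Fin.ext (by exact_mod_cast add_right_cancel h1)
  have hdet : IsUnit (Matrix.vandermonde t).det :=
    isUnit_iff_ne_zero.2 (Matrix.det_vandermonde_ne_zero_iff.2 hinj)
  refine ⟨t, fun k j => if h : k < n then (Matrix.vandermonde t)⁻¹ ⟨k, h⟩ j else 0,
    fun j => ⟨div_pos (by positivity) (hpos j), ?_⟩, fun k hk q hq => ?_⟩
  · rw [ht, div_le_one (hpos j)]
    exact_mod_cast j.2
  · have h := congrFun (congrFun (Matrix.nonsing_inv_mul _ hdet) ⟨k, hk⟩) ⟨q, hq⟩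
    rw [Matrix.mul_apply, Matrix.one_apply] at h
    simp only [Matrix.vandermonde_apply, Fin.mk.injEq] at h
    simpa [hk] using h

theorem sum_weights {E : Type*} [AddCommGroup E] [Module ℂ E] {n k : ℕ} {t w : Fin n → ℝ}
    (hk : k < n) (h : ∀ q < n, ∑ j, w j * t j ^ q = if k = q then 1 else 0) (c : ℕ → E) :
    ∑ j, (w j : ℂ) • ∑ q ∈ Finset.range n, (t j : ℂ) ^ q • c q = c k := by
  simp only [Finset.smul_sum, smul_smul]
  rw [Finset.sum_comm]
  have h1 : ∀ q ∈ Finset.range n, ∑ j, ((w j : ℂ) * (t j : ℂ) ^ q) • c q =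
      if q = k then c q else 0 := by
    intro q hq
    rw [← Finset.sum_smul]
    have h2 := congrArg (fun x : ℝ => (x : ℂ)) (h q (Finset.mem_range.1 hq))
    push_cast at h2
    rw [h2]
    by_cases hkq : k = q
    · subst hkq; simp
    · simp [hkq, Ne.symm hkq]
  rw [Finset.sum_congr rfl h1, Finset.sum_ite_eq', if_pos (Finset.mem_range.2 hk)]

theorem exists_coeff_bound (n : ℕ) : ∃ K : ℝ, 0 ≤ K ∧ ∀ (c : ℕ → ℂ) (M : ℝ),
    (∀ t : ℝ, 0 < t → t ≤ 1 → ‖∑ q ∈ Finset.range n, (t : ℂ) ^ q • c q‖ ≤ M) →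
      ∀ k < n, ‖c k‖ ≤ K * M := by
  obtain ⟨t, w, ht, hw⟩ := exists_weights n
  refine ⟨∑ k ∈ Finset.range n, ∑ j, |w k j|, by positivity, fun c M h k hk => ?_⟩
  have h0 : 0 ≤ M := (norm_nonneg _).trans (h 1 one_pos le_rfl)
  rw [← sum_weights hk (hw k hk) c]
  have h1 : ∑ j, |w k j| ≤ ∑ k ∈ Finset.range n, ∑ j, |w k j| :=
    Finset.single_le_sum (f := fun k => ∑ j, |w k j|) (fun _ _ => by positivity)
      (Finset.mem_range.2 hk)
  refine (norm_sum_le _ _).trans ((Finset.sum_le_sum fun j _ => ?_).trans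
    ((Finset.sum_mul _ _ M).symm.le.trans (mul_le_mul_of_nonneg_right h1 h0)))
  rw [norm_smul, Complex.norm_real, Real.norm_eq_abs]
  exact mul_le_mul_of_nonneg_left (h _ (ht j).1 (ht j).2) (abs_nonneg _)

/-- Dilating by δ gives a polynomial of size δ^{N+1} on (0, 1], whose coefficient of index k is δ^k
c_k. By `exists_coeff_bound` and k ≤ N, the norm of c_k is at most a constant times δ, which tends
to zero. -/
theorem coeff_eq_zero {n N : ℕ} {c : ℕ → ℂ}
    (h : (fun t : ℝ => ∑ q ∈ Finset.range n, (t : ℂ) ^ q • c q) =O[𝓝[>] 0] fun t => t ^ (N + 1))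
    {k : ℕ} (hk : k < n) (hkN : k ≤ N) : c k = 0 := by
  obtain ⟨K, hK, hc⟩ := exists_coeff_bound n
  obtain ⟨A, hA⟩ := h.bound
  obtain ⟨ε, hε, hA⟩ := mem_nhdsGT_iff_exists_Ioc_subset.1 hA
  have hε0 : (0 : ℝ) < ε := hε
  have key : ∀ δ : ℝ, 0 < δ → δ ≤ min ε 1 → ‖c k‖ ≤ K * |A| * δ := by
    intro δ hδ hδε
    have h1 := hc (fun q => (δ : ℂ) ^ q • c q) (|A| * δ ^ (N + 1)) (fun t ht ht1 => by
      have h2 : t * δ ∈ Set.Ioc 0 ε :=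
        ⟨by positivity, by nlinarith [hδε.trans (min_le_left ε 1)]⟩
      have h3 := hA h2
      simp only [Set.mem_ofPred_eq, Complex.ofReal_mul, mul_pow] at h3
      simp only [smul_smul]
      refine h3.trans ?_
      rw [Real.norm_eq_abs, abs_of_nonneg (by positivity)]
      have h4 : t ^ (N + 1) ≤ 1 := pow_le_one₀ ht.le ht1
      have h5 : (0 : ℝ) ≤ δ ^ (N + 1) := by positivity
      exact mul_le_mul (le_abs_self A) (by nlinarith) (by positivity) (abs_nonneg A)) k hk
    rw [norm_smul, norm_pow, Complex.norm_real, Real.norm_eq_abs, abs_of_pos hδ] at h1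
    have h6 : δ ^ (N + 1) ≤ δ ^ k * δ := by
      rw [← pow_succ]
      exact pow_le_pow_of_le_one hδ.le (hδε.trans (min_le_right _ _)) (by omega)
    have h7 : δ ^ k * ‖c k‖ ≤ δ ^ k * (K * |A| * δ) := by
      refine h1.trans ?_
      have := mul_le_mul_of_nonneg_left h6 (mul_nonneg hK (abs_nonneg A))
      linarith
    exact le_of_mul_le_mul_left h7 (by positivity)
  have h0 : Tendsto (fun δ : ℝ => K * |A| * δ) (𝓝[>] 0) (𝓝 0) := by
    have : Tendsto (fun δ : ℝ => K * |A| * δ) (𝓝 0) (𝓝 (K * |A| * 0)) :=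
      (continuous_const.mul continuous_id).tendsto 0
    rw [mul_zero] at this
    exact this.mono_left nhdsWithin_le_nhds
  have h1 : ∀ᶠ δ in 𝓝[>] (0 : ℝ), ‖c k‖ ≤ K * |A| * δ :=
    mem_nhdsGT_iff_exists_Ioc_subset.2 ⟨min ε 1, lt_min hε0 one_pos, fun δ hδ => key δ hδ.1 hδ.2⟩
  exact norm_le_zero_iff.1 (ge_of_tendsto h0 h1)

/-! ### Real-to-real matrices -/

theorem conjH_coeff (u : Hinf) (j : ℤ) : (conjH u).1 j = (starRingEnd ℂ) (u.1 (-j)) := rfl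

theorem conjH_conjH (u : Hinf) : conjH (conjH u) = u :=
  Subtype.ext (funext fun j => by rw [conjH_coeff, conjH_coeff, neg_neg, Complex.conj_conj])

theorem conjH_add (u v : Hinf) : conjH (u + v) = conjH u + conjH v :=
  Subtype.ext (funext fun j => map_add (starRingEnd ℂ) (u.1 (-j)) (v.1 (-j)))

theorem conjH_smul (c : ℂ) (u : Hinf) : conjH (c • u) = (starRingEnd ℂ) c • conjH u :=
  Subtype.ext (funext fun j => map_mul (starRingEnd ℂ) c (u.1 (-j)))

theorem act_add (A B : LinMat) (V : Hinf2) : (A + B).act V = A.act V + B.act V := by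
  funext σ
  simp [LinMat.act, Finset.sum_add_distrib]

theorem act_one (V : Hinf2) : LinMat.act 1 V = V := by
  funext σ
  match σ with
  | 0 => simp [LinMat.act, Fin.sum_univ_two]
  | 1 => simp [LinMat.act, Fin.sum_univ_two]

theorem act_zero (V : Hinf2) : LinMat.act 0 V = 0 := by
  funext σ
  simp [LinMat.act]

theorem act_sum {ι : Type*} (T : Finset ι) (A : ι → LinMat) (V : Hinf2) :
    LinMat.act (∑ i ∈ T, A i) V = ∑ i ∈ T, (A i).act V := by
  classical
  induction T using Finset.induction_on with
  | empty => rw [Finset.sum_empty, Finset.sum_empty, act_zero]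
  | insert a T ha ih => rw [Finset.sum_insert ha, Finset.sum_insert ha, act_add, ih]

theorem RealToReal.act {A : Hinf2 → LinMat} (hA : RealToReal A) {U V : Hinf2}
    (hU : IsRealPair U) (hV : IsRealPair V) : IsRealPair ((A U).act V) := by
  change ∑ σ', A U 1 σ' (V σ') = conjH (∑ σ', A U 0 σ' (V σ'))
  rw [Fin.sum_univ_two, Fin.sum_univ_two, hV, (hA U hU _).1, (hA U hU _).2, conjH_conjH, conjH_add,
    add_comm]

/-- Real pairs (w, conj w) give only the sum of the two required identities; replacing w by i w
changes the sign of the conjugate-linear terms and separates them. -/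
theorem realToReal_of_act {A : Hinf2 → LinMat}
    (h : ∀ U V, IsRealPair U → IsRealPair V → IsRealPair ((A U).act V)) : RealToReal A := by
  intro U hU
  have key : ∀ w, A U 1 0 w + A U 1 1 (conjH w) = conjH (A U 0 0 w) + conjH (A U 0 1 (conjH w)) := by
    intro w
    have h1 := h U ![w, conjH w] hU rfl
    change ∑ σ', A U 1 σ' (![w, conjH w] σ') = conjH (∑ σ', A U 0 σ' (![w, conjH w] σ')) at h1
    rwa [Fin.sum_univ_two, Fin.sum_univ_two, conjH_add] at h1
  have key' : ∀ w, A U 1 0 w - A U 1 1 (conjH w) = conjH (A U 0 1 (conjH w)) - conjH (A U 0 0 w) := by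
    intro w
    have h1 := key (Complex.I • w)
    simp only [conjH_smul, map_smul, Complex.conj_I] at h1
    have h2 := congrArg (fun x => (-Complex.I) • x) h1
    simp only [smul_add, smul_smul, neg_mul, mul_neg, Complex.I_mul_I, neg_neg, neg_one_smul,
      one_smul, map_neg] at h2
    simpa [sub_eq_add_neg, add_comm, conjH_smul] using h2
  have h2 : (2 : ℂ) ≠ 0 := two_ne_zero
  intro v
  constructor
  · have h3 := key (conjH v)
    have h4 := key' (conjH v)
    rw [conjH_conjH] at h3 h4
    have h5 : (2 : ℂ) • A U 1 1 v = (2 : ℂ) • conjH (A U 0 0 (conjH v)) := by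
      rw [two_smul, two_smul]
      have := congrArg₂ (fun x y => x - y) h3 h4
      calc A U 1 1 v + A U 1 1 v = A U 1 0 (conjH v) + A U 1 1 v - (A U 1 0 (conjH v) - A U 1 1 v) := by
            abel
        _ = _ := by rw [this]; abel
    exact smul_right_injective _ h2 h5
  · have h3 := key v
    have h4 := key' v
    have h5 : (2 : ℂ) • A U 1 0 v = (2 : ℂ) • conjH (A U 0 1 (conjH v)) := by
      rw [two_smul, two_smul]
      have := congrArg₂ (fun x y => x + y) h3 h4
      calc A U 1 0 v + A U 1 0 v = A U 1 0 v + A U 1 1 (conjH v) + (A U 1 0 v - A U 1 1 (conjH v)) := by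
            abel
        _ = _ := by rw [this]; abel
    exact smul_right_injective _ h2 h5

/-! ### Pluri-homogeneous maps and their components -/

theorem sum_range_eq_add_sum_Icc {E : Type*} [AddCommMonoid E] {p L : ℕ} (hp : 1 ≤ p) {f : ℕ → E}
    (h : ∀ q, 1 ≤ q → q < p → f q = 0) :
    ∑ q ∈ Finset.range (L + 1), f q = f 0 + ∑ q ∈ Finset.Icc p L, f q := by
  rw [Finset.sum_range_eq_add_Ico _ (Nat.succ_pos L)]
  congr 1
  refine (Finset.sum_subset (fun q hq => ?_) fun q hq hq' => ?_).symm
  · rw [Finset.mem_Icc] at hq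
    rw [Finset.mem_Ico]; omega
  · rw [Finset.mem_Ico] at hq
    rw [Finset.mem_Icc] at hq'
    exact h q hq.1 (by omega)

theorem act_one_add_pluri (p N : ℕ) (M : (q : ℕ) → OpMat q) (U V : Hinf2) :
    LinMat.act (1 + pluri p N M U) V =
      V + ∑ q ∈ Finset.Icc p N, LinMat.act ((M q).eval U) V := by
  rw [act_add, act_one, pluri, act_sum]

theorem snoc_const_self {α : Type*} {q : ℕ} (U : α) :
    (Fin.snoc (fun _ : Fin q => U) U : Fin (q + 1) → α) = fun _ => U := by
  funext i
  induction i using Fin.lastCases <;> simp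

theorem polyMap_eq_pluriMap {p L : ℕ} (hp : 1 ≤ p) {D : (q : ℕ) → VF (q + 1)}
    (h0 : ∀ U, D 0 (fun _ => U) = U) (hgap : ∀ q, 1 ≤ q → q < p → D q = 0) (U : Hinf2) :
    polyMap L D U = pluriMap p L (fun q => opMat (D q)) U := by
  rw [polyMap, sum_range_eq_add_sum_Icc hp (fun q h1 h2 => by rw [hgap q h1 h2]; rfl), h0,
    pluriMap, act_one_add_pluri]
  simp only [opMat_eval_act, snoc_const_self]

theorem der_zero_comp {D : (q : ℕ) → VF (q + 1)} (h0 : ∀ U, D 0 (fun _ => U) = U) (U V : Hinf2) :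
    der (D 0) U V = V := by
  rw [der_eq_snoc]
  have : (Fin.snoc (fun _ : Fin 0 => U) V : Fin 1 → Hinf2) = fun _ => V := by
    funext i
    induction i using Fin.lastCases with
    | last => exact Fin.snoc_last (α := fun _ => Hinf2) V _
    | cast i => exact i.elim0
  rw [this, h0, Finset.univ_eq_empty, Finset.sum_empty, add_zero]

theorem polyDer_eq_dPluriMap {p L : ℕ} (hp : 1 ≤ p) {D : (q : ℕ) → VF (q + 1)}
    (h0 : ∀ U, D 0 (fun _ => U) = U) (hgap : ∀ q, 1 ≤ q → q < p → D q = 0) (U V : Hinf2) :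
    polyDer L D U V = dPluriMap p L (fun q => opMat (D q)) U V := by
  rw [polyDer, sum_range_eq_add_sum_Icc hp (fun q h1 h2 => by rw [hgap q h1 h2, der_zero]),
    der_zero_comp h0, dPluriMap, act_one_add_pluri, add_assoc, ← Finset.sum_add_distrib]
  simp only [opMat_eval_act, opMat_dEval_act, der_eq_snoc]

/-! ### The components of a spectrally localized map -/

/-- The multilinear vector field `(U₁, …, U_q, V) ↦ M(U₁, …, U_q) V`. -/
def matVF {q : ℕ} (M : OpMat q) : VF (q + 1) := ∑ σ, ∑ σ', entryVF (M σ σ') σ σ'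

theorem matVF_apply {q : ℕ} (M : OpMat q) (X : Fin (q + 1) → Hinf2) :
    matVF M X = ∑ σ, ∑ σ', entryVF (M σ σ') σ σ' X := by
  rw [matVF, sum_apply]
  exact Finset.sum_congr rfl fun σ _ => sum_apply _ _ _

theorem matVF_snoc {q : ℕ} (M : OpMat q) (U V : Hinf2) :
    matVF M (Fin.snoc (fun _ : Fin q => U) V) = LinMat.act (M.eval U) V := by
  rw [matVF_apply]
  simp only [entryVF_apply, Fin.init_snoc, Fin.snoc_last]
  funext τ
  simp only [Finset.sum_apply, LinMat.act]
  rw [Finset.sum_comm]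
  refine Finset.sum_congr rfl fun σ' _ => ?_
  exact Finset.sum_pi_single τ (fun σ => M σ σ' (fun _ => U) (V σ')) Finset.univ |>.trans
    (if_pos (Finset.mem_univ τ))

theorem matVF_bdd {q : ℕ} {m : ℝ} {M : OpMat q} (hM : ∀ σ σ', IsHomOp m (M σ σ')) (s : ℝ) :
    ∃ s' C : ℝ, 0 ≤ C ∧ ∀ X, sobNorm2 s (matVF M X) ≤ C * ∏ i, sobNorm2 s' (X i) := by
  choose a C hC h using fun σ σ' => entryVF_bdd (hM σ σ') σ σ' s
  obtain ⟨S, hS⟩ := exists_forall_le_real fun p : Fin 2 × Fin 2 => a p.1 p.2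
  refine ⟨S, ∑ σ, ∑ σ', C σ σ', Finset.sum_nonneg fun _ _ => Finset.sum_nonneg fun _ _ => hC _ _,
    fun X => ?_⟩
  rw [matVF_apply, Finset.sum_mul]
  refine (sobNorm2_sum_le _ _ _).trans (Finset.sum_le_sum fun σ _ => ?_)
  rw [Finset.sum_mul]
  refine (sobNorm2_sum_le _ _ _).trans (Finset.sum_le_sum fun σ' _ => (h _ _ X).trans ?_)
  exact mul_le_mul_of_nonneg_left (prod_sobNorm2_mono (hS (σ, σ')) X) (hC _ _)

theorem matVF_trans {q : ℕ} {m : ℝ} {M : OpMat q} (hM : ∀ σ σ', IsHomOp m (M σ σ')) (ς : ℝ)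
    (X : Fin (q + 1) → Hinf2) : matVF M (fun i => trans2 ς (X i)) = trans2 ς (matVF M X) := by
  rw [matVF_apply, matVF_apply]
  refine Eq.symm ((map_sum (transL ς) _ _).trans (Finset.sum_congr rfl fun σ _ =>
    (map_sum (transL ς) _ _).trans (Finset.sum_congr rfl fun σ' _ => ?_)))
  rw [transL_apply, entryVF_apply, entryVF_apply, trans2_single]
  congr 1
  exact ((hM σ σ').translation ς (Fin.init X) (X (Fin.last q) σ')).symm

theorem symmetrize_bdd {n : ℕ} {F : VF n} {s s' C : ℝ}
    (h : ∀ X, sobNorm2 s (F X) ≤ C * ∏ i, sobNorm2 s' (X i)) (X : Fin n → Hinf2) :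
    sobNorm2 s (symmetrize F X) ≤ C * ∏ i, sobNorm2 s' (X i) := by
  rw [symmetrize_apply, sobNorm2_smul, norm_inv, Complex.norm_natCast]
  have h1 : sobNorm2 s (∑ π : Equiv.Perm (Fin n), F (fun i => X (π i))) ≤
      n.factorial * (C * ∏ i, sobNorm2 s' (X i)) := by
    refine (sobNorm2_sum_le _ _ _).trans ((Finset.sum_le_sum (g := fun _ =>
      C * ∏ i, sobNorm2 s' (X i)) fun π _ => (h _).trans (le_of_eq ?_)).trans (le_of_eq ?_))
    · rw [Equiv.prod_comp π (fun i => sobNorm2 s' (X i))]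
    · rw [Finset.sum_const, Finset.card_univ, Fintype.card_perm, Fintype.card_fin, nsmul_eq_mul]
  rw [inv_mul_le_iff₀ (by exact_mod_cast n.factorial_pos)]
  exact h1

theorem symmetrize_trans {n : ℕ} {F : VF n} {ς : ℝ}
    (h : ∀ X, F (fun i => trans2 ς (X i)) = trans2 ς (F X)) (X : Fin n → Hinf2) :
    symmetrize F (fun i => trans2 ς (X i)) = trans2 ς (symmetrize F X) := by
  rw [symmetrize_apply, symmetrize_apply, ← transL_apply, map_smul, map_sum]
  congr 1
  exact Finset.sum_congr rfl fun π _ => h _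

theorem matVF_tame {q : ℕ} {M : OpMat q} (hM : M.IsLoc) :
    Tame (fun U V => LinMat.act (M.eval U) V) := by
  obtain ⟨m, hm⟩ := hM
  have h : Tame (fun U V => ∑ σ, ∑ σ', entryVF (M σ σ') σ σ'
      (Function.update (fun _ => U) (Fin.last q) V)) :=
    Tame.sum _ fun σ _ => Tame.sum _ fun σ' _ => tame_of_slot (entryVF_tame_last (hm σ σ') σ σ')
  simp only [← matVF_apply, ← snoc_const_eq, matVF_snoc] at h
  exact h

/-- This is the contribution of one degree to dΦ(U) - B(U): V runs through all slots but the last.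
-/
theorem matVF_smoothing {q : ℕ} {M : OpMat q} (hM : M.IsLoc) :
    Smoothing (fun U V => ∑ i : Fin q, matVF M (Function.update (fun _ => U) i.castSucc V)) := by
  obtain ⟨m, hm⟩ := hM
  simp only [matVF_apply]
  exact Smoothing.sum _ fun i _ => Smoothing.sum _ fun σ _ => Smoothing.sum _ fun σ' _ =>
    smoothing_of_slot (entryVF_smoothing (hm σ σ') σ σ' (Fin.castSucc_ne_last i))

theorem der_matVF {q : ℕ} (M : OpMat q) (U V : Hinf2) :
    der (matVF M) U V = LinMat.act (M.eval U) V +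
      ∑ i : Fin q, matVF M (Function.update (fun _ => U) i.castSucc V) := by
  rw [der, Fin.sum_univ_castSucc, ← snoc_const_eq, matVF_snoc, add_comm]

/-- The identity as a multilinear map in one variable. -/
def idVF : VF 1 := MultilinearMap.ofSubsingleton ℂ Hinf2 Hinf2 (0 : Fin 1) LinearMap.id

theorem idVF_apply (X : Fin 1 → Hinf2) : idVF X = X 0 := rfl

theorem isSymm_fin_one (F : VF 1) : IsSymm F := fun π X => by
  congr 1
  funext i
  congr 1
  exact Subsingleton.elim _ _

theorem isNice_idVF : IsNice idVF where
  bdd s := ⟨s, 1, zero_le_one, fun X => by simp [idVF_apply]⟩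
  trans _ _ := rfl
  real _ hX := hX 0

/-- The symmetric components of `U ↦ U + ∑ M_q(U) U`. -/
def matComp (p N : ℕ) (M : (q : ℕ) → OpMat q) : (q : ℕ) → VF (q + 1)
  | 0 => idVF
  | q + 1 => if q + 1 ∈ Finset.Icc p N then symmetrize (matVF (M (q + 1))) else 0

section Components

variable {p N : ℕ} {M : (q : ℕ) → OpMat q}

theorem matComp_of_mem (hp : 1 ≤ p) {q : ℕ} (hq : q ∈ Finset.Icc p N) :
    matComp p N M q = symmetrize (matVF (M q)) := by
  match q with
  | 0 => rw [Finset.mem_Icc] at hq; omega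
  | q + 1 => exact if_pos hq

theorem matComp_of_notMem {q : ℕ} (hq0 : 1 ≤ q) (hq : q ∉ Finset.Icc p N) :
    matComp p N M q = 0 := by
  match q with
  | 0 => omega
  | q + 1 => exact if_neg hq

theorem isSymm_matComp (q : ℕ) : IsSymm (matComp p N M q) := by
  match q with
  | 0 => exact isSymm_fin_one _
  | q + 1 =>
    rw [matComp]
    split_ifs
    · exact isSymm_symmetrize _
    · exact isSymm_zero

theorem matComp_zero (U : Hinf2) : matComp p N M 0 (fun _ => U) = U := rfl

theorem matComp_gap {q : ℕ} (h1 : 1 ≤ q) (h2 : q < p) : matComp p N M q = 0 :=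
  matComp_of_notMem h1 (by rw [Finset.mem_Icc]; omega)

theorem matComp_top {q : ℕ} (h1 : N < q) : matComp p N M q = 0 :=
  matComp_of_notMem (by omega) (by rw [Finset.mem_Icc]; omega)

theorem polyMap_matComp (hp : 1 ≤ p) (U : Hinf2) :
    polyMap N (matComp p N M) U = pluriMap p N M U := by
  rw [polyMap, sum_range_eq_add_sum_Icc hp (fun q h1 h2 => by rw [matComp_gap h1 h2]; rfl),
    matComp_zero, pluriMap, act_one_add_pluri]
  congr 1
  refine Finset.sum_congr rfl fun q hq => ?_
  rw [matComp_of_mem hp hq, symmetrize_diag, ← matVF_snoc, snoc_const_self]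

theorem polyDer_matComp (hp : 1 ≤ p) (U V : Hinf2) :
    polyDer N (matComp p N M) U V = LinMat.act (1 + pluri p N M U) V +
      ∑ q ∈ Finset.Icc p N, ∑ i : Fin q,
        matVF (M q) (Function.update (fun _ => U) i.castSucc V) := by
  rw [polyDer, sum_range_eq_add_sum_Icc hp (fun q h1 h2 => by rw [matComp_gap h1 h2, der_zero]),
    der_zero_comp matComp_zero, act_one_add_pluri, add_assoc, ← Finset.sum_add_distrib]
  congr 1
  refine Finset.sum_congr rfl fun q hq => ?_
  rw [matComp_of_mem hp hq, der_symmetrize, der_matVF]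

theorem tame_linear (hM : ∀ q ∈ Finset.Icc p N, (M q).IsLoc) :
    Tame (fun U V => LinMat.act (1 + pluri p N M U) V) := by
  simp only [act_one_add_pluri]
  exact Tame.snd.add (Tame.sum _ fun q hq => matVF_tame (hM q hq))

theorem smul_diag {q : ℕ} (F : VF (q + 1)) (c : ℂ) (U : Hinf2) :
    F (fun _ => c • U) = c ^ (q + 1) • F (fun _ => U) := by
  have h := F.map_smul_univ (fun _ => c) (fun _ => U)
  rwa [Finset.prod_const, Finset.card_univ, Fintype.card_fin] at h

/-- Reality is assumed for the whole sum B(U) only. Each component is a real combination of the real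
pairs t⁻¹Φ(tU), the division accounting for the extra argument of each component. -/
theorem matComp_real (hp : 1 ≤ p) (hr : RealToReal (fun U => 1 + pluri p N M U)) {q : ℕ}
    {U : Hinf2} (hU : IsRealPair U) : IsRealPair (matComp p N M q (fun _ => U)) := by
  rcases le_or_gt q N with hq | hq
  · obtain ⟨t, w, ht, hw⟩ := exists_weights (N + 1)
    rw [← sum_weights (Nat.lt_succ_of_le hq) (hw q (Nat.lt_succ_of_le hq))
      (fun q => matComp p N M q (fun _ => U))]
    refine IsRealPair.sum fun j _ => IsRealPair.smul _ ?_
    have ht0 : (t j : ℂ) ≠ 0 := by exact_mod_cast (ht j).1.ne'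
    have h1 : ∑ q ∈ Finset.range (N + 1), (t j : ℂ) ^ q • matComp p N M q (fun _ => U) =
        (((t j)⁻¹ : ℝ) : ℂ) • pluriMap p N M ((t j : ℂ) • U) := by
      rw [← polyMap_matComp hp, polyMap, Finset.smul_sum]
      refine Finset.sum_congr rfl fun q _ => ?_
      rw [smul_diag, smul_smul, pow_succ, Complex.ofReal_inv, mul_comm, mul_assoc,
        mul_inv_cancel₀ ht0, mul_one]
    rw [h1]
    exact (hr.act (hU.smul _) (hU.smul _)).smul _
  · rw [matComp_top hq]
    exact isRealPair_zero

theorem isNice_matComp (hp : 1 ≤ p) (hM : ∀ q ∈ Finset.Icc p N, (M q).IsLoc)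
    (hr : RealToReal (fun U => 1 + pluri p N M U)) (q : ℕ) : IsNice (matComp p N M q) := by
  by_cases hq : q ∈ Finset.Icc p N
  · obtain ⟨m, hm⟩ := hM q hq
    have hm' := fun σ σ' => (hm σ σ').toIsHomOp
    refine ⟨fun s => ?_, fun ς X => ?_, fun X hX => ?_⟩
    · obtain ⟨s', C, hC, h⟩ := matVF_bdd hm' s
      refine ⟨s', C, hC, ?_⟩
      rw [matComp_of_mem hp hq]
      exact symmetrize_bdd h
    · rw [matComp_of_mem hp hq]
      exact symmetrize_trans (matVF_trans hm' ς) X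
    · exact (isSymm_matComp q).mem_of_diag (P := IsRealPair) (Q := IsRealPair) isRealPair_zero
        (fun _ _ => IsRealPair.add) isRealPair_zero (fun _ _ => IsRealPair.add)
        (fun r _ h => h.smul r) (fun U hU => matComp_real hp hr hU) X hX
  · match q with
    | 0 => exact isNice_idVF
    | q + 1 =>
      rw [matComp_of_notMem (by omega) hq]
      exact isNice_zero

end Components

/-! ### The linear part of the pullback -/

/-- The homogeneous components of `B(U) V`. -/
def linComp (p N : ℕ) (S : (q : ℕ) → OpMat q) (q : ℕ) (U V : Hinf2) : Hinf2 :=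
  if q = 0 then V else if q ∈ Finset.Icc p N then LinMat.act ((S q).eval U) V else 0

section LinearPart

variable {p N : ℕ} {S : (q : ℕ) → OpMat q}

theorem linComp_top {q : ℕ} (hq : N < q) (U V : Hinf2) : linComp p N S q U V = 0 := by
  rw [linComp, if_neg (by omega), if_neg (by rw [Finset.mem_Icc]; omega)]

theorem eval_smul_act {q : ℕ} (M : OpMat q) (c : ℂ) (U V : Hinf2) :
    LinMat.act (M.eval (c • U)) V = c ^ q • LinMat.act (M.eval U) V := by
  rw [← matVF_snoc, ← matVF_snoc]
  have h := (MultilinearMap.curryRight (matVF M)).map_smul_univ (fun _ => c) (fun _ => U)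
  rw [Finset.prod_const, Finset.card_univ, Fintype.card_fin] at h
  exact congrArg (fun f => f V) h

theorem sum_linComp (hp : 1 ≤ p) {L : ℕ} (hL : N ≤ L) (c : ℂ) (U V : Hinf2) :
    ∑ q ∈ Finset.range (L + 1), c ^ q • linComp p N S q U V =
      LinMat.act (1 + pluri p N S (c • U)) V := by
  rw [← Finset.sum_subset (Finset.range_mono (Nat.succ_le_succ hL)) fun q _ hq => by
      rw [linComp_top (by simpa using hq), smul_zero],
    sum_range_eq_add_sum_Icc hp (fun q h1 h2 => by
      rw [linComp, if_neg (by omega), if_neg (by rw [Finset.mem_Icc]; omega), smul_zero]),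
    act_one_add_pluri, pow_zero, one_smul]
  congr 1
  refine Finset.sum_congr rfl fun q hq => ?_
  rw [eval_smul_act, linComp, if_neg (by rw [Finset.mem_Icc] at hq; omega), if_pos hq]

/-- The component of degree `q` of `B(U)ᵀ E_c B(U)`. -/
def linOmega (p N : ℕ) (S : (q : ℕ) → OpMat q) (q : ℕ) (U V W : Hinf2) : ℂ :=
  ∑ a ∈ Finset.HasAntidiagonal.antidiagonal q,
    omegaL (linComp p N S a.1 U V) (linComp p N S a.2 U W)

theorem omegaL_linear (hp : 1 ≤ p) {L : ℕ} (hL : N ≤ L) (c : ℂ) (U V W : Hinf2) :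
    omegaL (LinMat.act (1 + pluri p N S (c • U)) V) (LinMat.act (1 + pluri p N S (c • U)) W) =
      ∑ q ∈ Finset.range (2 * L + 1), c ^ q • linOmega p N S q U V W := by
  rw [← sum_linComp hp hL, ← sum_linComp hp hL,
    omegaL_sum_sum (fun q hq => by rw [linComp_top (by omega), smul_zero])
      fun q hq => by rw [linComp_top (by omega), smul_zero]]
  refine Finset.sum_congr rfl fun q _ => ?_
  rw [linOmega, Finset.smul_sum]
  refine Finset.sum_congr rfl fun a ha => ?_
  rw [map_smul, map_smul, LinearMap.smul_apply, smul_smul, mul_comm, ← pow_add,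
    Finset.HasAntidiagonal.mem_antidiagonal.1 ha]

/-- The order of the Sobolev space is taken equal to the loss m, so that the image is in `L²` and
can be paired with W. -/
theorem isBigO_act {s₀ r m : ℝ} {A : Hinf2 → LinMat} {n : ℕ}
    (hA : ∀ σ σ', IsNonhomSpecLoc n s₀ r m (fun U => A U σ σ')) (U V W : Hinf2) :
    (fun t : ℝ => bilin ((A ((t : ℂ) • U)).act V) W) =O[𝓝[>] 0] fun t => t ^ n := by
  have e : ∀ t : ℝ, bilin ((A ((t : ℂ) • U)).act V) W =
      ∑ σ, ∑ σ', bilin (Pi.single σ (A ((t : ℂ) • U) σ σ' (V σ'))) W := by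
    intro t
    rw [← bilinL_apply, ← sum_single ((A ((t : ℂ) • U)).act V), map_sum, LinearMap.sum_apply]
    refine Finset.sum_congr rfl fun σ _ => ?_
    have h1 : (Pi.single σ ((A ((t : ℂ) • U)).act V σ) : Hinf2) =
        ∑ σ', Pi.single σ (A ((t : ℂ) • U) σ σ' (V σ')) :=
      map_sum (LinearMap.single ℂ (fun _ : Fin 2 => Hinf) σ) _ _
    rw [h1, map_sum, LinearMap.sum_apply]; rfl
  simp only [e]
  apply Asymptotics.IsBigO.fun_sum
  intro σ _
  apply Asymptotics.IsBigO.fun_sum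
  intro σ' _
  obtain ⟨C, rs, hC, hrs, -, h⟩ := hA σ σ' m
  refine Asymptotics.IsBigO.of_bound
    (C * sobNorm2 s₀ U ^ n * sobNorm m (V σ') * sobNorm2 0 W) ?_
  refine mem_nhdsGT_iff_exists_Ioc_subset.2 ⟨rs / (sobNorm2 s₀ U + 1), ?_, fun t ht => ?_⟩
  · have := sobNorm2_nonneg s₀ U
    exact div_pos hrs (by linarith)
  · have h0 := sobNorm2_nonneg s₀ U
    have ht0 : 0 < t := ht.1
    have hnt : sobNorm2 s₀ ((t : ℂ) • U) = t * sobNorm2 s₀ U := by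
      rw [sobNorm2_smul, Complex.norm_real, Real.norm_eq_abs, abs_of_pos ht0]
    have h1 := (le_div_iff₀ (by linarith)).1 ht.2
    have h2 := h ((t : ℂ) • U) (V σ') (by rw [hnt]; nlinarith)
    rw [hnt, sub_self] at h2
    have h3 := norm_bilin_le 0 (Pi.single σ (A ((t : ℂ) • U) σ σ' (V σ'))) W
    rw [sobNorm2_single, neg_zero] at h3
    have h4 := mul_le_mul_of_nonneg_right h2 (sobNorm2_nonneg 0 W)
    change ‖_‖ ≤ _ * ‖t ^ n‖
    rw [Real.norm_eq_abs, abs_of_nonneg (by positivity)]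
    refine h3.trans (h4.trans (le_of_eq ?_))
    rw [mul_pow]; ring

/-- Along a ray tU the defect of symplecticity is a polynomial in t and is O(t^{N+1}), so its
coefficients up to N vanish. The degree 0 part is Ω_c itself and is subtracted first. -/
theorem linOmega_eq_zero (hp : 1 ≤ p) (hB : LinSymplecticUpTo N (fun U => 1 + pluri p N S U))
    {q : ℕ} (hq : 1 ≤ q) (hqN : q ≤ N) (U V W : Hinf2) : linOmega p N S q U V W = 0 := by
  obtain ⟨-, s₀, r, m, A, hs₀, hr, hA, h⟩ := hB
  have h0 : linOmega p N S 0 U V W = omegaL V W := by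
    rw [linOmega, Finset.Nat.antidiagonal_zero, Finset.sum_singleton]
    rfl
  set c : ℕ → ℂ := fun q => linOmega p N S q U V W - if q = 0 then omegaL V W else 0 with hc
  have hsum : ∀ t : ℝ, ∑ q ∈ Finset.range (2 * N + 1), (t : ℂ) ^ q • c q =
      omegaL (LinMat.act (1 + pluri p N S ((t : ℂ) • U)) V)
        (LinMat.act (1 + pluri p N S ((t : ℂ) • U)) W) - omegaL V W := by
    intro t
    rw [omegaL_linear hp le_rfl, hc]
    simp only [smul_sub, Finset.sum_sub_distrib]
    congr 1
    rw [Finset.sum_eq_single_of_mem 0 (Finset.mem_range.2 (by omega))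
      fun q _ hq => by rw [if_neg hq, smul_zero], if_pos rfl, pow_zero, one_smul]
  have hO : (fun t : ℝ => ∑ q ∈ Finset.range (2 * N + 1), (t : ℂ) ^ q • c q) =O[𝓝[>] 0]
      fun t => t ^ (N + 1) := by
    refine (isBigO_act hA U V W).congr' ?_ EventuallyEq.rfl
    refine mem_nhdsGT_iff_exists_Ioc_subset.2 ⟨r / (2 * (sobNorm2 s₀ U + 1)), ?_, fun t ht => ?_⟩
    · have := sobNorm2_nonneg s₀ U
      exact div_pos hr (by linarith)
    · have h0 := sobNorm2_nonneg s₀ U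
      have ht0 : 0 < t := ht.1
      have h1 := (le_div_iff₀ (by linarith)).1 ht.2
      have h2 := h ((t : ℂ) • U) (by
        rw [sobNorm2_smul, Complex.norm_real, Real.norm_eq_abs, abs_of_pos ht0]
        nlinarith) V W
      change bilin ((A ((t : ℂ) • U)).act V) W = ∑ q ∈ Finset.range (2 * N + 1), (t : ℂ) ^ q • c q
      rw [hsum]
      exact (sub_eq_of_eq_add' h2).symm
  have := coeff_eq_zero hO (k := q) (by omega) hqN
  simpa [hc, show q ≠ 0 by omega] using this

end LinearPart

/-! ### Construction of the correction -/

/-- A map `D = C ∘ Φ`, with `C - Id` regularizing, which is symplectic up to homogeneity `k`. -/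
structure Corrected (p N k : ℕ) (S : (q : ℕ) → OpMat q) (L : ℕ) (G D : (q : ℕ) → VF (q + 1)) :
    Prop where
  G_symm : ∀ q, IsSymm (G q)
  G_nice : ∀ q, IsNice (G q)
  G_reg : ∀ q, IsRegularizing (G q)
  D_symm : ∀ q, IsSymm (D q)
  D_nice : ∀ q, IsNice (D q)
  D_zero : ∀ U, D 0 (fun _ => U) = U
  D_gap : ∀ q, 1 ≤ q → q < p → D q = 0
  D_top : ∀ q, L < q → D q = 0
  le : N ≤ L
  map : ∀ U, polyMap L D U =
    pluriMap p N S U + ∑ q ∈ Finset.Icc p k, G q (fun _ => pluriMap p N S U)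
  der : ∃ T, Smoothing T ∧
    ∀ U V, polyDer L D U V = LinMat.act (1 + pluri p N S U) V + T U V
  omega : ∀ q, 1 ≤ q → q ≤ k → ∀ U V W, omegaComp D q U V W = 0

section Construction

variable {p N : ℕ} {S : (q : ℕ) → OpMat q}

/-- Φ has no components of index between 1 and p - 1, hence neither has the pulled back form, and
the induction starts with C = Id. -/
theorem corrected_base (hp : 1 ≤ p) (hS : ∀ q ∈ Finset.Icc p N, (S q).IsLoc)
    (hr : RealToReal (fun U => 1 + pluri p N S U)) :
    Corrected p N (p - 1) S N (fun _ => 0) (matComp p N S) where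
  G_symm _ := isSymm_zero
  G_nice _ := isNice_zero
  G_reg q i s t := ⟨0, 0, le_rfl, fun X => by simp [sobNorm2_zero]⟩
  D_symm := isSymm_matComp
  D_nice := isNice_matComp hp hS hr
  D_zero := matComp_zero
  D_gap q := matComp_gap
  D_top q := matComp_top
  le := le_rfl
  map U := by
    rw [polyMap_matComp hp, Finset.Icc_eq_empty (by omega), Finset.sum_empty, add_zero]
  der := ⟨_, Smoothing.sum _ fun q hq => matVF_smoothing (hS q hq), polyDer_matComp hp⟩
  omega q h1 h2 U V W := by
    refine Finset.sum_eq_zero fun a ha => ?_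
    rw [Finset.HasAntidiagonal.mem_antidiagonal] at ha
    rcases Nat.eq_zero_or_pos a.1 with h | h
    · rw [matComp_gap (q := a.2) (by omega) (by omega), der_zero, map_zero]
    · rw [matComp_gap (q := a.1) (by omega) (by omega), der_zero, map_zero, LinearMap.zero_apply]

/-- With dD = B + T and T smoothing, the pulled back form differs from Bᵀ E_c B by pairings that
contain T, and Bᵀ E_c B has no component of index q. -/
theorem Corrected.omegaComp_bound {k L : ℕ} {G D : (q : ℕ) → VF (q + 1)}
    (h : Corrected p N k S L G D) (hp : 1 ≤ p) (hS : ∀ q ∈ Finset.Icc p N, (S q).IsLoc)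
    (hB : LinSymplecticUpTo N (fun U => 1 + pluri p N S U)) {q : ℕ} (hq : 1 ≤ q) (hqN : q ≤ N)
    (s : ℝ) : ∃ s' C : ℝ, 0 ≤ C ∧ ∀ U V W, ‖omegaComp D q U V W‖ ≤
      C * sobNorm2 s' U ^ q * sobNorm2 (-s) V * sobNorm2 (-s) W := by
  obtain ⟨T, hT, hder⟩ := h.der
  have hBt := tame_linear hS
  have hDt : Tame (polyDer L D) := by
    have e : polyDer L D = fun U V => LinMat.act (1 + pluri p N S U) V + T U V :=
      funext fun U => funext fun V => hder U V
    rw [e]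
    exact hBt.add hT.tame
  -- The difference is Ω_c(TV, dD W) + Ω_c(BV, TW); antisymmetry puts T in the first place of the
  -- second term.
  obtain ⟨s', C, n, hC, hρ⟩ := ((hT.pair hDt).add (hT.pair hBt).neg_swap) s
  obtain ⟨K, hK, hcoeff⟩ := exists_coeff_bound (2 * L + 1)
  have hLq : q < 2 * L + 1 := by have := h.le; omega
  have hball : ∀ U V W, sobNorm2 s' U ≤ 1 → ‖omegaComp D q U V W‖ ≤
      K * (C * 2 ^ n * sobNorm2 (-s) V * sobNorm2 (-s) W) := by
    intro U V W hU
    -- The estimate is known for the sum over all degrees. The dilations tU stay in the unit ball,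
    -- so the growth in U is bounded by 2^n and each coefficient inherits the bound.
    have h1 := hcoeff (fun q => omegaComp D q U V W - linOmega p N S q U V W)
      (C * 2 ^ n * sobNorm2 (-s) V * sobNorm2 (-s) W) (fun t ht ht1 => ?_) q hLq
    · rwa [linOmega_eq_zero hp hB hq hqN, sub_zero] at h1
    · have e : ∑ q ∈ Finset.range (2 * L + 1),
          (t : ℂ) ^ q • (omegaComp D q U V W - linOmega p N S q U V W) =
          omegaL (T ((t : ℂ) • U) V) (polyDer L D ((t : ℂ) • U) W) +
            -omegaL (T ((t : ℂ) • U) W) (LinMat.act (1 + pluri p N S ((t : ℂ) • U)) V) := by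
        simp only [smul_sub, Finset.sum_sub_distrib]
        rw [← omegaL_linear hp h.le]
        have e1 : ∑ q ∈ Finset.range (2 * L + 1), (t : ℂ) ^ q • omegaComp D q U V W =
            omegaL (polyDer L D ((t : ℂ) • U) V) (polyDer L D ((t : ℂ) • U) W) := by
          rw [omegaL_polyDer h.D_top]
          exact Finset.sum_congr rfl fun q _ => by rw [omegaComp_smul h.D_symm]; rfl
        rw [e1, ← omegaL_antisymm]
        simp only [hder, map_add, LinearMap.add_apply]
        ring
      rw [e]
      refine (hρ _ V W).trans ?_
      have h2 : sobNorm2 s' ((t : ℂ) • U) ≤ 1 := by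
        rw [sobNorm2_smul, Complex.norm_real, Real.norm_eq_abs, abs_of_pos ht]
        exact mul_le_one₀ ht1 (sobNorm2_nonneg _ _) hU
      have h3 : (1 + sobNorm2 s' ((t : ℂ) • U)) ^ n ≤ 2 ^ n := by
        have := sobNorm2_nonneg s' ((t : ℂ) • U)
        exact pow_le_pow_left₀ (by linarith) (by linarith) n
      have h4 := sobNorm2_nonneg (-s) V
      have h5 := sobNorm2_nonneg (-s) W
      exact mul_le_mul_of_nonneg_right (mul_le_mul_of_nonneg_right
        (mul_le_mul_of_nonneg_left h3 hC) h4) h5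
  refine ⟨s', K * (C * 2 ^ n), by positivity, fun U V W => ?_⟩
  -- Homogeneity of degree q extends the bound from the unit ball; U = 0 is treated apart.
  rcases eq_or_ne (sobNorm2 s' U) 0 with hU | hU
  · have e : omegaComp D q U V W = 0 := by
      have := omegaComp_smul h.D_symm q 0 U V W
      rwa [zero_smul, zero_pow (by omega), zero_mul, ← eq_zero_of_sobNorm2_eq_zero hU] at this
    rw [e, norm_zero, hU, zero_pow (by omega)]
    simp
  · have hU' : (sobNorm2 s' U : ℂ) ≠ 0 := by exact_mod_cast hU
    have h0 := sobNorm2_nonneg s' U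
    have e : omegaComp D q U V W = (sobNorm2 s' U : ℂ) ^ q *
        omegaComp D q ((sobNorm2 s' U : ℂ)⁻¹ • U) V W := by
      rw [← omegaComp_smul h.D_symm, smul_smul, mul_inv_cancel₀ hU', one_smul]
    have h1 := hball ((sobNorm2 s' U : ℂ)⁻¹ • U) V W (by
      rw [sobNorm2_smul, norm_inv, Complex.norm_real, Real.norm_eq_abs, abs_of_nonneg h0,
        inv_mul_cancel₀ hU])
    rw [e, norm_mul, norm_pow, Complex.norm_real, Real.norm_eq_abs, abs_of_nonneg h0]
    refine (mul_le_mul_of_nonneg_left h1 (by positivity)).trans (le_of_eq (by ring))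

theorem polyMap_add {L : ℕ} (D E : (q : ℕ) → VF (q + 1)) (U : Hinf2) :
    polyMap L (fun q => D q + E q) U = polyMap L D U + polyMap L E U :=
  Finset.sum_add_distrib

theorem polyDer_add {L : ℕ} (D E : (q : ℕ) → VF (q + 1)) (U V : Hinf2) :
    polyDer L (fun q => D q + E q) U V = polyDer L D U V + polyDer L E U V := by
  simp only [polyDer, der_add, Finset.sum_add_distrib]

theorem omegaComp_add_of_lt {k : ℕ} {D E : (q : ℕ) → VF (q + 1)} (hE : ∀ q, q < k → E q = 0) {q : ℕ}
    (hq : q < k) (U V W : Hinf2) :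
    omegaComp (fun q => D q + E q) q U V W = omegaComp D q U V W := by
  refine Finset.sum_congr rfl fun a ha => ?_
  rw [Finset.HasAntidiagonal.mem_antidiagonal] at ha
  change omegaL (der (D a.1 + E a.1) U V) (der (D a.2 + E a.2) U W) = _
  rw [hE a.1 (by omega), hE a.2 (by omega), add_zero, add_zero]

/-- Since `E` starts at index k ≥ 1, its products with itself have index at least 2k > k, and its
products with `D` reach index k only against the identity component. -/
theorem omegaComp_add_self {k : ℕ} (hk : 1 ≤ k) {D E : (q : ℕ) → VF (q + 1)}
    (hD : ∀ U, D 0 (fun _ => U) = U) (hE : ∀ q, q < k → E q = 0) (U V W : Hinf2) :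
    omegaComp (fun q => D q + E q) k U V W = omegaComp D k U V W +
      (omegaL (der (E k) U V) W + omegaL V (der (E k) U W)) := by
  have h1 : ∑ a ∈ Finset.HasAntidiagonal.antidiagonal k,
      omegaL (der (E a.1) U V) (der (D a.2) U W) = omegaL (der (E k) U V) W := by
    rw [Finset.sum_eq_single_of_mem (k, 0) (Finset.HasAntidiagonal.mem_antidiagonal.2 (add_zero k))
      fun a ha hne => ?_, der_zero_comp hD]
    rw [Finset.HasAntidiagonal.mem_antidiagonal] at ha
    have : a.1 < k := by
      by_contra hlt
      exact hne (Prod.ext (by change a.1 = k; omega) (by change a.2 = 0; omega))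
    rw [hE _ this, der_zero, map_zero, LinearMap.zero_apply]
  have h2 : ∑ a ∈ Finset.HasAntidiagonal.antidiagonal k,
      omegaL (der (D a.1) U V) (der (E a.2) U W) = omegaL V (der (E k) U W) := by
    rw [Finset.sum_eq_single_of_mem (0, k) (Finset.HasAntidiagonal.mem_antidiagonal.2 (zero_add k))
      fun a ha hne => ?_, der_zero_comp hD]
    rw [Finset.HasAntidiagonal.mem_antidiagonal] at ha
    have : a.2 < k := by
      by_contra hlt
      exact hne (Prod.ext (by change a.1 = 0; omega) (by change a.2 = k; omega))
    rw [hE _ this, der_zero, map_zero]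
  rw [← h1, ← h2, omegaComp, omegaComp, ← Finset.sum_add_distrib, ← Finset.sum_add_distrib]
  refine Finset.sum_congr rfl fun a ha => ?_
  rw [Finset.HasAntidiagonal.mem_antidiagonal] at ha
  simp only [der_add, map_add, LinearMap.add_apply]
  have h3 : omegaL (der (E a.1) U V) (der (E a.2) U W) = 0 := by
    rcases lt_or_ge a.1 k with h | h
    · rw [hE _ h, der_zero, map_zero, LinearMap.zero_apply]
    · rw [hE a.2 (by omega), der_zero, map_zero]
  rw [h3]; ring

/-- C is enlarged by a field `F` cancelling the form of index k + 1, so D receives F∘Φ. Its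
component of index k + 1 is F and the lower ones are zero, so earlier cancellations persist. -/
theorem Corrected.step {k L : ℕ} {G D : (q : ℕ) → VF (q + 1)} (h : Corrected p N k S L G D)
    (hp : 1 ≤ p) (hpk : p ≤ k + 1) (hkN : k + 1 ≤ N) (hS : ∀ q ∈ Finset.Icc p N, (S q).IsLoc)
    (hB : LinSymplecticUpTo N (fun U => 1 + pluri p N S U)) :
    ∃ L' G' D', Corrected p N (k + 1) S L' G' D' := by
  obtain ⟨F, hF1, hF2, hF3, hF⟩ := exists_correction_of_omegaComp h.D_symm h.D_nice (k + 1)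
    (h.omegaComp_bound hp hS hB (by omega) hkN)
  obtain ⟨L₁, E, hE1, hE2, hE3, hE4, hE5, hE6, hE7⟩ := exists_comp (L := N) F (matComp p N S) hF2 hF1
    (isNice_matComp hp hS hB.1) matComp_zero
  obtain ⟨T, hT, hder⟩ := h.der
  have hG' : ∀ P : (q : ℕ) → VF (q + 1) → Prop, (∀ q, P q (G q)) → P (k + 1) F →
      ∀ q, P q (Function.update G (k + 1) F q) := by
    intro P h1 h2 q
    by_cases hq : q = k + 1
    · subst hq; rwa [Function.update_self]
    · rw [Function.update_of_ne hq]; exact h1 q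
  refine ⟨max L L₁, Function.update G (k + 1) F, fun q => D q + E q,
    hG' (fun _ g => IsSymm g) h.G_symm hF1, hG' (fun _ g => IsNice g) h.G_nice hF2,
    hG' (fun _ g => IsRegularizing g) h.G_reg hF3, fun q => (h.D_symm q).add (hE1 q),
    fun q => (h.D_nice q).add (hE2 q), fun U => ?_, fun q h1 h2 => ?_, fun q hq => ?_,
    h.le.trans (le_max_left _ _), fun U => ?_, ?_, fun q h1 h2 U V W => ?_⟩
  · rw [hE4 0 (by omega), add_zero, h.D_zero]
  · rw [h.D_gap q h1 h2, hE4 q (by omega), add_zero]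
  · rw [h.D_top q (by omega), hE3 q (by omega), add_zero]
  · rw [polyMap_add, polyMap_of_le (le_max_left L L₁) h.D_top, polyMap_of_le (le_max_right L L₁) hE3,
      h.map, hE6, polyMap_matComp hp, ← Finset.insert_Icc_right_eq_Icc_add_one hpk,
      Finset.sum_insert (by simp), Function.update_self, add_assoc, add_comm (F _)]
    congr 2
    refine Finset.sum_congr rfl fun q hq => ?_
    rw [Function.update_of_ne (by rw [Finset.mem_Icc] at hq; omega)]
  · have hΦ : Growing (polyMap N (matComp p N S)) :=
      Growing.sum _ fun q _ => (isNice_matComp hp hS hB.1 q).growing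
    have hΦ' : Tame (polyDer N (matComp p N S)) := by
      have e : polyDer N (matComp p N S) = _ := funext fun U => funext fun V => polyDer_matComp hp U V
      rw [e]
      exact (tame_linear hS).add (Smoothing.sum _ fun q hq => matVF_smoothing (hS q hq)).tame
    -- The new part of the differential is dF(Φ(U)) applied to dΦ(U)V: a smoothing map after a tame
    -- one.
    refine ⟨_, hT.add (hF3.smoothing.comp hΦ hΦ'), fun U V => ?_⟩
    rw [polyDer_add, polyDer_of_le (le_max_left L L₁) h.D_top,
      polyDer_of_le (le_max_right L L₁) hE3, hder, hE7, add_assoc]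
  · rcases Nat.lt_or_eq_of_le h2 with h3 | h3
    · rw [omegaComp_add_of_lt hE4 h3, h.omega q h1 (by omega)]
    · subst h3
      rw [omegaComp_add_self h1 h.D_zero hE4, hE5, hF, add_neg_cancel]

theorem exists_corrected (hp : 1 ≤ p) (hpN : p ≤ N) (hS : ∀ q ∈ Finset.Icc p N, (S q).IsLoc)
    (hB : LinSymplecticUpTo N (fun U => 1 + pluri p N S U)) :
    ∃ L G D, Corrected p N N S L G D := by
  have key : ∀ k, p - 1 ≤ k → k ≤ N → ∃ L G D, Corrected p N k S L G D := by
    intro k hk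
    induction k, hk using Nat.le_induction with
    | base => exact fun _ => ⟨_, _, _, corrected_base hp hS hB.1⟩
    | succ k hk ih =>
      intro hkN
      obtain ⟨L, G, D, h⟩ := ih (by omega)
      exact h.step hp (by omega) hkN hS hB
  exact key N (by omega) le_rfl

theorem Corrected.symplecticUpTo {L : ℕ} {G D : (q : ℕ) → VF (q + 1)}
    (h : Corrected p N N S L G D) (hp : 1 ≤ p) :
    SymplecticUpTo p N (fun U => pluriMap p N (fun q => opMat (G q)) (pluriMap p N S U)) := by
  refine ⟨L, fun q => opMat (D q), h.le, fun q _ => isOp_opMat (h.D_symm q) (h.D_nice q),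
    fun U => ?_, ?_⟩
  · rw [← polyMap_eq_pluriMap hp h.D_zero h.D_gap, h.map]
    change LinMat.act (1 + pluri p N (fun q => opMat (G q)) _) _ = _
    rw [act_one_add_pluri]
    simp only [opMat_eval_act, snoc_const_self]
  -- The truncation at index N alters only components that do not enter the pulled back form in
  -- degrees up to N; those degrees stay cancelled, and the degrees from N + 1 to 2N form the
  -- remainder.
  · set D' : (q : ℕ) → VF (q + 1) := fun q => if q ≤ N then D q else 0 with hD'
    have hsymm : ∀ q, IsSymm (D' q) := fun q => by
      simp only [hD']
      split_ifs
      · exact h.D_symm q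
      · exact isSymm_zero
    have hnice : ∀ q, IsNice (D' q) := fun q => by
      simp only [hD']
      split_ifs
      · exact h.D_nice q
      · exact isNice_zero
    have htop : ∀ q, N < q → D' q = 0 := fun q hq => if_neg (by omega)
    have hle : ∀ q, q ≤ N → D' q = D q := fun q hq => if_pos hq
    choose Λ hΛ hΛ' using fun q => exists_omegaComp_form hsymm hnice q
    refine ⟨2 * N, Λ, fun q _ => hΛ q, fun U V W => ?_⟩
    have e : ∀ V, dPluriMap p N (fun q => opMat (D q)) U V = polyDer N D' U V := by
      intro V
      rw [← polyDer_eq_dPluriMap hp h.D_zero h.D_gap, polyDer, polyDer]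
      refine Finset.sum_congr rfl fun q hq => ?_
      rw [hle q (by rw [Finset.mem_range] at hq; omega)]
    have hsmall : ∀ q, 1 ≤ q → q < N + 1 → omegaComp D' q U V W = 0 := by
      intro q h1 h2
      rw [← h.omega q h1 (by omega) U V W]
      refine Finset.sum_congr rfl fun a ha => ?_
      rw [Finset.HasAntidiagonal.mem_antidiagonal] at ha
      rw [hle a.1 (by omega), hle a.2 (by omega)]
    rw [e, e, ← omegaL_apply, omegaL_polyDer htop,
      sum_range_eq_add_sum_Icc (p := N + 1) (by omega) hsmall]
    simp only [hΛ']
    congr 1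
    rw [omegaComp, Finset.Nat.antidiagonal_zero, Finset.sum_singleton, hle 0 (Nat.zero_le _),
      der_zero_comp h.D_zero, der_zero_comp h.D_zero, omegaL_apply]

theorem realToReal_pluri_opMat {G : (q : ℕ) → VF (q + 1)} (hG : ∀ q, IsNice (G q)) :
    RealToReal (pluri p N (fun q => opMat (G q))) := by
  refine realToReal_of_act fun U V hU hV => ?_
  rw [pluri, act_sum]
  refine IsRealPair.sum fun q _ => ?_
  rw [opMat_eval_act]
  refine (hG q).real _ fun i => ?_
  induction i using Fin.lastCases with
  | last => simpa using hV
  | cast i => simpa using hU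

end Construction

end PluriHom

end

/-! ### The symplectic correction -/

theorem theorem4p1 (p N : ℕ) (hp : 1 ≤ p) (hpN : p ≤ N) (S : (q : ℕ) → OpMat q)
    (hS : ∀ q ∈ Finset.Icc p N, (S q).IsLoc)
    (hB : LinSymplecticUpTo N (fun U => 1 + pluri p N S U)) :
    ∃ R : (q : ℕ) → OpMat q,
      (∀ ϱ : ℝ, 0 ≤ ϱ → ∀ q ∈ Finset.Icc p N, (R q).IsSmoothing ϱ) ∧
      RealToReal (pluri p N R) ∧
      SymplecticUpTo p N (fun U => pluriMap p N R (pluriMap p N S U)) := by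
  obtain ⟨L, G, D, h⟩ := exists_corrected hp hpN hS hB
  exact ⟨fun q => opMat (G q),
    fun ϱ _ q _ => isSmoothing_opMat (h.G_symm q) (h.G_nice q) (h.G_reg q) ϱ,
    realToReal_pluri_opMat h.G_nice, h.symplecticUpTo hp⟩
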